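/- Let $n,d\ge 1$, $N=2n+1$, $D=2d$, $\mathcal A=\mathbb Z[v,v^{-1}]$. Let $\mathbb F_q$ be a finite field of odd characteristic. Equip $\mathbb F_q^D$ with the symmetric bilinear form with matrix $\begin{bmatrix}0&I_d\\ I_d&0\end{bmatrix}$, let $G=\mathrm{SO}(D)$ be its special orthogonal group, and fix a maximal isotropic subspace $M_d$ (of dimension $d$). Write $|W|$ for $\dim W$ and $U\overset{1}{\subset}W$ for $U\subseteq W$, $|W/U|=1$. Let $\mathscr X$ be the set of flags $0=V_0\subseteq V_1\subseteq\dots\subseteq V_N=\mathbb F_q^D$ (inclusions need not be strict) with $V_i=V_j^\perp$ whenever $i+j=N$. The $G$-orbits on $\mathscr X\times\mathscr X$ are classified by labels independent of $q$: the label of $(V,V')$ consists of the numbers $|V_i\cap V'_j|$ ($0\le i,j\le N$) and, for each of $V$, $V'$, of the information whether the $n$-th step has dimension $<d$, or has dimension $d$ and meets $M_d$ in a subspace of dimension $\equiv d$, respectively $\equiv d-1$, modulo $2$. Let $\mathcal S=\mathcal A_G(\mathscr X\times\mathscr X)$ be the $\mathcal A$-module of $G$-invariant $\mathcal A$-valued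 functions on $\mathscr X\times\mathscr X$ (functions for different $q$ being identified through the labels), with the $\mathcal A$-algebra structure $*$ which at $v=\sqrt q$ becomes $(f*g)(V,V')=\sum_{V''\in\mathscr X}f(V,V'')g(V'',V')$, for every odd prime power $q$. For $i\in[1,n]$, $a\in[1,n+1]$ define functions on $\mathscr X\times\mathscr X$, equal to $0$ outside the indicated cases, by - $E_i(V,V')=v^{-|V'_{i+1}/V'_i|}$ if $V_i\overset{1}{\subset}V'_i$ and $V_j=V'_j$ for all $j\in[1,n]\setminus\{i\}$; - $F_i(V,V')=v^{-|V'_i/V'_{i-1}|}$ if $V'_i\overset{1}{\subset}V_i$ and $V_j=V'_j$ for all $j\in[1,n]\setminus\{i\}$; - $H_a^{\pm1}(V,V')=v^{\mp|V'_a/V'_{a-1}|}$ if $V=V'$; - $J_+(V,V')=1$ if $V=V'$, $|V_n|=d$, $|V_n\cap M_d|\equiv d \bmod 2$; - $J_-(V,V')=1$ if $V=V'$, $|V_n|=d$, $|V_n\cap M_d|\equiv d-1 \bmod 2$; - $J_0=1-J_+-J_-$. Then these functions belong to $\mathcal S$, and in $\mathbb Q(v)\otimes_{\mathcal A}\mathcal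 S$ they satisfy the defining relations of $\mathbf U$, namely, for $i,j\in[1,n]$, $a,b\in[1,n+1]$, $\alpha,\beta\in\{+,0,-\}$: \begin{align*} & J_++J_0+J_-=1,\quad J_\alpha J_\beta=\delta_{\alpha,\beta}J_\alpha,\quad J_\alpha H_a=H_aJ_\alpha,\\ & J_\pm E_i=(1-\delta_{in})E_iJ_\pm,\quad F_iJ_\pm=(1-\delta_{in})J_\pm F_i,\\ & J_\pm F_nE_n-F_nE_nJ_\mp=\tfrac{H_n^{-1}H_{n+1}-H_nH_{n+1}^{-1}}{v-v^{-1}}(J_\pm-J_\mp),\\ & H_aH_b=H_bH_a,\quad H_aH_a^{-1}=H_a^{-1}H_a=1,\\ & H_aE_i=v^{\delta_{ai}-\delta_{a,i+1}-\delta_{a,n+1}\delta_{i,n}}E_iH_a,\quad H_aF_i=v^{-\delta_{ai}+\delta_{a,i+1}+\delta_{a,n+1}\delta_{i,n}}F_iH_a,\\ & E_iF_j-F_jE_i=\delta_{ij}\tfrac{H_iH_{i+1}^{-1}-H_i^{-1}H_{i+1}}{v-v^{-1}}\quad\text{if }(i,j)\ne(n,n),\\ & E_iE_j=E_jE_i,\quad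 F_iF_j=F_jF_i\quad\text{if }|i-j|>1,\\ & E_i^2E_j-(v+v^{-1})E_iE_jE_i+E_jE_i^2=0,\quad F_i^2F_j-(v+v^{-1})F_iF_jF_i+F_jF_i^2=0\quad\text{if }|i-j|=1,\\ & E_n^2F_n+F_nE_n^2=(v+v^{-1})\bigl(E_nF_nE_n-E_n(vH_nH_{n+1}^{-1}+v^{-1}H_n^{-1}H_{n+1})\bigr),\\ & F_n^2E_n+E_nF_n^2=(v+v^{-1})\bigl(F_nE_nF_n-(vH_nH_{n+1}^{-1}+v^{-1}H_n^{-1}H_{n+1})F_n\bigr). \end{align*} Moreover, in $\mathcal S$, $$H_{n+1}\prod_{i=1}^nH_i^2=v^{-D}\qquad\text{and}\qquad \prod_{l=0}^{d}(H_j-v^{-l})=0\quad\text{for all } j\in[1,n].$$ -/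

import Mathlib

open Module
open scoped TensorProduct

namespace TypeD

/-! ### The quadratic space, its special orthogonal group, and isotropic flags -/

/-- The space `F ^ D` with `D = 2 * d`; the coordinates `1, …, d` are indexed by the left summand
and the coordinates `d + 1, …, 2 * d` by the right summand. -/
abbrev Space (d : ℕ) (F : Type) : Type := Fin d ⊕ Fin d → F

/-- The symmetric bilinear form with block matrix `[[0, 1], [1, 0]]` in the standard basis. -/
noncomputable def form (d : ℕ) (F : Type) [Field F] : LinearMap.BilinForm F (Space d F) :=
  Matrix.toBilin' (Matrix.fromBlocks 0 1 1 0)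

/-- The special orthogonal group of the form. -/
def specialOrthogonal (d : ℕ) (F : Type) [Field F] : Subgroup (Space d F ≃ₗ[F] Space d F) where
  carrier := {g | (∀ x y, form d F (g x) (g y) = form d F x y) ∧
    LinearMap.det (g : Space d F →ₗ[F] Space d F) = 1}
  mul_mem' := by
    rintro g h ⟨hg, hg'⟩ ⟨hh, hh'⟩
    refine ⟨fun x y => ?_, ?_⟩
    · rw [LinearEquiv.mul_apply, LinearEquiv.mul_apply, hg, hh]
    · have : ((g * h : Space d F ≃ₗ[F] Space d F) : Space d F →ₗ[F] Space d F)
          = (g : Space d F →ₗ[F] Space d F) * (h : Space d F →ₗ[F] Space d F) := rfl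
      rw [this, map_mul, hg', hh', one_mul]
  one_mem' := ⟨fun _ _ => rfl, LinearMap.det_id⟩
  inv_mem' := by
    rintro g ⟨hg, hg'⟩
    refine ⟨fun x y => ?_, ?_⟩
    · have h := hg (g⁻¹ x) (g⁻¹ y)
      have e : ∀ z, g (g⁻¹ z) = z := fun z => g.apply_symm_apply z
      rw [e, e] at h
      exact h.symm
    · have h := LinearEquiv.det_mul_det_symm g
      rw [hg', one_mul] at h
      exact h

/-- `M` is an isotropic subspace of the maximal dimension `d`. -/
def IsMaximalIsotropic {d : ℕ} {F : Type} [Field F] (M : Submodule F (Space d F)) : Prop :=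
  M ≤ (form d F).orthogonal M ∧ finrank F M = d

/-- The `N`-step flags `0 = V_0 ⊆ V_1 ⊆ … ⊆ V_N`, `N = 2 * n + 1`, such that `V_i` is the
orthogonal complement of `V_j` whenever `i + j = N`. Inclusions need not be strict. -/
@[ext]
structure IsotropicFlag (n d : ℕ) (F : Type) [Field F] where
  step : Fin (2 * n + 2) → Submodule F (Space d F)
  step_zero : step 0 = ⊥
  mono : Monotone step
  perp : ∀ i j : Fin (2 * n + 2), (i : ℕ) + (j : ℕ) = 2 * n + 1 →
    step i = (form d F).orthogonal (step j)

namespace IsotropicFlag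

variable {n d : ℕ} {F : Type} [Field F]

instance [Finite F] : Finite (IsotropicFlag n d F) :=
  Finite.of_injective IsotropicFlag.step fun _ _ h => IsotropicFlag.ext h

noncomputable instance [Finite F] : Fintype (IsotropicFlag n d F) := Fintype.ofFinite _

noncomputable instance : DecidableEq (IsotropicFlag n d F) := Classical.decEq _

/-- The step `V_k` for `k ∈ [0, n + 1]`. -/
def stepAt (V : IsotropicFlag n d F) (k : Fin (n + 2)) : Submodule F (Space d F) :=
  V.step ⟨k, by omega⟩

/-- The middle isotropic step `V_n`. -/
def middle (V : IsotropicFlag n d F) : Submodule F (Space d F) :=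
  V.step ⟨n, by omega⟩

/-- `V.gap a` is the dimension of `V_{k} / V_{k-1}` for `k = a + 1 ∈ [1, n + 1]`. -/
noncomputable def gap (V : IsotropicFlag n d F) (a : Fin (n + 1)) : ℤ :=
  (finrank F (V.stepAt a.succ) : ℤ) - (finrank F (V.stepAt a.castSucc) : ℤ)

/-- `V` and `W` have the same steps `V_j = W_j` for all `j ∈ [1, n]` different from `i + 1`. -/
def AgreeOff (V W : IsotropicFlag n d F) (i : Fin n) : Prop :=
  ∀ j : Fin n, j ≠ i → V.stepAt j.succ.castSucc = W.stepAt j.succ.castSucc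

/-- `V_{i+1}` is contained in `W_{i+1}` with codimension one, and the other steps in `[1, n]`
are the same. -/
def Below (V W : IsotropicFlag n d F) (i : Fin n) : Prop :=
  V.stepAt i.succ.castSucc ≤ W.stepAt i.succ.castSucc ∧
    finrank F (W.stepAt i.succ.castSucc) = finrank F (V.stepAt i.succ.castSucc) + 1 ∧
    V.AgreeOff W i

end IsotropicFlag

/-- The three labels `+`, `0`, `-`. -/
inductive Sgn : Type
  | plus
  | zero
  | minus
  deriving DecidableEq

open Classical in
/-- The piece of the set of flags that contains `V`: `zero` if `dim V_n < d`; if `dim V_n = d`,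
then `plus` or `minus` according to the parity of `dim (V_n ∩ M)` against that of `d`. -/
noncomputable def component {n d : ℕ} {F : Type} [Field F] (M : Submodule F (Space d F))
    (V : IsotropicFlag n d F) : Sgn :=
  if finrank F V.middle = d then
    if finrank F (V.middle ⊓ M : Submodule F (Space d F)) ≡ d [MOD 2] then Sgn.plus
    else Sgn.minus
  else Sgn.zero

/-! ### All finite fields of odd characteristic, and generic invariant functions -/

/-- The index set of the finite fields of odd characteristic, up to isomorphism: `q = p ^ k`. -/
structure OddPrimePower : Type where
  p : ℕ
  k : ℕ
  prime : p.Prime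
  ne_two : p ≠ 2
  k_ne_zero : k ≠ 0

namespace OddPrimePower

instance (q : OddPrimePower) : Fact q.p.Prime := ⟨q.prime⟩

/-- The field with `q = p ^ k` elements. -/
abbrev field (q : OddPrimePower) : Type := GaloisField q.p q.k

/-- The real number `√q` as a unit. -/
noncomputable def sqrtUnit (q : OddPrimePower) : ℝˣ :=
  Units.mk0 (Real.sqrt ((q.p : ℝ) ^ q.k))
    (Real.sqrt_pos.mpr (pow_pos (Nat.cast_pos.mpr q.prime.pos) _)).ne'

end OddPrimePower

/-- The ring `𝒜 = ℤ[v, v⁻¹]`; `v ^ m` is `LaurentPolynomial.T m`. -/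
abbrev LaurentA : Type := LaurentPolynomial ℤ

/-- The field `ℚ(v)`, as the field of fractions of `ℤ[v, v⁻¹]`. -/
abbrev FieldQv : Type := FractionRing LaurentA

/-- The element `v` of `ℚ(v)`. -/
noncomputable def vv : FieldQv := algebraMap LaurentA FieldQv (LaurentPolynomial.T 1)

/-- Specialization `v ↦ √q`. -/
noncomputable def specialize (q : OddPrimePower) : LaurentA →+* ℝ :=
  LaurentPolynomial.eval₂ (Int.castRingHom ℝ) q.sqrtUnit

/-- The set `𝒳` of flags over the field with `q` elements. -/
abbrev Flags (n d : ℕ) (q : OddPrimePower) : Type := IsotropicFlag n d q.field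

/-- A choice of a subspace of `F_q ^ D` for every `q` (the subspace `M_d`). -/
abbrev SubspaceFamily (d : ℕ) : Type := ∀ q : OddPrimePower, Submodule q.field (Space d q.field)

/-- An `𝒜`-valued function on `𝒳 × 𝒳` for every `q`. -/
abbrev FunctionFamily (n d : ℕ) : Type :=
  ∀ q : OddPrimePower, Flags n d q → Flags n d q → LaurentA

/-- Two pairs of flags, over possibly different finite fields, have the same relative position:
all `dim (V_i ∩ V'_j)` agree (equivalently, the matrices with entries
`dim (V_{i-1} + V_i ∩ V'_j) / (V_{i-1} + V_i ∩ V'_{j-1})`, which are the second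
differences of these numbers, agree), and the components of both flags agree. This data is the
label, independent of `q`, of a `G`-orbit on `𝒳 × 𝒳`. -/
def SamePosition {n d : ℕ} (M : SubspaceFamily d) {q q' : OddPrimePower}
    (V V' : Flags n d q) (W W' : Flags n d q') : Prop :=
  (∀ i j, finrank q.field (V.step i ⊓ V'.step j : Submodule q.field (Space d q.field)) =
    finrank q'.field (W.step i ⊓ W'.step j : Submodule q'.field (Space d q'.field))) ∧
  component (M q) V = component (M q') W ∧ component (M q) V' = component (M q') W'

/-- The `𝒜`-module `𝒜_G(𝒳 × 𝒳)` of `𝒜`-valued functions on `𝒳 × 𝒳` that are invariant under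
`G = SO(D)`, with the standard identification of the orbit sets for the various `q`: a function
is given simultaneously for all `q`, and it takes the same value in `𝒜` on orbits with the same
label. Since labels classify orbits and every label occurs for every `q`, restriction to a single
`q` identifies this module with the invariant functions over that field. -/
noncomputable def invariantFunctions (n : ℕ) {d : ℕ} (M : SubspaceFamily d) :
    Submodule LaurentA (FunctionFamily n d) where
  carrier := {f |
    (∀ (q : OddPrimePower), ∀ g ∈ specialOrthogonal d q.field, ∀ V V' W W' : Flags n d q,
      (∀ i, W.step i = (V.step i).map (g : Space d q.field →ₗ[q.field] Space d q.field)) →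
      (∀ i, W'.step i = (V'.step i).map (g : Space d q.field →ₗ[q.field] Space d q.field)) →
      f q W W' = f q V V') ∧
    (∀ (q q' : OddPrimePower) (V V' : Flags n d q) (W W' : Flags n d q'),
      SamePosition M V V' W W' → f q V V' = f q' W W')}
  add_mem' := by
    rintro f g ⟨hf, hf'⟩ ⟨hg, hg'⟩
    refine ⟨fun q x hx V V' W W' h h' => ?_, fun q q' V V' W W' h => ?_⟩
    · simp only [Pi.add_apply, hf q x hx V V' W W' h h', hg q x hx V V' W W' h h']
    · simp only [Pi.add_apply, hf' q q' V V' W W' h, hg' q q' V V' W W' h]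
  zero_mem' := ⟨fun _ _ _ _ _ _ _ _ _ => rfl, fun _ _ _ _ _ _ _ => rfl⟩
  smul_mem' := by
    rintro c f ⟨hf, hf'⟩
    refine ⟨fun q x hx V V' W W' h h' => ?_, fun q q' V V' W W' h => ?_⟩
    · simp only [Pi.smul_apply, hf q x hx V V' W W' h h']
    · simp only [Pi.smul_apply, hf' q q' V V' W W' h]

/-! ### The convolution algebra -/

/-- The product over all `q` of the convolution algebras of real functions on `𝒳 × 𝒳`. The
product of matrices indexed by `𝒳` is convolution:
`(f * g) V V' = ∑ V'', f V V'' * g V'' V'`. -/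
def ConvolutionProduct (n d : ℕ) : Type :=
  ∀ q : OddPrimePower, Matrix (Flags n d q) (Flags n d q) ℝ

noncomputable instance (n d : ℕ) : Ring (ConvolutionProduct n d) :=
  inferInstanceAs (Ring (∀ q : OddPrimePower, Matrix (Flags n d q) (Flags n d q) ℝ))

/-- `𝒜` acts on the factor at `q` through `v ↦ √q`. -/
noncomputable instance (n d : ℕ) : Algebra LaurentA (ConvolutionProduct n d) :=
  RingHom.toAlgebra'
    (RingHom.pi fun q : OddPrimePower =>
      (algebraMap ℝ (Matrix (Flags n d q) (Flags n d q) ℝ)).comp (specialize q) :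
      LaurentA →+* ∀ q : OddPrimePower, Matrix (Flags n d q) (Flags n d q) ℝ)
    (fun c x => funext fun q => Algebra.commutes (specialize q c) (x q))

/-- The specializations of an `𝒜`-valued function at `v = √q`, for all `q`. -/
noncomputable def toConvolutionProduct {n d : ℕ} (f : FunctionFamily n d) :
    ConvolutionProduct n d :=
  fun q => Matrix.of fun V V' => specialize q (f q V V')

/-- The convolution `𝒜`-algebra `𝒮`, with underlying module `𝒜_G(𝒳 × 𝒳)` and the product that
becomes `(f * g) V V' = ∑ V'', f V V'' * g V'' V'` under `v ↦ √q`, for every `q`.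
An element of `𝒜` is determined by its values at the infinitely many `√q`, so an invariant
function is identified with the family of its specializations. Products of invariant functions are
again of this form (the structure constants are polynomials in `q`), so the algebra generated by
the invariant functions is the module of the invariant functions. -/
noncomputable def convolutionAlgebra (n : ℕ) {d : ℕ} (M : SubspaceFamily d) :
    Subalgebra LaurentA (ConvolutionProduct n d) :=
  Algebra.adjoin LaurentA {x | ∃ f ∈ invariantFunctions n M, x = toConvolutionProduct f}

/-- An invariant function as an element of the convolution algebra. -/
noncomputable def toAlgebra {n d : ℕ} {M : SubspaceFamily d} (f : invariantFunctions n M) :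
    convolutionAlgebra n M :=
  ⟨toConvolutionProduct f.1, Algebra.subset_adjoin ⟨f.1, f.2, rfl⟩⟩

/-! ### The generators and the relations of the algebra `U` -/

/-- The symbols that generate `U`. Indices are shifted by one: `E i`, `F i` with `i : Fin n` stand
for `E_{i+1}`, `F_{i+1}`, and `H a`, `Hinv a` with `a : Fin (n + 1)` for `H_{a+1}` and its
inverse. -/
inductive Gen (n : ℕ) : Type
  | E (i : Fin n)
  | F (i : Fin n)
  | H (a : Fin (n + 1))
  | Hinv (a : Fin (n + 1))
  | J (α : Sgn)

/-- The defining relations of the `ℚ(v)`-algebra `U`, for the images `x s` of the symbols `s` in a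
`ℚ(v)`-algebra `A`. With the shift of indices, `H i.castSucc`, `H i.succ` and `H (Fin.last n)`
are `H_i`, `H_{i+1}` and `H_{n+1}`, and `i + 1 = n` says that `i` is the last index. -/
structure SatisfiesRelations {n : ℕ} {A : Type} [Ring A] [Algebra FieldQv A] (x : Gen n → A) :
    Prop where
  J_sum : x (.J .plus) + x (.J .zero) + x (.J .minus) = 1
  J_mul : ∀ α β, x (.J α) * x (.J β) = if α = β then x (.J α) else 0
  J_H : ∀ α a, x (.J α) * x (.H a) = x (.H a) * x (.J α)
  J_E : ∀ α, α ≠ .zero → ∀ i : Fin n,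
    x (.J α) * x (.E i) = if (i : ℕ) + 1 = n then 0 else x (.E i) * x (.J α)
  F_J : ∀ α, α ≠ .zero → ∀ i : Fin n,
    x (.F i) * x (.J α) = if (i : ℕ) + 1 = n then 0 else x (.J α) * x (.F i)
  J_F_E : ∀ α β, (α = .plus ∧ β = .minus) ∨ (α = .minus ∧ β = .plus) →
    ∀ i : Fin n, (i : ℕ) + 1 = n →
    x (.J α) * x (.F i) * x (.E i) - x (.F i) * x (.E i) * x (.J β) =
      ((vv - vv⁻¹)⁻¹ • (x (.Hinv i.castSucc) * x (.H (Fin.last n))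
        - x (.H i.castSucc) * x (.Hinv (Fin.last n)))) * (x (.J α) - x (.J β))
  H_H : ∀ a b, x (.H a) * x (.H b) = x (.H b) * x (.H a)
  H_Hinv : ∀ a, x (.H a) * x (.Hinv a) = 1
  Hinv_H : ∀ a, x (.Hinv a) * x (.H a) = 1
  H_E : ∀ (a : Fin (n + 1)) (i : Fin n), x (.H a) * x (.E i) =
    vv ^ ((if a = i.castSucc then 1 else 0) - (if a = i.succ then 1 else 0)
      - (if a = Fin.last n ∧ (i : ℕ) + 1 = n then 1 else 0) : ℤ) • (x (.E i) * x (.H a))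
  H_F : ∀ (a : Fin (n + 1)) (i : Fin n), x (.H a) * x (.F i) =
    vv ^ (-(if a = i.castSucc then 1 else 0) + (if a = i.succ then 1 else 0)
      + (if a = Fin.last n ∧ (i : ℕ) + 1 = n then 1 else 0) : ℤ) • (x (.F i) * x (.H a))
  E_F : ∀ i j : Fin n, ¬ ((i : ℕ) + 1 = n ∧ (j : ℕ) + 1 = n) →
    x (.E i) * x (.F j) - x (.F j) * x (.E i) =
      if i = j then (vv - vv⁻¹)⁻¹ • (x (.H i.castSucc) * x (.Hinv i.succ)
        - x (.Hinv i.castSucc) * x (.H i.succ)) else 0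
  E_E : ∀ i j : Fin n, 1 < |(i : ℤ) - (j : ℤ)| → x (.E i) * x (.E j) = x (.E j) * x (.E i)
  F_F : ∀ i j : Fin n, 1 < |(i : ℤ) - (j : ℤ)| → x (.F i) * x (.F j) = x (.F j) * x (.F i)
  serre_E : ∀ i j : Fin n, |(i : ℤ) - (j : ℤ)| = 1 →
    x (.E i) ^ 2 * x (.E j) - (vv + vv⁻¹) • (x (.E i) * x (.E j) * x (.E i))
      + x (.E j) * x (.E i) ^ 2 = 0
  serre_F : ∀ i j : Fin n, |(i : ℤ) - (j : ℤ)| = 1 →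
    x (.F i) ^ 2 * x (.F j) - (vv + vv⁻¹) • (x (.F i) * x (.F j) * x (.F i))
      + x (.F j) * x (.F i) ^ 2 = 0
  E_E_F : ∀ i : Fin n, (i : ℕ) + 1 = n →
    x (.E i) ^ 2 * x (.F i) + x (.F i) * x (.E i) ^ 2 =
      (vv + vv⁻¹) • (x (.E i) * x (.F i) * x (.E i)
        - x (.E i) * (vv • (x (.H i.castSucc) * x (.Hinv (Fin.last n)))
          + vv⁻¹ • (x (.Hinv i.castSucc) * x (.H (Fin.last n)))))
  F_F_E : ∀ i : Fin n, (i : ℕ) + 1 = n →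
    x (.F i) ^ 2 * x (.E i) + x (.E i) * x (.F i) ^ 2 =
      (vv + vv⁻¹) • (x (.F i) * x (.E i) * x (.F i)
        - (vv • (x (.H i.castSucc) * x (.Hinv (Fin.last n)))
          + vv⁻¹ • (x (.Hinv i.castSucc) * x (.H (Fin.last n)))) * x (.F i))

/-! ### The functions `E_i`, `F_i`, `H_a`, `J_α` -/

section Functions

open Classical LaurentPolynomial

variable {n d : ℕ} {F : Type} [Field F]

/-- The function `E_{i+1}`. -/
noncomputable def funE (i : Fin n) (V V' : IsotropicFlag n d F) : LaurentA :=
  if V.Below V' i then T (-V'.gap i.succ) else 0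

/-- The function `F_{i+1}`. -/
noncomputable def funF (i : Fin n) (V V' : IsotropicFlag n d F) : LaurentA :=
  if V'.Below V i then T (-V'.gap i.castSucc) else 0

/-- The function `H_{a+1}`. -/
noncomputable def funH (a : Fin (n + 1)) (V V' : IsotropicFlag n d F) : LaurentA :=
  if V = V' then T (-V'.gap a) else 0

/-- The inverse of the function `H_{a+1}`. -/
noncomputable def funHinv (a : Fin (n + 1)) (V V' : IsotropicFlag n d F) : LaurentA :=
  if V = V' then T (V'.gap a) else 0

/-- The functions `J_+`, `J_-` and `J_0 = 1 - J_+ - J_-`. -/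
noncomputable def funJ (M : Submodule F (Space d F)) (α : Sgn) (V V' : IsotropicFlag n d F) :
    LaurentA :=
  let plus : LaurentA := if V = V' ∧ finrank F V.middle = d ∧
    finrank F (V.middle ⊓ M : Submodule F (Space d F)) ≡ d [MOD 2] then 1 else 0
  let minus : LaurentA := if V = V' ∧ finrank F V.middle = d ∧
    finrank F (V.middle ⊓ M : Submodule F (Space d F)) ≡ d - 1 [MOD 2] then 1 else 0
  match α with
  | .plus => plus
  | .minus => minus
  | .zero => (if V = V' then 1 else 0) - plus - minus

end Functions

/-- The function on `𝒳 × 𝒳`, for every `q`, that corresponds to a symbol. -/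
noncomputable def generatorFunction (n : ℕ) {d : ℕ} (M : SubspaceFamily d) :
    Gen n → FunctionFamily n d
  | .E i => fun _ => funE i
  | .F i => fun _ => funF i
  | .H a => fun _ => funH a
  | .Hinv a => fun _ => funHinv a
  | .J α => fun q => funJ (M q) α

end TypeD

/-! An element of the convolution algebra is, by construction, the family of its specializations at
v = √q. An identity in it therefore holds as soon as it holds between real matrices indexed by
flags, for every q (`evalAt_ext`). The relations have coefficients in ℤ[v, v⁻¹] except for the
denominator v - v⁻¹, which is nonzero in ℚ(v). Once it is cleared, each relation over ℚ(v) is the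
image of such an identity.

Fix q and let b_i be the 0/1 matrix recording that V_i is a hyperplane of W_i while the other steps
up to n agree. Then E_i is b_i times a diagonal matrix of powers of v, F_i is the transpose of b_i
times another one, and H_a and J_α are diagonal. The gaps of a flag change by constants along b_i
(`BelowBy.gap_eq`), so diagonal factors cross b_i at the cost of a power of v. What remains are
identities between products of the b_i and their transposes, that is, counts of intermediate flags;
`ncard_slice` turns a count of flags with one free step into a count of subspaces.

Away from the last step this is linear algebra over a finite field. The Serre relations compare the
q + 1 lines of a plane with a single line (`incid_serre_succ`, `incid_serre_pred`). In the
commutator of E_i and F_i the off-diagonal entries cancel, and the diagonal ones count lines and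
hyperplanes (`incid_commutator`). The step V_n can only grow to isotropic subspaces; the recursion
for the number of isotropic lines (`ncard_isotropicLines`) gives the cubic relations of E_n and F_n
(`incid_triple_last`). For J_+ and J_- the point is that two Lagrangian subspaces meeting in
codimension one have opposite types (`finrank_inf_lagrangian`, `componentMatrix_commutator`).

The generators lie in the module of invariant functions because their values depend only on labels,
and SO(D) preserves labels. The nontrivial part is the type of a Lagrangian: reflections change its
parity as well as the determinant, and composing with reflections reduces an arbitrary isometry to
one that stabilizes the Lagrangian (`neg_one_pow_finrank_map_inf`). The last two identities concern
diagonal matrices and express that the gaps telescope and lie between 0 and d. -/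

namespace TypeD

/-! ### Symmetric bilinear spaces: Lagrangian subspaces, reflections and parity. -/

section BilinearGeometry

variable {F V : Type*} [Field F] [AddCommGroup V] [Module F V] [FiniteDimensional F V]
  {B : LinearMap.BilinForm F V}

theorem finrank_add_orthogonal (hB : B.Nondegenerate) (W : Submodule F V) :
    finrank F W + finrank F (B.orthogonal W) = finrank F V := by
  have h := LinearMap.BilinForm.finrank_orthogonal hB W
  have h' := W.finrank_le
  omega

omit [FiniteDimensional F V] in
theorem le_orthogonal_comm (hS : B.IsSymm) {X Y : Submodule F V} :
    X ≤ B.orthogonal Y ↔ Y ≤ B.orthogonal X := by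
  constructor
  · intro h y hy x hx
    rw [← hS.eq y x]
    exact h hx y hy
  · intro h y hy x hx
    rw [← hS.eq y x]
    exact h hx y hy

omit [FiniteDimensional F V] in
theorem orthogonal_sup (X Y : Submodule F V) :
    B.orthogonal (X ⊔ Y) = B.orthogonal X ⊓ B.orthogonal Y := by
  apply le_antisymm
  · exact le_inf (LinearMap.BilinForm.orthogonal_le le_sup_left)
      (LinearMap.BilinForm.orthogonal_le le_sup_right)
  · rintro m ⟨hx, hy⟩ z hz
    obtain ⟨x, hx', y, hy', rfl⟩ := Submodule.mem_sup.mp hz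
    have h1 := hx x hx'
    have h2 := hy y hy'
    rw [map_add, LinearMap.add_apply, h1, h2, add_zero]

theorem orthogonal_inf (hB : B.Nondegenerate) (hS : B.IsSymm) (X Y : Submodule F V) :
    B.orthogonal (X ⊓ Y) = B.orthogonal X ⊔ B.orthogonal Y := by
  rw [← LinearMap.BilinForm.orthogonal_orthogonal hB hS.isRefl
    (B.orthogonal X ⊔ B.orthogonal Y), orthogonal_sup,
    LinearMap.BilinForm.orthogonal_orthogonal hB hS.isRefl,
    LinearMap.BilinForm.orthogonal_orthogonal hB hS.isRefl]

theorem orthogonal_le_iff (hB : B.Nondegenerate) (hS : B.IsSymm) {X Y : Submodule F V} :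
    B.orthogonal Y ≤ B.orthogonal X ↔ X ≤ Y := by
  refine ⟨fun h => ?_, fun h => LinearMap.BilinForm.orthogonal_le h⟩
  rw [← LinearMap.BilinForm.orthogonal_orthogonal hB hS.isRefl X,
    ← LinearMap.BilinForm.orthogonal_orthogonal hB hS.isRefl Y]
  exact LinearMap.BilinForm.orthogonal_le h

/-- An isometry that stabilizes a Lagrangian subspace has determinant one. -/
theorem det_eq_one_of_stabilizes (hB : B.Nondegenerate) (hS : B.IsSymm) (g : V ≃ₗ[F] V)
    (hg : ∀ x y, B (g x) (g y) = B x y) (L : Submodule F V) (hL : B.orthogonal L = L)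
    (hgL : L.map (g : V →ₗ[F] V) = L) : LinearMap.det (g : V →ₗ[F] V) = 1 := by
  have h1 : L ≤ L.comap (g : V →ₗ[F] V) := by
    rw [← Submodule.map_le_iff_le_comap, hgL]
  have h2 : L ≤ L.comap (g.symm : V →ₗ[F] V) := by
    intro x hx
    rw [← hgL] at hx
    obtain ⟨y, hy, rfl⟩ := hx
    simpa using hy
  -- The form identifies V / L with the dual of L, and under this identification g on V / L becomes
  -- the dual of g⁻¹ on L. The two diagonal blocks of g thus have inverse determinants.
  set ψ : V →ₗ[F] Dual F L := L.subtype.dualMap ∘ₗ B with hψ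
  have hψa : ∀ x (l : L), ψ x l = B x l := fun _ _ => rfl
  have hker : LinearMap.ker ψ = L := by
    ext x
    rw [LinearMap.mem_ker]
    conv_rhs => rw [← hL]
    constructor
    · intro h y hy
      rw [hS.eq]
      exact congrArg (fun f : Dual F L => f ⟨y, hy⟩) h
    · intro h
      ext l
      rw [hψa, hS.eq]
      exact h l l.2
  have hrange : LinearMap.range ψ = ⊤ := by
    apply Submodule.eq_top_of_finrank_eq
    have e1 := LinearMap.finrank_range_add_finrank_ker ψ
    have e2 := finrank_add_orthogonal hB L
    rw [hker] at e1
    rw [hL] at e2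
    rw [Subspace.dual_finrank_eq]
    omega
  let φ : (V ⧸ L) ≃ₗ[F] Dual F L :=
    (Submodule.quotEquivOfEq _ _ hker.symm).trans
      (ψ.quotKerEquivOfSurjective (LinearMap.range_eq_top.mp hrange))
  have hφ : ∀ x, φ (Submodule.Quotient.mk x) = ψ x := fun x => rfl
  have hconj : (φ : (V ⧸ L) →ₗ[F] Dual F L) ∘ₗ (L.mapQ L (g : V →ₗ[F] V) h1) ∘ₗ
      (φ.symm : Dual F L →ₗ[F] (V ⧸ L)) =
      ((g.symm : V →ₗ[F] V).restrict h2).dualMap := by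
    ext f l
    obtain ⟨y, rfl⟩ := φ.surjective f
    obtain ⟨x, rfl⟩ := Submodule.Quotient.mk_surjective _ y
    rw [LinearMap.comp_apply, LinearMap.comp_apply, LinearEquiv.coe_coe, LinearEquiv.coe_coe,
      LinearEquiv.symm_apply_apply, Submodule.mapQ_apply, hφ, hφ, LinearMap.dualMap_apply, hψa,
      hψa, LinearMap.coe_restrict_apply, LinearEquiv.coe_coe, LinearEquiv.coe_coe]
    rw [← hg x (g.symm l), LinearEquiv.apply_symm_apply]
  rw [LinearMap.det_eq_det_mul_det L _ h1, ← LinearMap.det_conj (L.mapQ L _ h1) φ, hconj,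
    LinearMap.det_dualMap, ← map_mul]
  have : ((g : V →ₗ[F] V).restrict h1) * ((g.symm : V →ₗ[F] V).restrict h2) = 1 := by
    ext l
    simp [LinearMap.coe_restrict_apply]
  rw [this, map_one]

/-- The orthogonal reflection in a vector with `B u u ≠ 0`. -/
theorem exists_reflection (hS : B.IsSymm) (u : V) (hu : B u u ≠ 0) :
    ∃ r : V ≃ₗ[F] V, (∀ x, r x = x - (2 / B u u * B u x) • u) ∧
      (∀ x y, B (r x) (r y) = B x y) ∧ LinearMap.det (r : V →ₗ[F] V) = -1 := by
  have h : ((2 / B u u) • B u) u = 2 := by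
    simp [hu]
  have hr : ∀ x, Module.reflection h x = x - (2 / B u u * B u x) • u := by
    intro x
    rw [Module.reflection_apply]
    simp
  refine ⟨Module.reflection h, hr, fun x y => ?_, ?_⟩
  · rw [hr, hr]
    simp only [map_sub, map_smul, LinearMap.sub_apply, LinearMap.smul_apply, smul_eq_mul]
    rw [hS.eq x u]
    field_simp
    ring
  · have : ((Module.reflection h : V ≃ₗ[F] V) : V →ₗ[F] V) =
        LinearMap.transvection (-((2 / B u u) • B u)) u := by
      ext x
      rw [LinearEquiv.coe_coe, hr, LinearMap.transvection.apply]
      simp [sub_eq_add_neg]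
    rw [this, LinearMap.transvection.det, LinearMap.neg_apply, h]
    norm_num

omit [FiniteDimensional F V] in
theorem finrank_map_isometry (g : V ≃ₗ[F] V) (L : Submodule F V) :
    finrank F (L.map (g : V →ₗ[F] V)) = finrank F L :=
  LinearEquiv.finrank_map_eq g L

omit [FiniteDimensional F V] in
theorem orthogonal_map (g : V ≃ₗ[F] V) (hg : ∀ x y, B (g x) (g y) = B x y)
    (L : Submodule F V) :
    B.orthogonal (L.map (g : V →ₗ[F] V)) = (B.orthogonal L).map (g : V →ₗ[F] V) := by
  ext x
  constructor
  · intro h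
    refine ⟨g.symm x, fun y hy => ?_, by simp⟩
    have := h (g y) ⟨y, hy, rfl⟩
    rw [← hg, LinearEquiv.apply_symm_apply]
    exact this
  · rintro ⟨x, hx, rfl⟩ _ ⟨y, hy, rfl⟩
    simp only [LinearEquiv.coe_coe, hg]
    exact hx y hy

omit [FiniteDimensional F V] in
theorem isOrtho_of_le {X Y : Submodule F V} (h : X ≤ B.orthogonal Y) {x y : V} (hx : x ∈ X)
    (hy : y ∈ Y) : B y x = 0 := h hx y hy

/-- If two Lagrangian subspaces meet in codimension one, their intersections with a third one
have dimensions that differ by one. -/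
theorem finrank_inf_lagrangian (h2 : (2 : F) ≠ 0) (hB : B.Nondegenerate) (hS : B.IsSymm)
    {L L' M : Submodule F V} (hL : B.orthogonal L = L) (hL' : B.orthogonal L' = L')
    (hM : B.orthogonal M = M)
    (hLL' : finrank F (L ⊓ L' : Submodule F V) + 1 = finrank F L) :
    finrank F (L ⊓ M : Submodule F V) = finrank F (L' ⊓ M : Submodule F V) + 1 ∨
    finrank F (L' ⊓ M : Submodule F V) = finrank F (L ⊓ M : Submodule F V) + 1 := by
  set K := L ⊓ L' with hK
  have dL := finrank_add_orthogonal hB L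
  have dL' := finrank_add_orthogonal hB L'
  have dM := finrank_add_orthogonal hB M
  have dK := finrank_add_orthogonal hB K
  rw [hL] at dL
  rw [hL'] at dL'
  rw [hM] at dM
  have hKo : B.orthogonal K = L ⊔ L' := by
    rw [hK, orthogonal_inf hB hS, hL, hL']
  -- K^⊥ / K is a hyperbolic plane, whose only isotropic lines are L / K and L' / K. So N, being
  -- totally isotropic, lies in L or in L'. The one containing N meets M in N, the other one only in
  -- M ⊓ K, which is one dimension smaller.
  set N := M ⊓ B.orthogonal K with hN
  have hNo : B.orthogonal N = M ⊔ K := by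
    rw [hN, orthogonal_inf hB hS, hM, LinearMap.BilinForm.orthogonal_orthogonal hB hS.isRefl]
  have dN := finrank_add_orthogonal hB N
  have dMK := Submodule.finrank_sup_add_finrank_inf_eq M K
  rw [hNo] at dN
  have hNdim : finrank F N = finrank F (M ⊓ K : Submodule F V) + 1 := by omega
  have key : ∀ x ∈ N, x ∈ L ∨ x ∈ L' := by
    rintro x ⟨hxM, hxK⟩
    rw [hKo] at hxK
    obtain ⟨l, hl, l', hl', rfl⟩ := Submodule.mem_sup.mp hxK
    have e0 : B (l + l') (l + l') = 0 := isOrtho_of_le hM.ge hxM hxM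
    have e1 : B l l = 0 := isOrtho_of_le hL.ge hl hl
    have e2 : B l' l' = 0 := isOrtho_of_le hL'.ge hl' hl'
    have e3 : B l l' = 0 := by
      simp only [map_add, LinearMap.add_apply, e1, e2, hS.eq l' l] at e0
      have : 2 * B l l' = 0 := by linear_combination e0
      simpa [h2] using this
    by_cases hlL' : l ∈ L'
    · exact Or.inr (L'.add_mem hlL' hl')
    · left
      have hsup : K ⊔ Submodule.span F {l} = L := by
        apply Submodule.eq_of_le_of_finrank_le
        · exact sup_le inf_le_left (by simpa using hl)
        · have : finrank F K < finrank F (K ⊔ Submodule.span F {l} : Submodule F V) := by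
            apply Submodule.finrank_lt_finrank_of_lt
            refine lt_of_le_of_ne le_sup_left fun h => hlL' ?_
            have : l ∈ K := by
              rw [h]
              exact (le_sup_right : Submodule.span F {l} ≤ _)
                (Submodule.mem_span_singleton_self l)
            exact this.2
          omega
      have : l' ∈ B.orthogonal L := by
        intro y hy
        rw [← hsup] at hy
        obtain ⟨k, hk, z, hz, rfl⟩ := Submodule.mem_sup.mp hy
        obtain ⟨c, rfl⟩ := Submodule.mem_span_singleton.mp hz
        have e4 : B k l' = 0 := isOrtho_of_le hL'.ge hl' hk.2
        simp [e3, e4]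
      rw [hL] at this
      exact L.add_mem hl this
  have hsplit : N ≤ L ∨ N ≤ L' := by
    by_contra! hcon
    obtain ⟨⟨x, hx, hxL⟩, ⟨y, hy, hyL⟩⟩ :=
      And.intro (SetLike.not_le_iff_exists.mp hcon.1) (SetLike.not_le_iff_exists.mp hcon.2)
    have hx' := (key x hx).resolve_left hxL
    have hy' := (key y hy).resolve_right hyL
    rcases key _ (N.add_mem hx hy) with h | h
    · exact hxL ((Submodule.add_mem_iff_left _ hy').mp h)
    · exact hyL ((Submodule.add_mem_iff_right _ hx').mp h)
  have hLK : L ≤ B.orthogonal K := hKo ▸ le_sup_left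
  have hLK' : L' ≤ B.orthogonal K := hKo ▸ le_sup_right
  rcases hsplit with h | h
  · left
    have e1 : L ⊓ M = N := le_antisymm (fun x hx => ⟨hx.2, hLK hx.1⟩) (fun x hx => ⟨h hx, hx.1⟩)
    have e2 : L' ⊓ M = M ⊓ K :=
      le_antisymm (fun x hx => ⟨hx.2, h ⟨hx.2, hLK' hx.1⟩, hx.1⟩) (fun x hx => ⟨hx.2.2, hx.1⟩)
    rw [e1, e2, hNdim]
  · right
    have e1 : L' ⊓ M = N :=
      le_antisymm (fun x hx => ⟨hx.2, hLK' hx.1⟩) (fun x hx => ⟨h hx, hx.1⟩)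
    have e2 : L ⊓ M = M ⊓ K :=
      le_antisymm (fun x hx => ⟨hx.2, hx.1, h ⟨hx.2, hLK hx.1⟩⟩) (fun x hx => ⟨hx.2.1, hx.1⟩)
    rw [e1, e2, hNdim]

/-- The intersection consists of the vectors of L orthogonal to u. This is the kernel of a nonzero
functional on L, since u is not isotropic and hence not in L = L^⊥. -/
theorem finrank_inf_reflection {L : Submodule F V} (hS : B.IsSymm)
    (hL : B.orthogonal L = L) {u : V} (hu : B u u ≠ 0) {r : V ≃ₗ[F] V}
    (hr : ∀ x, r x = x - (2 / B u u * B u x) • u) (h2 : (2 : F) ≠ 0) :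
    finrank F (L ⊓ L.map (r : V →ₗ[F] V) : Submodule F V) + 1 = finrank F L := by
  have huL : u ∉ L := fun h => hu (isOrtho_of_le hL.ge h h)
  have hex : ∃ x ∈ L, B u x ≠ 0 := by
    by_contra! hcon
    apply huL
    rw [← hL]
    intro y hy
    rw [hS.eq]
    exact hcon y hy
  have hinf : L ⊓ L.map (r : V →ₗ[F] V) = (LinearMap.ker ((B u).domRestrict L)).map L.subtype := by
    ext x
    constructor
    · rintro ⟨hx, ⟨y, hy, rfl⟩⟩
      refine ⟨⟨_, hx⟩, ?_, rfl⟩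
      simp only [LinearEquiv.coe_coe] at hx
      rw [hr] at hx
      have : (2 / B u u * B u y) • u ∈ L := by
        have := L.sub_mem hy hx
        simpa using this
      have h0 : 2 / B u u * B u y = 0 := by
        by_contra hne
        exact huL ((L.smul_mem_iff hne).mp this)
      have h1 : B u y = 0 := by
        rcases mul_eq_zero.mp h0 with h | h
        · exact absurd h (div_ne_zero h2 hu)
        · exact h
      simp only [SetLike.mem_coe, LinearMap.mem_ker, LinearMap.domRestrict_apply,
        LinearEquiv.coe_coe]
      rw [hr, map_sub, map_smul, h1]
      simp
    · rintro ⟨⟨x, hx⟩, hk, rfl⟩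
      refine ⟨hx, x, hx, ?_⟩
      have : B u x = 0 := hk
      simp [hr, this]
  have hne : (B u).domRestrict L ≠ 0 := by
    obtain ⟨x, hx, hx'⟩ := hex
    exact fun h => hx' (congrArg (fun f : Dual F L => f ⟨x, hx⟩) h)
  rw [hinf, Submodule.finrank_map_subtype_eq]
  exact Module.Dual.finrank_ker_add_one_of_ne_zero hne

/-- The parity of the intersection with a fixed Lagrangian subspace changes under an isometry by
its determinant. -/
theorem neg_one_pow_finrank_map_inf (h2 : (2 : F) ≠ 0) (hB : B.Nondegenerate) (hS : B.IsSymm)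
    {L M : Submodule F V} (hL : B.orthogonal L = L) (hM : B.orthogonal M = M) (k : ℕ) :
    ∀ g : V ≃ₗ[F] V, (∀ x y, B (g x) (g y) = B x y) →
      finrank F L ≤ finrank F (L.map (g : V →ₗ[F] V) ⊓ L : Submodule F V) + k →
      ((-1) ^ finrank F (L.map (g : V →ₗ[F] V) ⊓ M : Submodule F V) : F) =
        LinearMap.det (g : V →ₗ[F] V) * (-1) ^ finrank F (L ⊓ M : Submodule F V) := by
  have stab : ∀ g : V ≃ₗ[F] V, (∀ x y, B (g x) (g y) = B x y) →
      L.map (g : V →ₗ[F] V) = L →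
      ((-1) ^ finrank F (L.map (g : V →ₗ[F] V) ⊓ M : Submodule F V) : F) =
        LinearMap.det (g : V →ₗ[F] V) * (-1) ^ finrank F (L ⊓ M : Submodule F V) := by
    intro g hg h
    rw [h, det_eq_one_of_stabilizes hB hS g hg L hL h, one_mul]
  -- Here k bounds the codimension of gL ∩ L in L. Composing g with a suitable reflection enlarges
  -- this intersection and reverses both the determinant and the parity.
  induction k with
  | zero =>
    intro g hg hk
    refine stab g hg ?_
    have h1 : L.map (g : V →ₗ[F] V) ⊓ L = L :=
      Submodule.eq_of_le_of_finrank_le inf_le_right hk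
    exact (Submodule.eq_of_le_of_finrank_eq (inf_eq_right.mp h1)
      (finrank_map_isometry g L).symm).symm
  | succ k ih =>
    intro g hg hk
    by_cases hgL : L.map (g : V →ₗ[F] V) = L
    · exact stab g hg hgL
    set L₁ := L.map (g : V →ₗ[F] V) with hL₁
    have hL₁o : B.orthogonal L₁ = L₁ := by rw [hL₁, orthogonal_map g hg, hL]
    -- Both a and b are isotropic, so a - b has norm -2 B(a, b) ≠ 0 and the reflection in it sends a
    -- to b. It fixes gL ∩ L pointwise, as these vectors are orthogonal to a and b; the vector b is
    -- new in the intersection.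
    obtain ⟨a, ha, b, hb, hab⟩ : ∃ a ∈ L₁, ∃ b ∈ L, B a b ≠ 0 := by
      by_contra! hcon
      apply hgL
      refine (Submodule.eq_of_le_of_finrank_eq (?_ : L ≤ L₁) ?_).symm
      · intro b hb
        rw [← hL₁o]
        exact fun a ha => hcon a ha b hb
      · exact (finrank_map_isometry g L).symm
    have haa : B a a = 0 := isOrtho_of_le hL₁o.ge ha ha
    have hbb : B b b = 0 := isOrtho_of_le hL.ge hb hb
    have huu : B (a - b) (a - b) = -2 * B a b := by
      simp only [map_sub, LinearMap.sub_apply, haa, hbb, hS.eq b a]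
      ring
    have hu : B (a - b) (a - b) ≠ 0 := by
      rw [huu]
      exact mul_ne_zero (neg_ne_zero.mpr h2) hab
    obtain ⟨r, hr, hriso, hrdet⟩ := exists_reflection hS (a - b) hu
    have hra : r a = b := by
      have : 2 / B (a - b) (a - b) * B (a - b) a = 1 := by
        rw [huu]
        simp only [map_sub, LinearMap.sub_apply, haa, hS.eq b a]
        field_simp
        ring
      rw [hr, this]
      simp
    have hrg : ((g.trans r : V ≃ₗ[F] V) : V →ₗ[F] V) = (r : V →ₗ[F] V) ∘ₗ (g : V →ₗ[F] V) := rfl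
    have hmap : L.map ((g.trans r : V ≃ₗ[F] V) : V →ₗ[F] V) = L₁.map (r : V →ₗ[F] V) := by
      rw [hrg, Submodule.map_comp]
    have hdet : LinearMap.det ((g.trans r : V ≃ₗ[F] V) : V →ₗ[F] V) =
        -LinearMap.det (g : V →ₗ[F] V) := by
      rw [hrg, LinearMap.det_comp, hrdet, neg_one_mul]
    have hbig : finrank F (L₁ ⊓ L : Submodule F V) <
        finrank F (L₁.map (r : V →ₗ[F] V) ⊓ L : Submodule F V) := by
      apply Submodule.finrank_lt_finrank_of_lt
      refine lt_of_le_of_ne ?_ ?_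
      · rintro x ⟨hx1, hx2⟩
        refine ⟨⟨x, hx1, ?_⟩, hx2⟩
        have e1 : B a x = 0 := isOrtho_of_le hL₁o.ge hx1 ha
        have e2 : B b x = 0 := isOrtho_of_le hL.ge hx2 hb
        simp [hr, e1, e2]
      · intro h
        have : b ∈ L₁ ⊓ L := by
          rw [h]
          exact ⟨⟨a, ha, hra⟩, hb⟩
        exact hab (isOrtho_of_le hL₁o.ge this.1 ha)
    have hih := ih (g.trans r) (fun x y => by simp [hriso, hg]) (by rw [hmap]; omega)
    rw [hmap, hdet] at hih
    have hrL₁ : B.orthogonal (L₁.map (r : V →ₗ[F] V)) = L₁.map (r : V →ₗ[F] V) := by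
      rw [orthogonal_map r hriso, hL₁o]
    have hflip := finrank_inf_lagrangian h2 hB hS hL₁o hrL₁ hM
      (finrank_inf_reflection hS hL₁o hu hr h2)
    have hsign : ((-1) ^ finrank F (L₁ ⊓ M : Submodule F V) : F) =
        -(-1) ^ finrank F (L₁.map (r : V →ₗ[F] V) ⊓ M : Submodule F V) := by
      rcases hflip with h | h <;> rw [h, pow_succ] <;> ring
    rw [hsign, hih]
    ring

/-- Isometries of determinant one preserve the parity of the intersection with a fixed Lagrangian
subspace. -/
theorem finrank_map_inf_modEq (h2 : (2 : F) ≠ 0) (hB : B.Nondegenerate) (hS : B.IsSymm)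
    {L M : Submodule F V} (hL : B.orthogonal L = L) (hM : B.orthogonal M = M) (g : V ≃ₗ[F] V)
    (hg : ∀ x y, B (g x) (g y) = B x y) (hdet : LinearMap.det (g : V →ₗ[F] V) = 1) :
    finrank F (L.map (g : V →ₗ[F] V) ⊓ M : Submodule F V) ≡
      finrank F (L ⊓ M : Submodule F V) [MOD 2] := by
  have h := neg_one_pow_finrank_map_inf h2 hB hS hL hM (finrank F L) g hg (by omega)
  rw [hdet, one_mul] at h
  have hne : (1 : F) ≠ -1 := by
    intro h'
    apply h2
    linear_combination h'
  rcases Nat.even_or_odd (finrank F (L.map (g : V →ₗ[F] V) ⊓ M : Submodule F V)) with h1 | h1 <;>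
  rcases Nat.even_or_odd (finrank F (L ⊓ M : Submodule F V)) with h3 | h3
  · rw [Nat.ModEq, Nat.even_iff.mp h1, Nat.even_iff.mp h3]
  · rw [h1.neg_one_pow, h3.neg_one_pow] at h
    exact absurd h hne
  · rw [h1.neg_one_pow, h3.neg_one_pow] at h
    exact absurd h.symm hne
  · rw [Nat.ModEq, Nat.odd_iff.mp h1, Nat.odd_iff.mp h3]

end BilinearGeometry
end TypeD

namespace TypeD

/-! ### Counting lines, hyperplanes and isotropic lines over a finite field. -/

section Counting

variable {F V : Type*} [Field F] [AddCommGroup V] [Module F V] [FiniteDimensional F V]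

theorem finrank_sup_span_singleton {U : Submodule F V} {x : V} (hx : x ∉ U) :
    finrank F (U ⊔ Submodule.span F {x} : Submodule F V) = finrank F U + 1 := by
  have h1 : finrank F U < finrank F (U ⊔ Submodule.span F {x} : Submodule F V) := by
    apply Submodule.finrank_lt_finrank_of_lt
    refine lt_of_le_of_ne le_sup_left fun h => hx ?_
    rw [h]
    exact (le_sup_right : Submodule.span F {x} ≤ _) (Submodule.mem_span_singleton_self x)
  have h2 := Submodule.finrank_add_le_finrank_add_finrank U (Submodule.span F {x})
  have h3 : finrank F (Submodule.span F {x}) ≤ 1 := by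
    simpa using finrank_span_le_card (R := F) ({x} : Set V)
  omega

theorem sup_span_singleton_eq {U X : Submodule F V} (hUX : U ≤ X)
    (hX : finrank F X = finrank F U + 1) {x : V} (hx : x ∈ X) (hxU : x ∉ U) :
    U ⊔ Submodule.span F {x} = X :=
  Submodule.eq_of_le_of_finrank_eq (sup_le hUX (by simpa using hx))
    (by rw [finrank_sup_span_singleton hxU, hX])

/-- The subspaces between `A` and `B` that contain `A` in codimension one. -/
def linesBetween (A B : Submodule F V) : Set (Submodule F V) :=
  {X | A ≤ X ∧ X ≤ B ∧ finrank F X = finrank F A + 1}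

/-- The subspaces between `A` and `B` that have codimension one in `B`. -/
def hyperplanesBetween (A B : Submodule F V) : Set (Submodule F V) :=
  {X | A ≤ X ∧ X ≤ B ∧ finrank F X + 1 = finrank F B}

/-- The totally isotropic subspaces that contain `U` in codimension one. -/
def isotropicLines (b : LinearMap.BilinForm F V) (U : Submodule F V) : Set (Submodule F V) :=
  {X | U ≤ X ∧ X ≤ b.orthogonal X ∧ finrank F X = finrank F U + 1}

variable [Finite F]

instance finite_submodule : Finite (Submodule F V) :=
  have := Module.finite_of_finite F (M := V)
  inferInstance

theorem ncard_diff_submodule {A X : Submodule F V} (h : A ≤ X) :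
    ((X : Set V) \ (A : Set V)).ncard = Nat.card F ^ finrank F X - Nat.card F ^ finrank F A := by
  have := Module.finite_of_finite F (M := V)
  rw [Set.ncard_sdiff (by exact_mod_cast h)]
  congr 1
  · rw [← Module.natCard_eq_pow_finrank (K := F) (V := X)]
    rfl
  · rw [← Module.natCard_eq_pow_finrank (K := F) (V := A)]
    rfl

theorem two_le_natCard : 2 ≤ Nat.card F := by
  have : 1 < Nat.card F := Finite.one_lt_card
  omega

/-- The vectors of B outside A are partitioned according to the subspace A + ⟨x⟩, and each such
subspace X contributes the q^(dim A + 1) - q^(dim A) vectors of X outside A. -/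
theorem ncard_linesBetween {A B : Submodule F V} (h : A ≤ B) :
    ((linesBetween A B).ncard : ℝ) * (Nat.card F - 1) =
      (Nat.card F : ℝ) ^ (finrank F B - finrank F A) - 1 := by
  classical
  have := Module.finite_of_finite F (M := V)
  have := Fintype.ofFinite V
  have := Fintype.ofFinite (Submodule F V)
  set q := Nat.card F with hq
  have hq2 : 2 ≤ q := two_le_natCard
  have key : ((B : Set V) \ (A : Set V)).ncard =
      (linesBetween A B).ncard * (q ^ (finrank F A + 1) - q ^ finrank F A) := by
    rw [Set.ncard_eq_toFinset_card', Set.ncard_eq_toFinset_card',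
      Finset.card_eq_sum_card_fiberwise (f := fun x => A ⊔ Submodule.span F {x})
        (t := (linesBetween A B).toFinset), Finset.sum_const_nat]
    · intro X hX
      obtain ⟨hAX, hXB, hX⟩ := Set.mem_toFinset.mp hX
      rw [← hX, ← ncard_diff_submodule hAX, Set.ncard_eq_toFinset_card']
      congr 1
      ext x
      simp only [Finset.mem_filter, Set.mem_toFinset, Set.mem_sdiff, SetLike.mem_coe]
      constructor
      · rintro ⟨⟨hxB, hxA⟩, rfl⟩
        exact ⟨(le_sup_right : Submodule.span F {x} ≤ _) (Submodule.mem_span_singleton_self x),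
          hxA⟩
      · rintro ⟨hxX, hxA⟩
        exact ⟨⟨hXB hxX, hxA⟩, sup_span_singleton_eq hAX hX hxX hxA⟩
    · intro x hx
      simp only [Set.coe_toFinset, Set.mem_sdiff, SetLike.mem_coe] at hx ⊢
      exact ⟨le_sup_left, sup_le h (by simpa using hx.1), finrank_sup_span_singleton hx.2⟩
  rw [ncard_diff_submodule h, ← hq] at key
  have hAB : finrank F A ≤ finrank F B := Submodule.finrank_mono h
  have hle : q ^ finrank F A ≤ q ^ finrank F B := Nat.pow_le_pow_right (by omega) hAB
  have hle' : q ^ finrank F A ≤ q ^ (finrank F A + 1) := Nat.pow_le_pow_right (by omega) (by omega)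
  have key' : ((q ^ finrank F B - q ^ finrank F A : ℕ) : ℝ) =
      (((linesBetween A B).ncard * (q ^ (finrank F A + 1) - q ^ finrank F A) : ℕ) : ℝ) := by
    rw [key]
  push_cast [Nat.cast_sub hle, Nat.cast_sub hle'] at key'
  have hqpos : (0 : ℝ) < (q : ℝ) ^ finrank F A := by positivity
  have hsplit : (q : ℝ) ^ finrank F B =
      (q : ℝ) ^ finrank F A * (q : ℝ) ^ (finrank F B - finrank F A) := by
    rw [← pow_add]
    congr 1
    omega
  apply mul_left_cancel₀ hqpos.ne'
  linear_combination hsplit - key'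

theorem ncard_linesBetween_of_finrank_eq_add_two {A B : Submodule F V} (h : A ≤ B)
    (hAB : finrank F B = finrank F A + 2) : (linesBetween A B).ncard = Nat.card F + 1 := by
  have h1 := ncard_linesBetween h
  have h2 : (2 : ℝ) ≤ Nat.card F := by exact_mod_cast two_le_natCard (F := F)
  rw [hAB, show finrank F A + 2 - finrank F A = 2 by omega] at h1
  have h3 : ((linesBetween A B).ncard : ℝ) = Nat.card F + 1 := by
    apply mul_right_cancel₀ (b := (Nat.card F - 1 : ℝ)) (by linarith)
    rw [h1]
    ring
  exact_mod_cast h3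

/-- Orthogonal complement is a bijection from hyperplanes between A and B to lines between B^⊥ and
A^⊥. -/
theorem ncard_hyperplanesBetween {b : LinearMap.BilinForm F V} (hb : b.Nondegenerate)
    (hS : b.IsSymm) {A B : Submodule F V} (h : A ≤ B) :
    ((hyperplanesBetween A B).ncard : ℝ) * (Nat.card F - 1) =
      (Nat.card F : ℝ) ^ (finrank F B - finrank F A) - 1 := by
  have h1 := ncard_linesBetween ((orthogonal_le_iff hb hS).mpr h)
  have dA := finrank_add_orthogonal hb A
  have dB := finrank_add_orthogonal hb B
  have e : (linesBetween (b.orthogonal B) (b.orthogonal A)).ncard =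
      (hyperplanesBetween A B).ncard := by
    have : linesBetween (b.orthogonal B) (b.orthogonal A) =
        b.orthogonal '' hyperplanesBetween A B := by
      ext X
      have dX := finrank_add_orthogonal hb X
      have hX := LinearMap.BilinForm.orthogonal_orthogonal hb hS.isRefl X
      constructor
      · rintro ⟨hX1, hX2, hX3⟩
        refine ⟨b.orthogonal X, ⟨?_, ?_, by omega⟩, hX⟩
        · rwa [← orthogonal_le_iff hb hS, hX]
        · rwa [← orthogonal_le_iff hb hS, hX]
      · rintro ⟨Y, ⟨hY1, hY2, hY3⟩, rfl⟩
        have dY := finrank_add_orthogonal hb Y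
        exact ⟨LinearMap.BilinForm.orthogonal_le hY2, LinearMap.BilinForm.orthogonal_le hY1,
          by omega⟩
    rw [this, Set.ncard_image_of_injective]
    intro X Y hXY
    rw [← LinearMap.BilinForm.orthogonal_orthogonal hb hS.isRefl X, hXY,
      LinearMap.BilinForm.orthogonal_orthogonal hb hS.isRefl Y]
  rw [e] at h1
  rw [h1]
  congr 2
  have := Submodule.finrank_mono h
  omega

variable {b : LinearMap.BilinForm F V}

omit [FiniteDimensional F V] [Finite F] in
theorem sup_isotropic (hS : b.IsSymm) {X Y : Submodule F V} (hX : X ≤ b.orthogonal X)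
    (hY : Y ≤ b.orthogonal Y) (hXY : X ≤ b.orthogonal Y) : X ⊔ Y ≤ b.orthogonal (X ⊔ Y) := by
  rw [orthogonal_sup]
  exact sup_le (le_inf hX hXY) (le_inf ((le_orthogonal_comm hS).mp hXY) hY)

omit [Finite F] in
/-- A plane over `U` that is not orthogonal to its isotropic line `U'` contains exactly one other
isotropic line. -/
theorem existsUnique_isotropicLine (h2 : (2 : F) ≠ 0) (hS : b.IsSymm) {U U' Z : Submodule F V}
    (hUU' : U ≤ U') (hU' : finrank F U' = finrank F U + 1) (hiso : U' ≤ b.orthogonal U')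
    (hU'Z : U' ≤ Z) (hZU : Z ≤ b.orthogonal U) (hZ : finrank F Z = finrank F U + 2)
    (hZU' : ¬ Z ≤ b.orthogonal U') :
    ∃! X, X ∈ isotropicLines b U ∧ X ≠ U' ∧ X ⊔ U' = Z := by
  obtain ⟨z, hz, hz'⟩ := SetLike.not_le_iff_exists.mp hZU'
  obtain ⟨e, he, hez⟩ : ∃ e ∈ U', b e z ≠ 0 := by
    by_contra! hcon
    exact hz' hcon
  have hee : b e e = 0 := isOrtho_of_le hiso he he
  -- The multiple of e is the one that makes x isotropic while keeping its pairing with e nonzero.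
  set x := z - (b z z / (2 * b e z)) • e with hx
  have hxZ : x ∈ Z := Z.sub_mem hz (Z.smul_mem _ (hU'Z he))
  have hex : b e x = b e z := by
    rw [hx, map_sub, map_smul, hee]
    simp
  have hxx : b x x = 0 := by
    rw [hx]
    simp only [map_sub, map_smul, LinearMap.sub_apply, LinearMap.smul_apply, hee, smul_eq_mul,
      hS.eq z e]
    field_simp
    ring
  have hxU' : x ∉ U' := fun h => hez (by rw [← hex]; exact isOrtho_of_le hiso h he)
  have hxU : x ∉ U := fun h => hxU' (hUU' h)
  have hspan : Submodule.span F {x} ≤ b.orthogonal (Submodule.span F {x}) := by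
    intro y hy w hw
    obtain ⟨c, rfl⟩ := Submodule.mem_span_singleton.mp hy
    obtain ⟨c', rfl⟩ := Submodule.mem_span_singleton.mp hw
    simp [hxx]
  have hUiso : U ≤ b.orthogonal U :=
    hUU'.trans (hiso.trans (LinearMap.BilinForm.orthogonal_le hUU'))
  have hsup : ∀ X : Submodule F V, U ≤ X → X ≤ Z → finrank F X = finrank F U + 1 → X ≠ U' →
      X ⊔ U' = Z := by
    intro X hX1 hX2 hX3 hX4
    apply Submodule.eq_of_le_of_finrank_le (sup_le hX2 hU'Z)
    have : finrank F U' < finrank F (X ⊔ U' : Submodule F V) := by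
      apply Submodule.finrank_lt_finrank_of_lt
      refine lt_of_le_of_ne le_sup_right fun h => hX4 ?_
      exact Submodule.eq_of_le_of_finrank_eq (by rw [h]; exact le_sup_left) (by omega)
    omega
  have hXZ : U ⊔ Submodule.span F {x} ≤ Z := sup_le (hUU'.trans hU'Z) (by simpa using hxZ)
  have hXx : x ∈ U ⊔ Submodule.span F {x} :=
    (le_sup_right : Submodule.span F {x} ≤ _) (Submodule.mem_span_singleton_self x)
  have hXU' : U ⊔ Submodule.span F {x} ≠ U' := fun h => hxU' (h ▸ hXx)
  have hXd := finrank_sup_span_singleton hxU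
  have hexist : ∃ X, X ∈ isotropicLines b U ∧ X ≠ U' ∧ X ⊔ U' = Z := by
    refine ⟨U ⊔ Submodule.span F {x}, ⟨le_sup_left, ?_, hXd⟩, hXU',
      hsup _ le_sup_left hXZ hXd hXU'⟩
    refine sup_isotropic hS hUiso hspan ((le_orthogonal_comm hS).mp ?_)
    have : Submodule.span F {x} ≤ Z := by simpa using hxZ
    exact this.trans hZU
  refine existsUnique_of_exists_of_unique hexist ?_
  rintro X₁ X₂ ⟨⟨hU1, hi1, hd1⟩, hne1, hs1⟩ ⟨⟨hU2, hi2, hd2⟩, hne2, hs2⟩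
  -- Isotropy of w = y + f forces y ⊥ f. If neither y nor f lay in U, they would generate X₁ and U'
  -- over U, and Z would be orthogonal to U'.
  have key : ∀ w ∈ X₂, w ∈ X₁ ∨ w ∈ U' := by
    intro w hw
    have hwZ : w ∈ X₁ ⊔ U' := by
      rw [hs1, ← hs2]
      exact (le_sup_left : X₂ ≤ X₂ ⊔ U') hw
    obtain ⟨y, hy, f, hf, rfl⟩ := Submodule.mem_sup.mp hwZ
    have e0 : b (y + f) (y + f) = 0 := isOrtho_of_le hi2 hw hw
    have e1 : b y y = 0 := isOrtho_of_le hi1 hy hy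
    have e2 : b f f = 0 := isOrtho_of_le hiso hf hf
    have e3 : b f y = 0 := by
      simp only [map_add, LinearMap.add_apply, e1, e2, hS.eq y f] at e0
      have : 2 * b f y = 0 := by linear_combination e0
      simpa [h2] using this
    by_cases hfU : f ∈ U
    · exact Or.inl (X₁.add_mem hy (hU1 hfU))
    by_cases hyU : y ∈ U
    · exact Or.inr (U'.add_mem (hUU' hyU) hf)
    exfalso
    apply hZU'
    rw [← hs1]
    refine sup_le ?_ hiso
    rw [← sup_span_singleton_eq hU1 hd1 hy hyU, ← sup_span_singleton_eq hUU' hU' hf hfU,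
      orthogonal_sup]
    have a1 : Submodule.span F {y} ≤ b.orthogonal (Submodule.span F {f}) := by
      intro s hs t ht
      obtain ⟨c, rfl⟩ := Submodule.mem_span_singleton.mp hs
      obtain ⟨c', rfl⟩ := Submodule.mem_span_singleton.mp ht
      simp [e3]
    have a2 : Submodule.span F {y} ≤ b.orthogonal U := by
      have : Submodule.span F {y} ≤ X₁ := by simpa using hy
      exact this.trans (hi1.trans (LinearMap.BilinForm.orthogonal_le hU1))
    have a3 : U ≤ b.orthogonal (Submodule.span F {f}) := by
      have : Submodule.span F {f} ≤ U' := by simpa using hf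
      exact hUU'.trans (hiso.trans (LinearMap.BilinForm.orthogonal_le this))
    exact sup_le (le_inf hUiso a3) (le_inf a2 a1)
  have hsplit : X₂ ≤ X₁ ∨ X₂ ≤ U' := by
    by_contra! hcon
    obtain ⟨⟨s, hs, hs'⟩, ⟨t, ht, ht'⟩⟩ :=
      And.intro (SetLike.not_le_iff_exists.mp hcon.1) (SetLike.not_le_iff_exists.mp hcon.2)
    have hs'' := (key s hs).resolve_left hs'
    have ht'' := (key t ht).resolve_right ht'
    rcases key _ (X₂.add_mem hs ht) with h | h
    · exact hs' ((Submodule.add_mem_iff_left _ ht'').mp h)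
    · exact ht' ((Submodule.add_mem_iff_right _ hs'').mp h)
  rcases hsplit with h | h
  · exact (Submodule.eq_of_le_of_finrank_eq h (by omega)).symm
  · exact absurd (Submodule.eq_of_le_of_finrank_eq h (by omega)) hne2

/-- The recursion for the number of isotropic lines. -/
theorem ncard_isotropicLines (h2 : (2 : F) ≠ 0) (hb : b.Nondegenerate) (hS : b.IsSymm)
    {U U' : Submodule F V} (hUU' : U ≤ U') (hU' : finrank F U' = finrank F U + 1)
    (hiso : U' ≤ b.orthogonal U') :
    ((isotropicLines b U).ncard : ℝ) = 1 + Nat.card F * (isotropicLines b U').ncard +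
      (Nat.card F : ℝ) ^ (finrank F V - 2 * finrank F U - 2) := by
  classical
  have := Fintype.ofFinite (Submodule F V)
  set q := Nat.card F with hq
  have hq2 : 2 ≤ q := two_le_natCard
  have hUiso : U' ≤ b.orthogonal U := hiso.trans (LinearMap.BilinForm.orthogonal_le hUU')
  have hmem : U' ∈ (isotropicLines b U).toFinset :=
    Set.mem_toFinset.mpr ⟨hUU', hiso, hU'⟩
  -- The isotropic lines X ≠ U' over U are sorted by the plane X + U', which lies in U^⊥.
  have hmaps : Set.MapsTo (fun X => X ⊔ U') ((isotropicLines b U).toFinset.erase U')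
      (linesBetween U' (b.orthogonal U)).toFinset := by
    intro X hX
    simp only [Finset.coe_erase, Set.coe_toFinset, Set.mem_sdiff, Set.mem_singleton_iff] at hX ⊢
    obtain ⟨⟨hUX, hXi, hXd⟩, hne⟩ := hX
    refine ⟨le_sup_right,
      sup_le (hXi.trans (LinearMap.BilinForm.orthogonal_le hUX)) hUiso, ?_⟩
    have e1 := Submodule.finrank_sup_add_finrank_inf_eq X U'
    have e2 : finrank F U ≤ finrank F (X ⊓ U' : Submodule F V) :=
      Submodule.finrank_mono (le_inf hUX hUU')
    have e3 : finrank F U' < finrank F (X ⊔ U' : Submodule F V) := by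
      apply Submodule.finrank_lt_finrank_of_lt
      refine lt_of_le_of_ne le_sup_right fun h => hne ?_
      exact Submodule.eq_of_le_of_finrank_eq (by rw [h]; exact le_sup_left) (by omega)
    omega
  -- A plane Z over U contains one further isotropic line if it is not orthogonal to U', all q
  -- further lines if it is totally isotropic, and none if it is orthogonal to U' without being
  -- totally isotropic.
  have hfib : ∀ Z ∈ (linesBetween U' (b.orthogonal U)).toFinset,
      (((isotropicLines b U).toFinset.erase U').filter fun X => X ⊔ U' = Z).card =
        (if Z ≤ b.orthogonal U' then 0 else 1) + (if Z ≤ b.orthogonal Z then q else 0) := by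
    intro Z hZ
    obtain ⟨hU'Z, hZU, hZd⟩ := Set.mem_toFinset.mp hZ
    by_cases hZU' : Z ≤ b.orthogonal U'
    · by_cases hZi : Z ≤ b.orthogonal Z
      · rw [if_pos hZU', if_pos hZi, zero_add]
        have hset : (((isotropicLines b U).toFinset.erase U').filter fun X => X ⊔ U' = Z) =
            (linesBetween U Z).toFinset.erase U' := by
          ext X
          simp only [Finset.mem_filter, Finset.mem_erase, Set.mem_toFinset]
          constructor
          · rintro ⟨⟨hne, hUX, hXi, hXd⟩, rfl⟩
            exact ⟨hne, hUX, le_sup_left, hXd⟩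
          · rintro ⟨hne, hUX, hXZ, hXd⟩
            refine ⟨⟨hne, hUX, hXZ.trans (hZi.trans (LinearMap.BilinForm.orthogonal_le hXZ)),
              hXd⟩, ?_⟩
            apply Submodule.eq_of_le_of_finrank_le (sup_le hXZ hU'Z)
            have : finrank F U' < finrank F (X ⊔ U' : Submodule F V) := by
              apply Submodule.finrank_lt_finrank_of_lt
              refine lt_of_le_of_ne le_sup_right fun h => hne ?_
              exact Submodule.eq_of_le_of_finrank_eq (by rw [h]; exact le_sup_left) (by omega)
            omega
        have hU'mem : U' ∈ (linesBetween U Z).toFinset := Set.mem_toFinset.mpr ⟨hUU', hU'Z, hU'⟩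
        rw [hset, Finset.card_erase_of_mem hU'mem, ← Set.ncard_eq_toFinset_card',
          ncard_linesBetween_of_finrank_eq_add_two (hUU'.trans hU'Z) (by omega)]
        rfl
      · rw [if_pos hZU', if_neg hZi, Finset.card_eq_zero, Finset.filter_eq_empty_iff]
        intro X hX hXZ
        obtain ⟨_, _, hXi, _⟩ := And.intro (Finset.mem_erase.mp hX).1
          (Set.mem_toFinset.mp (Finset.mem_erase.mp hX).2)
        apply hZi
        rw [← hXZ]
        refine sup_isotropic hS hXi hiso ?_
        rw [← hXZ] at hZU'
        exact le_sup_left.trans hZU'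
    · have hZi : ¬ Z ≤ b.orthogonal Z := fun h =>
        hZU' (h.trans (LinearMap.BilinForm.orthogonal_le hU'Z))
      rw [if_neg hZU', if_neg hZi, add_zero, Finset.card_eq_one]
      obtain ⟨X, hX, huniq⟩ := existsUnique_isotropicLine h2 hS hUU' hU' hiso hU'Z hZU
        (by omega) hZU'
      refine ⟨X, ?_⟩
      ext Y
      simp only [Finset.mem_filter, Finset.mem_erase, Set.mem_toFinset, Finset.mem_singleton]
      constructor
      · rintro ⟨⟨h1, h3⟩, h4⟩
        exact huniq Y ⟨h3, h1, h4⟩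
      · rintro rfl
        exact ⟨⟨hX.2.1, hX.1⟩, hX.2.2⟩
  -- The subtraction of naturals is not truncated: lines over U' inside U'^⊥ are among those inside
  -- U^⊥. The difference counts the planes of the first kind.
  have hcount : (isotropicLines b U).ncard = 1 +
      (((linesBetween U' (b.orthogonal U)).ncard - (linesBetween U' (b.orthogonal U')).ncard) +
        q * (isotropicLines b U').ncard) := by
    rw [Set.ncard_eq_toFinset_card', ← Finset.card_erase_add_one hmem,
      Finset.card_eq_sum_card_fiberwise hmaps, Finset.sum_congr rfl hfib,
      Finset.sum_add_distrib, add_comm]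
    congr 2
    · have e : ∀ Z : Submodule F V, (if Z ≤ b.orthogonal U' then 0 else 1) =
          (if ¬ Z ≤ b.orthogonal U' then 1 else 0) := fun Z => by split_ifs <;> simp_all
      have hsub : (linesBetween U' (b.orthogonal U')) ⊆ linesBetween U' (b.orthogonal U) :=
        fun Z hZ => ⟨hZ.1, hZ.2.1.trans (LinearMap.BilinForm.orthogonal_le hUU'), hZ.2.2⟩
      simp only [e]
      rw [← Finset.sum_filter, Finset.sum_const, smul_eq_mul, mul_one,
        ← Set.ncard_sdiff hsub, Set.ncard_eq_toFinset_card']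
      congr 1
      ext Z
      simp only [Finset.mem_filter, Set.mem_toFinset, Set.mem_sdiff]
      exact ⟨fun ⟨h1, h3⟩ => ⟨h1, fun h => h3 h.2.1⟩, fun ⟨h1, h3⟩ => ⟨h1, fun h =>
        h3 ⟨h1.1, h, h1.2.2⟩⟩⟩
    · rw [← Finset.sum_filter, Finset.sum_const, smul_eq_mul, mul_comm,
        Set.ncard_eq_toFinset_card']
      congr 2
      ext Z
      simp only [Finset.mem_filter, Set.mem_toFinset]
      exact ⟨fun ⟨h1, h3⟩ => ⟨h1.1, h3, h1.2.2⟩, fun ⟨h1, h3, h4⟩ => ⟨⟨h1, h3.trans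
        (LinearMap.BilinForm.orthogonal_le (hUU'.trans h1)), h4⟩, h3⟩⟩
  have l1 := ncard_linesBetween hUiso
  have l2 := ncard_linesBetween hiso
  have hle : (linesBetween U' (b.orthogonal U')).ncard ≤
      (linesBetween U' (b.orthogonal U)).ncard :=
    Set.ncard_le_ncard
      fun Z hZ => ⟨hZ.1, hZ.2.1.trans (LinearMap.BilinForm.orthogonal_le hUU'), hZ.2.2⟩
  rw [hcount]
  push_cast [Nat.cast_sub hle]
  have dU := finrank_add_orthogonal hb U
  have dU' := finrank_add_orthogonal hb U'
  have dm := Submodule.finrank_mono hiso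
  have hqr : (2 : ℝ) ≤ q := by exact_mod_cast hq2
  rw [show finrank F (b.orthogonal U') - finrank F U' = finrank F V - 2 * finrank F U - 2 by omega]
    at l2
  rw [show finrank F (b.orthogonal U) - finrank F U' =
    finrank F V - 2 * finrank F U - 2 + 1 by omega, pow_succ] at l1
  have hdiff : ((linesBetween U' (b.orthogonal U)).ncard : ℝ) -
      (linesBetween U' (b.orthogonal U')).ncard =
      (q : ℝ) ^ (finrank F V - 2 * finrank F U - 2) := by
    apply mul_right_cancel₀ (b := (q - 1 : ℝ)) (by linarith)
    rw [sub_mul, l1, l2]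
    ring
  rw [hdiff]
  ring

end Counting
end TypeD

namespace TypeD

/-! ### The split form of dimension 2d. -/

section Form

variable (d : ℕ) (F : Type) [Field F]

theorem form_isSymm : (form d F).IsSymm := by
  refine ⟨fun x y => ?_⟩
  rw [form, Matrix.toBilin'_apply', Matrix.toBilin'_apply',
    Matrix.dotProduct_mulVec, dotProduct_comm, ← Matrix.mulVec_transpose,
    Matrix.fromBlocks_transpose]
  simp

theorem form_nondegenerate : (form d F).Nondegenerate := by
  rw [form, LinearMap.BilinForm.nondegenerate_toBilin'_iff_det_ne_zero]
  have h : (Matrix.fromBlocks 0 1 1 0 : Matrix (Fin d ⊕ Fin d) (Fin d ⊕ Fin d) F) *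
      Matrix.fromBlocks 0 1 1 0 = 1 := by
    rw [Matrix.fromBlocks_multiply]
    simp [Matrix.fromBlocks_one]
  intro h0
  have := congrArg Matrix.det h
  rw [Matrix.det_mul, h0] at this
  simp at this

theorem finrank_space : finrank F (Space d F) = 2 * d := by
  simp [two_mul]

variable {d F}

theorem finrank_form_orthogonal (W : Submodule F (Space d F)) :
    finrank F W + finrank F ((form d F).orthogonal W) = 2 * d := by
  rw [finrank_add_orthogonal (form_nondegenerate d F), finrank_space]

theorem finrank_le_of_isotropic {W : Submodule F (Space d F)} (h : W ≤ (form d F).orthogonal W) :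
    finrank F W ≤ d := by
  have h1 := finrank_form_orthogonal W
  have h2 := Submodule.finrank_mono h
  omega

theorem orthogonal_eq_self_of_finrank_eq {W : Submodule F (Space d F)}
    (h : W ≤ (form d F).orthogonal W) (hd : finrank F W = d) : (form d F).orthogonal W = W := by
  have h1 := finrank_form_orthogonal W
  exact (Submodule.eq_of_le_of_finrank_eq h (by omega)).symm

theorem orthogonal_orthogonal_form (W : Submodule F (Space d F)) :
    (form d F).orthogonal ((form d F).orthogonal W) = W :=
  LinearMap.BilinForm.orthogonal_orthogonal (form_nondegenerate d F) (form_isSymm d F).isRefl W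

end Form

/-! ### Flags through their steps 1 to n, and replacement of a single step. -/

namespace IsotropicFlag

variable {n d : ℕ} {F : Type} [Field F]

/-- The step `V_{i+1}`. -/
abbrev sp (V : IsotropicFlag n d F) (i : Fin n) : Submodule F (Space d F) :=
  V.stepAt i.succ.castSucc

/-- The step `V_i` that precedes `V.sp i`. -/
abbrev prev (V : IsotropicFlag n d F) (i : Fin n) : Submodule F (Space d F) :=
  V.stepAt i.castSucc.castSucc

/-- The step `V_{i+2}` that follows `V.sp i`. -/
abbrev next (V : IsotropicFlag n d F) (i : Fin n) : Submodule F (Space d F) :=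
  V.stepAt i.succ.succ

theorem stepAt_zero (V : IsotropicFlag n d F) : V.stepAt 0 = ⊥ := V.step_zero

theorem stepAt_mono (V : IsotropicFlag n d F) {j k : Fin (n + 2)} (h : (j : ℕ) ≤ k) :
    V.stepAt j ≤ V.stepAt k := by
  have h' : (⟨j, by omega⟩ : Fin (2 * n + 2)) ≤ ⟨k, by omega⟩ := Fin.mk_le_mk.mpr h
  exact V.mono h'

theorem prev_le (V : IsotropicFlag n d F) (i : Fin n) : V.prev i ≤ V.sp i :=
  V.stepAt_mono (by simp)

theorem le_next (V : IsotropicFlag n d F) (i : Fin n) : V.sp i ≤ V.next i :=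
  V.stepAt_mono (by simp)

theorem sp_mono (V : IsotropicFlag n d F) {i j : Fin n} (h : i ≤ j) : V.sp i ≤ V.sp j :=
  V.stepAt_mono (by simpa using h)

theorem sp_isotropic (V : IsotropicFlag n d F) (i : Fin n) :
    V.sp i ≤ (form d F).orthogonal (V.sp i) := by
  have h := V.perp ⟨2 * n + 1 - (i + 1), by omega⟩ ⟨i + 1, by omega⟩ (by simp; omega)
  have e : V.sp i = V.step ⟨i + 1, by omega⟩ := rfl
  rw [e, ← h]
  exact V.mono (by simp [Fin.le_def]; omega)

theorem finrank_sp_le (V : IsotropicFlag n d F) (i : Fin n) : finrank F (V.sp i) ≤ d :=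
  finrank_le_of_isotropic (V.sp_isotropic i)

theorem prev_eq_bot (V : IsotropicFlag n d F) {i : Fin n} (h : (i : ℕ) = 0) : V.prev i = ⊥ := by
  rw [← V.stepAt_zero]
  exact congrArg V.stepAt (Fin.ext (by simpa using h))

theorem prev_eq_sp (V : IsotropicFlag n d F) {i j : Fin n} (h : (j : ℕ) + 1 = i) :
    V.prev i = V.sp j := by
  exact congrArg V.stepAt (Fin.ext (by simp [← h]))

theorem next_eq_sp (V : IsotropicFlag n d F) {i j : Fin n} (h : (i : ℕ) + 1 = j) :
    V.next i = V.sp j := by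
  exact congrArg V.stepAt (Fin.ext (by simp [← h]))

theorem next_eq_orthogonal (V : IsotropicFlag n d F) {i : Fin n} (h : (i : ℕ) + 1 = n) :
    V.next i = (form d F).orthogonal (V.sp i) :=
  V.perp ⟨i + 2, by omega⟩ ⟨i + 1, by omega⟩ (by simp; omega)

theorem middle_eq_sp (V : IsotropicFlag n d F) {i : Fin n} (h : (i : ℕ) + 1 = n) :
    V.middle = V.sp i := by
  have : (⟨n, by omega⟩ : Fin (2 * n + 2)) = ⟨i + 1, by omega⟩ := Fin.ext h.symm
  exact congrArg V.step this

/-- The steps beyond n are the orthogonal complements of the steps up to n. -/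
theorem ext_sp {V W : IsotropicFlag n d F} (h : ∀ i, V.sp i = W.sp i) : V = W := by
  have low : ∀ k (hk : k < 2 * n + 2), k ≤ n → V.step ⟨k, hk⟩ = W.step ⟨k, hk⟩ := by
    intro k hk hkn
    rcases k with _ | k
    · exact V.step_zero.trans W.step_zero.symm
    · exact h ⟨k, by omega⟩
  apply IsotropicFlag.ext
  funext k
  by_cases hk : (k : ℕ) ≤ n
  · exact low k k.2 hk
  · rw [V.perp k ⟨2 * n + 1 - k, by omega⟩ (by simp; omega),
      W.perp k ⟨2 * n + 1 - k, by omega⟩ (by simp; omega), low _ _ (by omega)]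

theorem exists_sp_eq (s : Fin n → Submodule F (Space d F)) (hs : Monotone s)
    (hiso : ∀ i, s i ≤ (form d F).orthogonal (s i)) :
    ∃ V : IsotropicFlag n d F, ∀ i, V.sp i = s i := by
  -- The value ⊥ outside [1, n] supplies the zeroth step; indices above n are never used.
  let t : ℕ → Submodule F (Space d F) := fun k =>
    if h : 0 < k ∧ k ≤ n then s ⟨k - 1, by omega⟩ else ⊥
  have t0 : t 0 = ⊥ := dif_neg (by omega)
  have tmono : ∀ j k, j ≤ k → k ≤ n → t j ≤ t k := by
    intro j k hjk hk
    by_cases hj : 0 < j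
    · have e1 : t j = s ⟨j - 1, by omega⟩ := dif_pos ⟨hj, by omega⟩
      have e2 : t k = s ⟨k - 1, by omega⟩ := dif_pos ⟨by omega, by omega⟩
      rw [e1, e2]
      exact hs (by simp [Fin.le_def]; omega)
    · have : j = 0 := by omega
      rw [this, t0]
      exact bot_le
  have tiso : ∀ k, t k ≤ (form d F).orthogonal (t k) := by
    intro k
    by_cases hk : 0 < k ∧ k ≤ n
    · have e : t k = s ⟨k - 1, by omega⟩ := dif_pos hk
      rw [e]
      exact hiso _
    · have e : t k = ⊥ := dif_neg hk
      rw [e]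
      exact bot_le
  refine ⟨⟨fun k => if (k : ℕ) ≤ n then t k else (form d F).orthogonal (t (2 * n + 1 - k)),
    ?_, ?_, ?_⟩, ?_⟩
  · simpa using t0
  · intro j k hjk
    have hjk' : (j : ℕ) ≤ k := hjk
    by_cases hk : (k : ℕ) ≤ n
    · simp only [hk, if_true, hjk'.trans hk]
      exact tmono _ _ hjk' hk
    · by_cases hj : (j : ℕ) ≤ n
      · simp only [hk, if_false, hj, if_true]
        exact (tmono j n hj le_rfl).trans ((tiso n).trans
          (LinearMap.BilinForm.orthogonal_le (tmono _ _ (by omega) le_rfl)))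
      · simp only [hk, if_false, hj]
        exact LinearMap.BilinForm.orthogonal_le (tmono _ _ (by omega) (by omega))
  · intro j k hjk
    by_cases hj : (j : ℕ) ≤ n
    · have hk : ¬ (k : ℕ) ≤ n := by omega
      simp only [hk, if_false, hj, if_true]
      rw [orthogonal_orthogonal_form]
      congr 1
      omega
    · have hk : (k : ℕ) ≤ n := by omega
      simp only [hk, if_true, hj, if_false]
      congr 2
      omega
  · intro i
    have hi : (i : ℕ) + 1 ≤ n := i.2
    change (if (i : ℕ) + 1 ≤ n then t (i + 1) else _) = s i
    rw [if_pos hi]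
    exact dif_pos ⟨by omega, hi⟩

theorem AgreeOff.symm {V W : IsotropicFlag n d F} {i : Fin n} (h : V.AgreeOff W i) :
    W.AgreeOff V i := fun j hj => (h j hj).symm

theorem AgreeOff.trans {V W X : IsotropicFlag n d F} {i : Fin n} (h : V.AgreeOff W i)
    (h' : W.AgreeOff X i) : V.AgreeOff X i := fun j hj => (h j hj).trans (h' j hj)

theorem AgreeOff.eq_of_sp_eq {V W : IsotropicFlag n d F} {i : Fin n} (h : V.AgreeOff W i)
    (h' : V.sp i = W.sp i) : V = W := by
  apply ext_sp
  intro j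
  by_cases hj : j = i
  · rw [hj, h']
  · exact h j hj

theorem AgreeOff.stepAt_eq {V W : IsotropicFlag n d F} {i : Fin n} (h : V.AgreeOff W i)
    {k : Fin (n + 1)} (hk : (k : ℕ) ≠ i + 1) : V.stepAt k.castSucc = W.stepAt k.castSucc := by
  rcases Fin.eq_zero_or_eq_succ k with rfl | ⟨j, rfl⟩
  · exact V.stepAt_zero.trans W.stepAt_zero.symm
  · exact h j fun hj => hk (by simp [hj])

theorem AgreeOff.prev_eq {V W : IsotropicFlag n d F} {i : Fin n} (h : V.AgreeOff W i) :
    V.prev i = W.prev i := h.stepAt_eq (by simp)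

theorem AgreeOff.next_eq {V W : IsotropicFlag n d F} {i : Fin n} (h : V.AgreeOff W i)
    (hi : (i : ℕ) + 1 ≠ n) : V.next i = W.next i := by
  have hi' : (i : ℕ) + 1 < n := by omega
  rw [V.next_eq_sp (j := ⟨i + 1, hi'⟩) rfl, W.next_eq_sp (j := ⟨i + 1, hi'⟩) rfl]
  exact h _ fun hj => by simpa using congrArg Fin.val hj

/-- The subspaces that may replace `V.sp i`. -/
def Admissible (V : IsotropicFlag n d F) (i : Fin n) (X : Submodule F (Space d F)) : Prop :=
  V.prev i ≤ X ∧ ((i : ℕ) + 1 ≠ n → X ≤ V.next i) ∧ X ≤ (form d F).orthogonal X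

/-- The conditions are those that keep the lower half of the flag monotone and isotropic. At the
last index no upper bound is needed, because the following step is recomputed as the orthogonal
complement of the new one. -/
theorem exists_replace {V : IsotropicFlag n d F} {i : Fin n} {X : Submodule F (Space d F)}
    (h : V.Admissible i X) : ∃ W : IsotropicFlag n d F, W.AgreeOff V i ∧ W.sp i = X := by
  obtain ⟨h1, h2, h3⟩ := h
  obtain ⟨W, hW⟩ := exists_sp_eq (Function.update V.sp i X) (by
    intro j k hjk
    rcases hjk.lt_or_eq with hlt | rfl
    · by_cases hj : j = i
      · subst hj
        have hk : k ≠ j := hlt.ne'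
        rw [Function.update_self, Function.update_of_ne hk]
        have hlt' : (j : ℕ) < k := hlt
        refine (h2 (by omega)).trans ?_
        exact V.stepAt_mono (by simp; omega)
      · by_cases hk : k = i
        · subst hk
          rw [Function.update_self, Function.update_of_ne hj]
          refine le_trans ?_ h1
          have hlt' : (j : ℕ) < k := hlt
          exact V.stepAt_mono (by simp; omega)
        · rw [Function.update_of_ne hj, Function.update_of_ne hk]
          exact V.sp_mono hjk
    · exact le_rfl) (by
    intro j
    by_cases hj : j = i
    · subst hj
      rwa [Function.update_self]
    · rw [Function.update_of_ne hj]
      exact V.sp_isotropic j)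
  refine ⟨W, fun j hj => ?_, ?_⟩
  · exact (hW j).trans (Function.update_of_ne hj _ _)
  · rw [hW, Function.update_self]

theorem admissible_sp (V : IsotropicFlag n d F) (i : Fin n) : V.Admissible i (V.sp i) :=
  ⟨V.prev_le i, fun _ => V.le_next i, V.sp_isotropic i⟩

theorem admissible_of_le {V : IsotropicFlag n d F} {i : Fin n} {X : Submodule F (Space d F)}
    (h1 : V.prev i ≤ X) (h2 : X ≤ V.sp i) : V.Admissible i X :=
  ⟨h1, fun _ => h2.trans (V.le_next i),
    h2.trans ((V.sp_isotropic i).trans (LinearMap.BilinForm.orthogonal_le h2))⟩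

/-- Isotropy has to be assumed only at the last index; elsewhere it is inherited from the next step.
-/
theorem admissible_of_ge {V : IsotropicFlag n d F} {i : Fin n} {X : Submodule F (Space d F)}
    (h1 : V.sp i ≤ X) (h2 : (i : ℕ) + 1 ≠ n → X ≤ V.next i)
    (h3 : (i : ℕ) + 1 = n → X ≤ (form d F).orthogonal X) : V.Admissible i X := by
  refine ⟨(V.prev_le i).trans h1, h2, ?_⟩
  by_cases hi : (i : ℕ) + 1 = n
  · exact h3 hi
  · have hi' : (i : ℕ) + 1 < n := by omega
    have h4 := h2 hi
    rw [V.next_eq_sp (j := ⟨i + 1, hi'⟩) rfl] at h4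
    exact h4.trans ((V.sp_isotropic _).trans (LinearMap.BilinForm.orthogonal_le h4))

/-- With the other steps fixed, a flag is the same as its step at i, so flags can be counted as
subspaces. -/
theorem ncard_slice (V : IsotropicFlag n d F) (i : Fin n)
    {S : Set (Submodule F (Space d F))} (hS : ∀ X ∈ S, V.Admissible i X) :
    {W : IsotropicFlag n d F | W.AgreeOff V i ∧ W.sp i ∈ S}.ncard = S.ncard := by
  have e : S = (fun W : IsotropicFlag n d F => W.sp i) '' {W | W.AgreeOff V i ∧ W.sp i ∈ S} := by
    ext X
    constructor
    · intro hX
      obtain ⟨W, hW, rfl⟩ := exists_replace (hS X hX)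
      exact ⟨W, ⟨hW, hX⟩, rfl⟩
    · rintro ⟨W, ⟨_, hW⟩, rfl⟩
      exact hW
  conv_rhs => rw [e]
  rw [Set.InjOn.ncard_image]
  rintro W ⟨hW, _⟩ X ⟨hX, _⟩ h
  exact (hW.trans hX.symm).eq_of_sp_eq h

/-- `V_{i+1}` is contained in `W_{i+1}` with codimension `k`, and the other steps in `[1, n]`
are the same. -/
def BelowBy (k : ℕ) (V W : IsotropicFlag n d F) (i : Fin n) : Prop :=
  V.sp i ≤ W.sp i ∧ finrank F (W.sp i) = finrank F (V.sp i) + k ∧ V.AgreeOff W i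

section Finite

variable [Finite F]

theorem ncard_between {V W : IsotropicFlag n d F} {i : Fin n} (h : BelowBy 2 V W i) :
    {X | BelowBy 1 V X i ∧ BelowBy 1 X W i}.ncard = Nat.card F + 1 := by
  obtain ⟨h1, h2, h3⟩ := h
  rw [← ncard_linesBetween_of_finrank_eq_add_two h1 h2, ← ncard_slice W i]
  · congr 1
    ext X
    constructor
    · rintro ⟨⟨a1, a2, a3⟩, ⟨b1, b2, b3⟩⟩
      exact ⟨b3, a1, b1, a2⟩
    · rintro ⟨a1, a2, a3, a4⟩
      exact ⟨⟨a2, a4, h3.trans a1.symm⟩, ⟨a3, by omega, a1⟩⟩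
  · rintro X ⟨hX1, hX2, hX3⟩
    exact admissible_of_le ((h3.prev_eq.symm.le.trans (V.prev_le i)).trans hX1) hX2

theorem ncard_down (W : IsotropicFlag n d F) (i : Fin n) :
    ({X | BelowBy 1 X W i}.ncard : ℝ) * (Nat.card F - 1) =
      (Nat.card F : ℝ) ^ (finrank F (W.sp i) - finrank F (W.prev i)) - 1 := by
  rw [← ncard_hyperplanesBetween (form_nondegenerate d F) (form_isSymm d F) (W.prev_le i),
    ← ncard_slice W i (S := hyperplanesBetween (W.prev i) (W.sp i))]
  · congr 3
    ext X
    constructor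
    · rintro ⟨a1, a2, a3⟩
      exact ⟨a3, a3.prev_eq.symm.le.trans (X.prev_le i), a1, a2.symm⟩
    · rintro ⟨a1, a2, a3, a4⟩
      exact ⟨a3, a4.symm, a1⟩
  · rintro X ⟨hX1, hX2, hX3⟩
    exact admissible_of_le hX1 hX2

theorem ncard_up (V : IsotropicFlag n d F) {i : Fin n} (hi : (i : ℕ) + 1 ≠ n) :
    ({X | BelowBy 1 V X i}.ncard : ℝ) * (Nat.card F - 1) =
      (Nat.card F : ℝ) ^ (finrank F (V.next i) - finrank F (V.sp i)) - 1 := by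
  rw [← ncard_linesBetween (V.le_next i),
    ← ncard_slice V i (S := linesBetween (V.sp i) (V.next i))]
  · congr 3
    ext X
    constructor
    · rintro ⟨a1, a2, a3⟩
      exact ⟨a3.symm, a1, (X.le_next i).trans (a3.next_eq hi).symm.le, a2⟩
    · rintro ⟨a1, a2, a3, a4⟩
      exact ⟨a2, a4, a1.symm⟩
  · rintro X ⟨hX1, hX2, hX3⟩
    exact admissible_of_ge hX1 (fun _ => hX2) (fun h => absurd h hi)

omit [Finite F] in
-- Nothing but isotropy bounds the last step from above, so isotropic lines replace the lines inside
-- the next step.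
theorem ncard_up_last (V : IsotropicFlag n d F) {i : Fin n} (hi : (i : ℕ) + 1 = n) :
    {X | BelowBy 1 V X i}.ncard = (isotropicLines (form d F) (V.sp i)).ncard := by
  rw [← ncard_slice V i (S := isotropicLines (form d F) (V.sp i))]
  · congr 1
    ext X
    constructor
    · rintro ⟨a1, a2, a3⟩
      exact ⟨a3.symm, a1, X.sp_isotropic i, a2⟩
    · rintro ⟨a1, a2, a3, a4⟩
      exact ⟨a2, a4, a1.symm⟩
  · rintro X ⟨hX1, hX2, hX3⟩
    exact admissible_of_ge hX1 (fun h => absurd hi h) (fun _ => hX2)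

end Finite

end IsotropicFlag
end TypeD

namespace TypeD

/-! ### Incidence matrices: commutation and Serre relations. -/

namespace IsotropicFlag

variable {n d : ℕ} {F : Type} [Field F]

theorem AgreeOff.admissible {V W : IsotropicFlag n d F} {i : Fin n} (h : V.AgreeOff W i)
    {X : Submodule F (Space d F)} (hX : V.Admissible i X) : W.Admissible i X :=
  ⟨h.prev_eq ▸ hX.1, fun hi => h.next_eq hi ▸ hX.2.1 hi, hX.2.2⟩

theorem AgreeOff.admissible_sp {V W : IsotropicFlag n d F} {i : Fin n} (h : V.AgreeOff W i) :
    W.Admissible i (V.sp i) := h.admissible (V.admissible_sp i)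

theorem prev_le_of_forall {V : IsotropicFlag n d F} {i : Fin n} {X : Submodule F (Space d F)}
    (h : ∀ j : Fin n, (j : ℕ) + 1 = i → V.sp j ≤ X) : V.prev i ≤ X := by
  by_cases hi : (i : ℕ) = 0
  · rw [V.prev_eq_bot hi]
    exact bot_le
  · have hj : ((⟨i - 1, by omega⟩ : Fin n) : ℕ) + 1 = i := by simp; omega
    rw [V.prev_eq_sp hj]
    exact h _ hj

theorem le_next_of_forall {V : IsotropicFlag n d F} {i : Fin n} {X : Submodule F (Space d F)}
    (h : ∀ j : Fin n, (i : ℕ) + 1 = j → X ≤ V.sp j) (hi : (i : ℕ) + 1 ≠ n) : X ≤ V.next i := by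
  rw [V.next_eq_sp (j := ⟨i + 1, by omega⟩) rfl]
  exact h _ rfl

/-- `V_{i+1} ⊆ W_{i+1}` with codimension `k`, `V_{j+1} ⊆ W_{j+1}` with codimension `l`, and the
other steps in `[1, n]` are the same. -/
def RectBelow (k l : ℕ) (V W : IsotropicFlag n d F) (i j : Fin n) : Prop :=
  V.sp i ≤ W.sp i ∧ finrank F (W.sp i) = finrank F (V.sp i) + k ∧ V.sp j ≤ W.sp j ∧
    finrank F (W.sp j) = finrank F (V.sp j) + l ∧ ∀ m, m ≠ i → m ≠ j → V.sp m = W.sp m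

theorem RectBelow.swap {k l : ℕ} {V W : IsotropicFlag n d F} {i j : Fin n}
    (h : RectBelow k l V W i j) : RectBelow l k V W j i :=
  ⟨h.2.2.1, h.2.2.2.1, h.1, h.2.1, fun m h1 h2 => h.2.2.2.2 m h2 h1⟩

theorem rectBelow_comm {k l : ℕ} {V W : IsotropicFlag n d F} {i j : Fin n} :
    RectBelow k l V W i j ↔ RectBelow l k V W j i := ⟨RectBelow.swap, RectBelow.swap⟩

/-- Enlarging step i first can only conflict with the step right after it, and that step already has
its final value unless it is step j. -/
theorem RectBelow.admissible {k l : ℕ} {V W : IsotropicFlag n d F} {i j : Fin n}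
    (h : RectBelow k l V W i j) (hij : (i : ℕ) + 1 ≠ j) : V.Admissible i (W.sp i) := by
  refine admissible_of_ge h.1 (le_next_of_forall fun m hm => ?_) fun _ => W.sp_isotropic i
  rw [h.2.2.2.2 m (by rintro rfl; omega) (by rintro rfl; omega)]
  exact W.sp_mono (Fin.le_def.mpr (by omega))

theorem RectBelow.admissible_iff {k l : ℕ} {V W : IsotropicFlag n d F} {i j : Fin n}
    (h : RectBelow k l V W i j) (hij : (i : ℕ) + 1 = j) :
    V.Admissible i (W.sp i) ↔ W.sp i ≤ V.sp j := by
  rw [← V.next_eq_sp hij]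
  constructor
  · exact fun h' => h'.2.1 (by omega)
  · exact fun h' => admissible_of_ge h.1 (fun _ => h') fun _ => W.sp_isotropic i

/-- `V_{i+1} ⊆ W_{i+1}` and `W_{j+1} ⊆ V_{j+1}` with codimension one, and the other steps in
`[1, n]` are the same. -/
def RectMixed (V W : IsotropicFlag n d F) (i j : Fin n) : Prop :=
  V.sp i ≤ W.sp i ∧ finrank F (W.sp i) = finrank F (V.sp i) + 1 ∧ W.sp j ≤ V.sp j ∧
    finrank F (V.sp j) = finrank F (W.sp j) + 1 ∧ ∀ m, m ≠ i → m ≠ j → V.sp m = W.sp m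

theorem RectMixed.sp_le {V W : IsotropicFlag n d F} {i j : Fin n}
    (h : RectMixed V W i j) {m : Fin n} (hm : m ≠ i) : W.sp m ≤ V.sp m := by
  by_cases hj : m = j
  · rw [hj]; exact h.2.2.1
  · exact (h.2.2.2.2 m hm hj).symm.le

theorem RectMixed.le_sp {V W : IsotropicFlag n d F} {i j : Fin n}
    (h : RectMixed V W i j) {m : Fin n} (hm : m ≠ j) : V.sp m ≤ W.sp m := by
  by_cases hi : m = i
  · rw [hi]; exact h.1
  · exact (h.2.2.2.2 m hi hm).le

/-- All steps other than i can only shrink on the way to W. The enlarged step i fits below the final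
next step, hence below the initial one. -/
theorem RectMixed.admissible_left {V W : IsotropicFlag n d F} {i j : Fin n}
    (h : RectMixed V W i j) : V.Admissible i (W.sp i) := by
  refine admissible_of_ge h.1 (le_next_of_forall fun m hm => ?_) fun _ => W.sp_isotropic i
  exact (W.sp_mono (Fin.le_def.mpr (by omega))).trans (h.sp_le (by rintro rfl; omega))

theorem RectMixed.admissible_right {V W : IsotropicFlag n d F} {i j : Fin n}
    (h : RectMixed V W i j) : V.Admissible j (W.sp j) := by
  refine admissible_of_le (prev_le_of_forall fun m hm => ?_) h.2.2.1
  exact (h.le_sp (by rintro rfl; omega)).trans (W.sp_mono (Fin.le_def.mpr (by omega)))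

section Matrices

variable [Finite F]

open Classical in
/-- The incidence matrix of the relation `BelowBy k`. -/
noncomputable def incid (n d : ℕ) (F : Type) [Field F] (k : ℕ) (i : Fin n) :
    Matrix (IsotropicFlag n d F) (IsotropicFlag n d F) ℝ :=
  Matrix.of fun V W => if BelowBy k V W i then 1 else 0

open Classical in
omit [Finite F] in
theorem incid_apply (k : ℕ) (i : Fin n) (V W : IsotropicFlag n d F) :
    incid n d F k i V W = if BelowBy k V W i then 1 else 0 := rfl

open Classical in
theorem sum_indicator_mul (P Q : IsotropicFlag n d F → Prop) :
    ∑ X, (if P X then (1 : ℝ) else 0) * (if Q X then 1 else 0) =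
      ({X | P X ∧ Q X}.ncard : ℝ) := by
  rw [Set.ncard_eq_toFinset_card', Set.toFinset_ofPred, ← Finset.sum_boole]
  refine Finset.sum_congr rfl fun X _ => ?_
  split_ifs <;> simp_all

theorem incid_mul_incid_apply (k l : ℕ) (i j : Fin n) (V W : IsotropicFlag n d F) :
    (incid n d F k i * incid n d F l j) V W =
      ({X | BelowBy k V X i ∧ BelowBy l X W j}.ncard : ℝ) := sum_indicator_mul _ _

theorem incid_mul_transpose_apply (k l : ℕ) (i j : Fin n) (V W : IsotropicFlag n d F) :
    (incid n d F k i * (incid n d F l j).transpose) V W =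
      ({X | BelowBy k V X i ∧ BelowBy l W X j}.ncard : ℝ) := sum_indicator_mul _ _

theorem transpose_mul_incid_apply (k l : ℕ) (i j : Fin n) (V W : IsotropicFlag n d F) :
    ((incid n d F k i).transpose * incid n d F l j) V W =
      ({X | BelowBy k X V i ∧ BelowBy l X W j}.ncard : ℝ) := sum_indicator_mul _ _

/-- The factor q + 1 counts the lines in a plane. The matrix for codimension two plays the role of a
divided square. -/
theorem incid_mul_self (i : Fin n) :
    incid n d F 1 i * incid n d F 1 i = ((Nat.card F : ℝ) + 1) • incid n d F 2 i := by
  classical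
  ext V W
  rw [incid_mul_incid_apply, Matrix.smul_apply, incid_apply]
  split_ifs with h
  · rw [ncard_between h]
    simp
  · rw [smul_zero, Nat.cast_eq_zero, Set.ncard_eq_zero, Set.eq_empty_iff_forall_notMem]
    rintro X ⟨⟨a1, a2, a3⟩, ⟨b1, b2, b3⟩⟩
    exact h ⟨a1.trans b1, by omega, a3.trans b3⟩

open Classical in
-- The intermediate flag is forced: step i comes from W and all others from V. The entry only asks
-- whether this is a flag.
theorem incid_mul_incid_of_ne (k l : ℕ) {i j : Fin n} (hij : i ≠ j) (V W : IsotropicFlag n d F) :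
    (incid n d F k i * incid n d F l j) V W =
      if RectBelow k l V W i j ∧ V.Admissible i (W.sp i) then 1 else 0 := by
  rw [incid_mul_incid_apply]
  split_ifs with h
  · obtain ⟨⟨h1, h2, h3, h4, h5⟩, h6⟩ := h
    obtain ⟨X, hX, hXi⟩ := exists_replace h6
    rw [Nat.cast_eq_one, Set.ncard_eq_one]
    refine ⟨X, ?_⟩
    ext Y
    constructor
    · rintro ⟨⟨a1, a2, a3⟩, ⟨b1, b2, b3⟩⟩
      exact (a3.symm.trans hX.symm).eq_of_sp_eq ((b3 i hij).trans hXi.symm)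
    · rintro rfl
      have e : Y.sp j = V.sp j := hX j hij.symm
      refine ⟨⟨hXi ▸ h1, hXi ▸ h2, hX.symm⟩, ⟨e ▸ h3, e ▸ h4, ?_⟩⟩
      intro m hm
      by_cases hmi : m = i
      · rw [hmi]; exact hXi
      · exact (hX m hmi).trans (h5 m hmi hm)
  · rw [Nat.cast_eq_zero, Set.ncard_eq_zero, Set.eq_empty_iff_forall_notMem]
    rintro X ⟨⟨a1, a2, a3⟩, ⟨b1, b2, b3⟩⟩
    have e : X.sp i = W.sp i := b3 i hij
    have e' : V.sp j = X.sp j := a3 j hij.symm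
    refine h ⟨⟨e ▸ a1, e ▸ a2, e' ▸ b1, e' ▸ b2, fun m h1 h2 => (a3 m h1).trans (b3 m h2)⟩, ?_⟩
    exact e ▸ a3.symm.admissible_sp

/-- Nonadjacent incidence matrices commute. -/
theorem incid_comm {i j : Fin n} (h1 : i ≠ j) (h2 : (i : ℕ) + 1 ≠ j) (h3 : (j : ℕ) + 1 ≠ i) :
    incid n d F 1 i * incid n d F 1 j = incid n d F 1 j * incid n d F 1 i := by
  classical
  ext V W
  rw [incid_mul_incid_of_ne _ _ h1, incid_mul_incid_of_ne _ _ h1.symm]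
  refine if_congr ⟨fun h => ⟨h.1.swap, h.1.swap.admissible h3⟩,
    fun h => ⟨h.1.swap, h.1.swap.admissible h2⟩⟩ rfl rfl

/-- Enlarging one step and shrinking a different one never obstruct each other, so in either order
there is exactly one intermediate flag. -/
theorem incid_transpose_comm {i j : Fin n} (hij : i ≠ j) :
    incid n d F 1 i * (incid n d F 1 j).transpose =
      (incid n d F 1 j).transpose * incid n d F 1 i := by
  classical
  ext V W
  have e1 : (incid n d F 1 i * (incid n d F 1 j).transpose) V W =
      if RectMixed V W i j then 1 else 0 := by
    rw [incid_mul_transpose_apply]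
    split_ifs with h
    · obtain ⟨X, hX, hXi⟩ := exists_replace h.admissible_left
      obtain ⟨h1, h2, h3, h4, h5⟩ := h
      rw [Nat.cast_eq_one, Set.ncard_eq_one]
      refine ⟨X, ?_⟩
      ext Y
      constructor
      · rintro ⟨⟨a1, a2, a3⟩, ⟨b1, b2, b3⟩⟩
        exact (a3.symm.trans hX.symm).eq_of_sp_eq ((b3 i hij).symm.trans hXi.symm)
      · rintro rfl
        have e : Y.sp j = V.sp j := hX j hij.symm
        refine ⟨⟨hXi ▸ h1, hXi ▸ h2, hX.symm⟩, ⟨e ▸ h3, e ▸ h4, ?_⟩⟩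
        intro m hm
        by_cases hmi : m = i
        · rw [hmi]; exact hXi.symm
        · exact (h5 m hmi hm).symm.trans (hX m hmi).symm
    · rw [Nat.cast_eq_zero, Set.ncard_eq_zero, Set.eq_empty_iff_forall_notMem]
      rintro X ⟨⟨a1, a2, a3⟩, ⟨b1, b2, b3⟩⟩
      have e : X.sp i = W.sp i := (b3 i hij).symm
      have e' : V.sp j = X.sp j := a3 j hij.symm
      exact h ⟨e ▸ a1, e ▸ a2, e' ▸ b1, e' ▸ b2, fun m h1 h2 => (a3 m h1).trans (b3 m h2).symm⟩
  have e2 : ((incid n d F 1 j).transpose * incid n d F 1 i) V W =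
      if RectMixed V W i j then 1 else 0 := by
    rw [transpose_mul_incid_apply]
    split_ifs with h
    · obtain ⟨X, hX, hXj⟩ := exists_replace h.admissible_right
      obtain ⟨h1, h2, h3, h4, h5⟩ := h
      rw [Nat.cast_eq_one, Set.ncard_eq_one]
      refine ⟨X, ?_⟩
      ext Y
      constructor
      · rintro ⟨⟨a1, a2, a3⟩, ⟨b1, b2, b3⟩⟩
        exact (a3.trans hX.symm).eq_of_sp_eq ((b3 j hij.symm).trans hXj.symm)
      · rintro rfl
        have e : Y.sp i = V.sp i := hX i hij
        refine ⟨⟨hXj ▸ h3, hXj ▸ h4, hX⟩, ⟨e ▸ h1, e ▸ h2, ?_⟩⟩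
        intro m hm
        by_cases hmj : m = j
        · rw [hmj]; exact hXj
        · exact (hX m hmj).trans (h5 m hm hmj)
    · rw [Nat.cast_eq_zero, Set.ncard_eq_zero, Set.eq_empty_iff_forall_notMem]
      rintro X ⟨⟨a1, a2, a3⟩, ⟨b1, b2, b3⟩⟩
      have e : X.sp j = W.sp j := b3 j hij.symm
      have e' : X.sp i = V.sp i := a3 i hij
      exact h ⟨e' ▸ b1, e' ▸ b2, e ▸ a1, e ▸ a2,
        fun m h1 h2 => (a3 m h2).symm.trans (b3 m h1)⟩
  rw [e1, e2]

theorem incid_triple_apply {i j : Fin n} (hij : i ≠ j) (V W : IsotropicFlag n d F) :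
    (incid n d F 1 i * incid n d F 1 j * incid n d F 1 i) V W =
      ({X | (RectBelow 1 1 V X i j ∧ V.Admissible i (X.sp i)) ∧ BelowBy 1 X W i}.ncard : ℝ) := by
  classical
  rw [Matrix.mul_apply, ← sum_indicator_mul]
  refine Finset.sum_congr rfl fun X _ => ?_
  rw [incid_mul_incid_of_ne _ _ hij, incid_apply]
  congr

theorem incid_triple_eq_zero {i j : Fin n} (hij : i ≠ j) {V W : IsotropicFlag n d F}
    (h : ¬ RectBelow 2 1 V W i j) :
    (incid n d F 1 i * incid n d F 1 j * incid n d F 1 i) V W = 0 := by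
  rw [incid_triple_apply hij, Nat.cast_eq_zero, Set.ncard_eq_zero,
    Set.eq_empty_iff_forall_notMem]
  rintro X ⟨⟨⟨a1, a2, a3, a4, a5⟩, _⟩, ⟨b1, b2, b3⟩⟩
  have e : X.sp j = W.sp j := b3 j hij.symm
  exact h ⟨a1.trans b1, by omega, e ▸ a3, e ▸ a4, fun m h1 h2 => (a5 m h1 h2).trans (b3 m h1)⟩

/-- Between the second and third move only step i is free. If j follows i, that step was chosen
before step j grew and must fit into the old step j; if j precedes i, it must contain the enlarged
step j. -/
theorem incid_triple_eq_ncard {i j : Fin n} (hij : i ≠ j) {V W : IsotropicFlag n d F}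
    (h : RectBelow 2 1 V W i j) {S : Set (Submodule F (Space d F))}
    (hS : ∀ X, X ∈ S ↔ X ∈ linesBetween (V.sp i) (W.sp i) ∧
      ((i : ℕ) + 1 = j → X ≤ V.sp j) ∧ ((j : ℕ) + 1 = i → W.sp j ≤ X)) :
    (incid n d F 1 i * incid n d F 1 j * incid n d F 1 i) V W = (S.ncard : ℝ) := by
  obtain ⟨h1, h2, h3, h4, h5⟩ := h
  rw [incid_triple_apply hij, ← ncard_slice W i (S := S)]
  · congr 2
    ext X
    constructor
    · rintro ⟨⟨⟨a1, a2, a3, a4, a5⟩, a6⟩, ⟨b1, b2, b3⟩⟩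
      refine ⟨b3, (hS _).mpr ⟨⟨a1, b1, a2⟩, fun hj => ?_, fun hj => ?_⟩⟩
      · rw [← V.next_eq_sp hj]
        exact a6.2.1 (by omega)
      · have e : X.sp j = W.sp j := b3 j hij.symm
        rw [← e]
        exact X.sp_mono (Fin.le_def.mpr (by omega))
    · rintro ⟨a1, a2⟩
      obtain ⟨⟨c1, c2, c3⟩, c4, c5⟩ := (hS _).mp a2
      have e : X.sp j = W.sp j := a1 j hij.symm
      refine ⟨⟨⟨c1, c3, e ▸ h3, e ▸ h4, fun m m1 m2 => (h5 m m1 m2).trans (a1 m m1).symm⟩, ?_⟩,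
        ⟨c2, by omega, a1⟩⟩
      refine admissible_of_ge c1 (le_next_of_forall fun m hm => ?_) fun _ => X.sp_isotropic i
      by_cases hmj : m = j
      · rw [hmj] at hm ⊢
        exact c4 hm
      · have e' : X.sp m = W.sp m := a1 m (by rintro rfl; omega)
        rw [h5 m (by rintro rfl; omega) hmj, ← e']
        exact X.sp_mono (Fin.le_def.mpr (by omega))
  · intro X hX
    obtain ⟨⟨c1, c2, c3⟩, c4, c5⟩ := (hS _).mp hX
    refine admissible_of_le (prev_le_of_forall fun m hm => ?_) c2
    by_cases hmj : m = j
    · rw [hmj] at hm ⊢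
      exact c5 hm
    · rw [← h5 m (by rintro rfl; omega) hmj]
      exact (V.sp_mono (Fin.le_def.mpr (by omega))).trans c1

/-- The Serre relation of the incidence matrices for `j = i + 1`. -/
theorem incid_serre_succ {i j : Fin n} (hij : (i : ℕ) + 1 = j) :
    (Nat.card F : ℝ) • (incid n d F 2 i * incid n d F 1 j)
      - incid n d F 1 i * incid n d F 1 j * incid n d F 1 i
      + incid n d F 1 j * incid n d F 2 i = 0 := by
  classical
  have hne : i ≠ j := by rintro rfl; omega
  ext V W
  rw [Matrix.add_apply, Matrix.sub_apply, Matrix.smul_apply, incid_mul_incid_of_ne _ _ hne,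
    incid_mul_incid_of_ne _ _ hne.symm, Matrix.zero_apply]
  by_cases h : RectBelow 2 1 V W i j
  -- Enlarging the outer step j first is always possible, so the last term contributes 1. If W_i ≤
  -- V_j the three terms give q - (q + 1) + 1; otherwise the only intermediate step is W_i ∩ V_j and
  -- they give 0 - 1 + 1.
  · rw [if_pos (⟨h.swap, h.swap.admissible (by omega)⟩ :
      RectBelow 1 2 V W j i ∧ V.Admissible j (W.sp j))]
    simp only [h, true_and, h.admissible_iff hij]
    obtain ⟨h1, h2, h3, h4, h5⟩ := id h
    have hVij : V.sp i ≤ V.sp j := V.sp_mono (Fin.le_def.mpr (by omega))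
    have hWij : W.sp i ≤ W.sp j := W.sp_mono (Fin.le_def.mpr (by omega))
    by_cases hle : W.sp i ≤ V.sp j
    · rw [if_pos hle, incid_triple_eq_ncard hne h (S := linesBetween (V.sp i) (W.sp i)),
        ncard_linesBetween_of_finrank_eq_add_two h1 h2]
      · simp
      · intro X
        refine ⟨fun hX => ⟨hX, fun _ => hX.2.1.trans hle, fun hj => by omega⟩, fun hX => hX.1⟩
    · rw [if_neg hle, incid_triple_eq_ncard hne h (S := {W.sp i ⊓ V.sp j})]
      · simp
      · have d1 := Submodule.finrank_sup_add_finrank_inf_eq (W.sp i) (V.sp j)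
        have d2 : finrank F (W.sp i ⊔ V.sp j : Submodule F (Space d F)) ≤ finrank F (W.sp j) :=
          Submodule.finrank_mono (sup_le hWij h3)
        have d3 : finrank F (W.sp i ⊓ V.sp j : Submodule F (Space d F)) < finrank F (W.sp i) := by
          apply Submodule.finrank_lt_finrank_of_lt
          exact lt_of_le_of_ne inf_le_left fun h => hle (inf_eq_left.mp h)
        intro X
        rw [Set.mem_singleton_iff]
        constructor
        · rintro rfl
          exact ⟨⟨le_inf h1 hVij, inf_le_left, by omega⟩, fun _ => inf_le_right,
            fun hj => by omega⟩
        · rintro ⟨⟨x1, x2, x3⟩, x4, _⟩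
          exact Submodule.eq_of_le_of_finrank_eq (le_inf x2 (x4 hij)) (by omega)
  · rw [if_neg fun h' => h h'.1, if_neg fun h' => h h'.1.swap, incid_triple_eq_zero hne h]
    simp

/-- The Serre relation of the incidence matrices for `i = j + 1`. -/
theorem incid_serre_pred {i j : Fin n} (hij : (j : ℕ) + 1 = i) :
    incid n d F 2 i * incid n d F 1 j
      - incid n d F 1 i * incid n d F 1 j * incid n d F 1 i
      + (Nat.card F : ℝ) • (incid n d F 1 j * incid n d F 2 i) = 0 := by
  classical
  have hne : i ≠ j := by rintro rfl; omega
  ext V W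
  rw [Matrix.add_apply, Matrix.sub_apply, Matrix.smul_apply, incid_mul_incid_of_ne _ _ hne,
    incid_mul_incid_of_ne _ _ hne.symm, Matrix.zero_apply]
  by_cases h : RectBelow 2 1 V W i j
  -- The dual situation: the terms give 1 - (q + 1) + q if W_j ≤ V_i. Otherwise V_i + W_j is the
  -- only intermediate step and they give 1 - 1 + 0.
  · rw [if_pos (⟨h, h.admissible (by omega)⟩ :
      RectBelow 2 1 V W i j ∧ V.Admissible i (W.sp i))]
    simp only [h.swap, true_and, h.swap.admissible_iff hij]
    obtain ⟨h1, h2, h3, h4, h5⟩ := id h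
    have hVij : V.sp j ≤ V.sp i := V.sp_mono (Fin.le_def.mpr (by omega))
    have hWij : W.sp j ≤ W.sp i := W.sp_mono (Fin.le_def.mpr (by omega))
    by_cases hle : W.sp j ≤ V.sp i
    · rw [if_pos hle, incid_triple_eq_ncard hne h (S := linesBetween (V.sp i) (W.sp i)),
        ncard_linesBetween_of_finrank_eq_add_two h1 h2]
      · simp
      · intro X
        refine ⟨fun hX => ⟨hX, fun hj => by omega, fun _ => hle.trans hX.1⟩, fun hX => hX.1⟩
    · rw [if_neg hle, incid_triple_eq_ncard hne h (S := {V.sp i ⊔ W.sp j})]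
      · simp
      · have d1 := Submodule.finrank_sup_add_finrank_inf_eq (V.sp i) (W.sp j)
        have d2 : finrank F (V.sp j) ≤ finrank F (V.sp i ⊓ W.sp j : Submodule F (Space d F)) :=
          Submodule.finrank_mono (le_inf hVij h3)
        have d3 : finrank F (V.sp i) < finrank F (V.sp i ⊔ W.sp j : Submodule F (Space d F)) := by
          apply Submodule.finrank_lt_finrank_of_lt
          exact lt_of_le_of_ne le_sup_left fun h => hle (left_eq_sup.mp h)
        intro X
        rw [Set.mem_singleton_iff]
        constructor
        · rintro rfl
          exact ⟨⟨le_sup_left, sup_le h1 hWij, by omega⟩, fun hj => by omega,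
            fun _ => le_sup_right⟩
        · rintro ⟨⟨x1, x2, x3⟩, _, x4⟩
          exact (Submodule.eq_of_le_of_finrank_eq (sup_le x1 (x4 hij)) (by omega)).symm
  · rw [if_neg fun h' => h h'.1, if_neg fun h' => h h'.1.swap, incid_triple_eq_zero hne h]
    simp

end Matrices

end IsotropicFlag
end TypeD

namespace TypeD

/-! ### Products of incidence matrices with transposes, and the relations at the last step. -/

namespace IsotropicFlag

variable {n d : ℕ} {F : Type} [Field F]

/-- `V` and `W` differ only in the step `i + 1`, where both steps have the same dimension and
meet in codimension one. -/
def Neighbours (V W : IsotropicFlag n d F) (i : Fin n) : Prop :=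
  V.AgreeOff W i ∧ finrank F (W.sp i) = finrank F (V.sp i) ∧
    finrank F (V.sp i ⊓ W.sp i : Submodule F (Space d F)) + 1 = finrank F (V.sp i)

theorem BelowBy.neighbours {V W X : IsotropicFlag n d F} {i : Fin n} (hV : BelowBy 1 X V i)
    (hW : BelowBy 1 X W i) (hne : V ≠ W) : Neighbours V W i := by
  obtain ⟨a1, a2, a3⟩ := hV
  obtain ⟨b1, b2, b3⟩ := hW
  have hag := a3.symm.trans b3
  refine ⟨hag, by omega, ?_⟩
  have h1 : finrank F (X.sp i) ≤ finrank F (V.sp i ⊓ W.sp i : Submodule F (Space d F)) :=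
    Submodule.finrank_mono (le_inf a1 b1)
  have h2 : finrank F (V.sp i ⊓ W.sp i : Submodule F (Space d F)) < finrank F (V.sp i) := by
    apply Submodule.finrank_lt_finrank_of_lt
    refine lt_of_le_of_ne inf_le_left fun h => hne (hag.eq_of_sp_eq ?_)
    exact Submodule.eq_of_le_of_finrank_eq (inf_eq_left.mp h) (by omega)
  omega

variable [Finite F]

open Classical in
-- A common hyperplane of two distinct steps of equal dimension must be their intersection.
theorem transpose_mul_self_of_ne (i : Fin n) {V W : IsotropicFlag n d F} (hVW : V ≠ W) :
    ((incid n d F 1 i).transpose * incid n d F 1 i) V W =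
      if Neighbours V W i then 1 else 0 := by
  rw [transpose_mul_incid_apply]
  split_ifs with h
  · obtain ⟨h1, h2, h3⟩ := h
    obtain ⟨X, hX, hXi⟩ := exists_replace (V := V) (i := i) (X := V.sp i ⊓ W.sp i)
      (admissible_of_le (le_inf (V.prev_le i) (h1.prev_eq.le.trans (W.prev_le i))) inf_le_left)
    rw [Nat.cast_eq_one, Set.ncard_eq_one]
    refine ⟨X, ?_⟩
    ext Y
    constructor
    · rintro ⟨⟨a1, a2, a3⟩, ⟨b1, b2, b3⟩⟩
      refine (a3.trans hX.symm).eq_of_sp_eq ?_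
      rw [hXi]
      exact Submodule.eq_of_le_of_finrank_eq (le_inf a1 b1) (by omega)
    · rintro rfl
      refine ⟨⟨hXi ▸ inf_le_left, by rw [hXi]; omega, hX⟩,
        ⟨hXi ▸ inf_le_right, by rw [hXi]; omega, hX.trans h1⟩⟩
  · rw [Nat.cast_eq_zero, Set.ncard_eq_zero, Set.eq_empty_iff_forall_notMem]
    rintro X ⟨a, b⟩
    exact h (a.neighbours b hVW)

open Classical in
-- Dually, the intermediate step must be the sum. It is isotropic because it lies in the next step,
-- which is where the last index is excluded.
theorem mul_transpose_self_of_ne {i : Fin n} (hi : (i : ℕ) + 1 ≠ n)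
    {V W : IsotropicFlag n d F} (hVW : V ≠ W) :
    (incid n d F 1 i * (incid n d F 1 i).transpose) V W =
      if Neighbours V W i then 1 else 0 := by
  rw [incid_mul_transpose_apply]
  have d1 := Submodule.finrank_sup_add_finrank_inf_eq (V.sp i) (W.sp i)
  split_ifs with h
  · obtain ⟨h1, h2, h3⟩ := h
    obtain ⟨X, hX, hXi⟩ := exists_replace (V := V) (i := i) (X := V.sp i ⊔ W.sp i)
      (admissible_of_ge le_sup_left
        (fun _ => sup_le (V.le_next i) ((W.le_next i).trans (h1.next_eq hi).ge))
        fun h => absurd h hi)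
    rw [Nat.cast_eq_one, Set.ncard_eq_one]
    refine ⟨X, ?_⟩
    ext Y
    constructor
    · rintro ⟨⟨a1, a2, a3⟩, ⟨b1, b2, b3⟩⟩
      refine (a3.symm.trans hX.symm).eq_of_sp_eq ?_
      rw [hXi]
      exact (Submodule.eq_of_le_of_finrank_eq (sup_le a1 b1) (by omega)).symm
    · rintro rfl
      refine ⟨⟨hXi ▸ le_sup_left, by rw [hXi]; omega, hX.symm⟩,
        ⟨hXi ▸ le_sup_right, by rw [hXi]; omega, h1.symm.trans hX.symm⟩⟩
  · rw [Nat.cast_eq_zero, Set.ncard_eq_zero, Set.eq_empty_iff_forall_notMem]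
    rintro X ⟨⟨a1, a2, a3⟩, ⟨b1, b2, b3⟩⟩
    have hag := a3.trans b3.symm
    have d2 : finrank F (V.sp i ⊔ W.sp i : Submodule F (Space d F)) ≤ finrank F (X.sp i) :=
      Submodule.finrank_mono (sup_le a1 b1)
    have d3 : finrank F (V.sp i) < finrank F (V.sp i ⊔ W.sp i : Submodule F (Space d F)) := by
      apply Submodule.finrank_lt_finrank_of_lt
      refine lt_of_le_of_ne le_sup_left fun h => hVW (hag.eq_of_sp_eq ?_)
      exact (Submodule.eq_of_le_of_finrank_eq (left_eq_sup.mp h) (by omega)).symm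
    exact h ⟨hag, by omega, by omega⟩

/-- Off the diagonal both products are the neighbour relation, so they cancel. On the diagonal
stands the number of lines above minus the number of hyperplanes below. -/
theorem incid_commutator {i : Fin n} (hi : (i : ℕ) + 1 ≠ n) :
    ((Nat.card F : ℝ) - 1) • (incid n d F 1 i * (incid n d F 1 i).transpose
      - (incid n d F 1 i).transpose * incid n d F 1 i) =
    Matrix.diagonal fun V : IsotropicFlag n d F =>
      (Nat.card F : ℝ) ^ (finrank F (V.next i) - finrank F (V.sp i))
        - (Nat.card F : ℝ) ^ (finrank F (V.sp i) - finrank F (V.prev i)) := by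
  classical
  ext V W
  rw [Matrix.smul_apply, Matrix.sub_apply]
  by_cases hVW : V = W
  · subst hVW
    rw [incid_mul_transpose_apply, transpose_mul_incid_apply, Matrix.diagonal_apply_eq]
    simp only [and_self]
    have h1 := V.ncard_up hi
    have h2 := V.ncard_down i
    rw [smul_eq_mul]
    linear_combination h1 - h2
  · rw [mul_transpose_self_of_ne hi hVW, transpose_mul_self_of_ne i hVW,
      Matrix.diagonal_apply_ne _ hVW, sub_self, smul_zero]

/-- Both sides vanish unless V_n ∩ W_n is a hyperplane of V_n. If it is and V_n ⊥ W_n, then the sum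
of the two is isotropic and each side is q + 1; if they are not orthogonal, each side is 1. -/
theorem triple_transpose_of_not_le {i : Fin n} (hi : (i : ℕ) + 1 = n)
    {V W : IsotropicFlag n d F} (hag : V.AgreeOff W i)
    (hd : finrank F (W.sp i) = finrank F (V.sp i) + 1) (hle : ¬ V.sp i ≤ W.sp i) :
    (Nat.card F : ℝ) * (incid n d F 2 i * (incid n d F 1 i).transpose) V W
      + ((incid n d F 1 i).transpose * incid n d F 2 i) V W =
    (incid n d F 1 i * ((incid n d F 1 i).transpose * incid n d F 1 i)) V W := by
  classical
  have hS := form_isSymm d F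
  set I := V.sp i ⊓ W.sp i with hI
  set T := V.sp i ⊔ W.sp i with hT
  have dT := Submodule.finrank_sup_add_finrank_inf_eq (V.sp i) (W.sp i)
  rw [← hI, ← hT] at dT
  have hIV : finrank F I < finrank F (V.sp i) := by
    apply Submodule.finrank_lt_finrank_of_lt
    exact lt_of_le_of_ne inf_le_left fun h => hle (inf_eq_left.mp h)
  have N1 : (incid n d F 2 i * (incid n d F 1 i).transpose) V W =
      if finrank F I + 1 = finrank F (V.sp i) ∧ V.sp i ≤ (form d F).orthogonal (W.sp i)
        then 1 else 0 := by
    rw [incid_mul_transpose_apply]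
    split_ifs with h
    · obtain ⟨h1, h2⟩ := h
      obtain ⟨X, hX, hXi⟩ := exists_replace (V := V) (i := i) (X := T)
        (admissible_of_ge le_sup_left (fun h => absurd hi h)
          fun _ => sup_isotropic hS (V.sp_isotropic i) (W.sp_isotropic i) h2)
      rw [Nat.cast_eq_one, Set.ncard_eq_one]
      refine ⟨X, ?_⟩
      ext Y
      constructor
      · rintro ⟨⟨a1, a2, a3⟩, ⟨b1, b2, b3⟩⟩
        refine (a3.symm.trans hX.symm).eq_of_sp_eq ?_
        rw [hXi]
        have hTY : T ≤ Y.sp i := sup_le a1 b1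
        exact (Submodule.eq_of_le_of_finrank_eq hTY (by omega)).symm
      · rintro rfl
        refine ⟨⟨hXi ▸ le_sup_left, by rw [hXi]; omega, hX.symm⟩,
          ⟨hXi ▸ le_sup_right, by rw [hXi]; omega, hag.symm.trans hX.symm⟩⟩
    · rw [Nat.cast_eq_zero, Set.ncard_eq_zero, Set.eq_empty_iff_forall_notMem]
      rintro X ⟨⟨a1, a2, a3⟩, ⟨b1, b2, b3⟩⟩
      have d2 : finrank F T ≤ finrank F (X.sp i) := Submodule.finrank_mono (sup_le a1 b1)
      exact h ⟨by omega,
        a1.trans ((X.sp_isotropic i).trans (LinearMap.BilinForm.orthogonal_le b1))⟩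
  have N2 : ((incid n d F 1 i).transpose * incid n d F 2 i) V W =
      if finrank F I + 1 = finrank F (V.sp i) then 1 else 0 := by
    rw [transpose_mul_incid_apply]
    split_ifs with h
    · obtain ⟨X, hX, hXi⟩ := exists_replace (V := V) (i := i) (X := I)
        (admissible_of_le (le_inf (V.prev_le i) (hag.prev_eq.le.trans (W.prev_le i))) inf_le_left)
      rw [Nat.cast_eq_one, Set.ncard_eq_one]
      refine ⟨X, ?_⟩
      ext Y
      constructor
      · rintro ⟨⟨a1, a2, a3⟩, ⟨b1, b2, b3⟩⟩
        refine (a3.trans hX.symm).eq_of_sp_eq ?_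
        rw [hXi]
        exact Submodule.eq_of_le_of_finrank_eq (le_inf a1 b1) (by omega)
      · rintro rfl
        refine ⟨⟨hXi ▸ inf_le_left, by rw [hXi]; omega, hX⟩,
          ⟨hXi ▸ inf_le_right, by rw [hXi]; omega, hX.trans hag⟩⟩
    · rw [Nat.cast_eq_zero, Set.ncard_eq_zero, Set.eq_empty_iff_forall_notMem]
      rintro X ⟨⟨a1, a2, a3⟩, ⟨b1, b2, b3⟩⟩
      have d2 : finrank F (X.sp i) ≤ finrank F I := Submodule.finrank_mono (le_inf a1 b1)
      exact h (by omega)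
  have N3 : (incid n d F 1 i * ((incid n d F 1 i).transpose * incid n d F 1 i)) V W =
      ({X | BelowBy 1 V X i ∧ Neighbours X W i}.ncard : ℝ) := by
    rw [← sum_indicator_mul, Matrix.mul_apply]
    refine Finset.sum_congr rfl fun X _ => ?_
    rw [incid_apply]
    split_ifs with h1 h2 h2
    · rw [transpose_mul_self_of_ne i (by rintro rfl; exact hle h1.1), if_pos h2]
    · rw [transpose_mul_self_of_ne i (by rintro rfl; exact hle h1.1), if_neg h2]
    · simp
    · simp
  rw [N1, N2, N3]
  -- An intermediate step X meeting W_n in a hyperplane is generated by V_n and X ∩ W_n. This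
  -- confines X to V_n + W_n and forces V_n ∩ W_n to be a hyperplane of V_n.
  have above : ∀ X : Submodule F (Space d F), V.sp i ≤ X →
      finrank F X = finrank F (V.sp i) + 1 →
      finrank F (X ⊓ W.sp i : Submodule F (Space d F)) + 1 = finrank F X →
      finrank F I + 1 = finrank F (V.sp i) ∧ V.sp i ⊔ (X ⊓ W.sp i) = X := by
    intro X hX hXd hXW
    have hlt : finrank F (V.sp i) < finrank F (V.sp i ⊔ (X ⊓ W.sp i) : Submodule F (Space d F)) := by
      apply Submodule.finrank_lt_finrank_of_lt
      refine lt_of_le_of_ne le_sup_left fun h => hle ?_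
      have : X ⊓ W.sp i = V.sp i :=
        Submodule.eq_of_le_of_finrank_eq (left_eq_sup.mp h) (by omega)
      rw [← this]
      exact inf_le_right
    have heq : V.sp i ⊔ (X ⊓ W.sp i) = X :=
      Submodule.eq_of_le_of_finrank_le (sup_le hX inf_le_left) (by omega)
    refine ⟨?_, heq⟩
    have e := Submodule.finrank_sup_add_finrank_inf_eq (V.sp i) (X ⊓ W.sp i)
    rw [heq, ← inf_assoc, inf_eq_left.mpr hX, ← hI] at e
    omega
  have slice : ∀ S : Set (Submodule F (Space d F)),
      (∀ X, X ∈ S ↔ V.sp i ≤ X ∧ X ≤ (form d F).orthogonal X ∧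
        finrank F X = finrank F (V.sp i) + 1 ∧
        finrank F (X ⊓ W.sp i : Submodule F (Space d F)) + 1 = finrank F X) →
      {X | BelowBy 1 V X i ∧ Neighbours X W i}.ncard = S.ncard := by
    intro S hSS
    rw [← ncard_slice V i (S := S)]
    · congr 1
      ext X
      constructor
      · rintro ⟨⟨a1, a2, a3⟩, ⟨b1, b2, b3⟩⟩
        exact ⟨a3.symm, (hSS _).mpr ⟨a1, X.sp_isotropic i, a2, b3⟩⟩
      · rintro ⟨a1, a2⟩
        obtain ⟨b1, b2, b3, b4⟩ := (hSS _).mp a2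
        exact ⟨⟨b1, b3, a1.symm⟩, a1.trans hag, by omega, b4⟩
    · intro X hX
      obtain ⟨b1, b2, b3, b4⟩ := (hSS _).mp hX
      exact admissible_of_ge b1 (fun h => absurd hi h) fun _ => b2
  by_cases hmeet : finrank F I + 1 = finrank F (V.sp i)
  · by_cases hperp : V.sp i ≤ (form d F).orthogonal (W.sp i)
    · rw [if_pos ⟨hmeet, hperp⟩, if_pos hmeet, slice (linesBetween (V.sp i) T),
        ncard_linesBetween_of_finrank_eq_add_two le_sup_left (by omega)]
      · push_cast
        ring
      · have hTi := sup_isotropic hS (V.sp_isotropic i) (W.sp_isotropic i) hperp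
        intro X
        constructor
        · rintro ⟨x1, x2, x3⟩
          refine ⟨x1, x2.trans (hTi.trans (LinearMap.BilinForm.orthogonal_le x2)), x3, ?_⟩
          have e := Submodule.finrank_sup_add_finrank_inf_eq X (W.sp i)
          have : X ⊔ W.sp i = T :=
            le_antisymm (sup_le x2 le_sup_right) (sup_le_sup_right x1 _)
          rw [this] at e
          omega
        · rintro ⟨x1, x2, x3, x4⟩
          refine ⟨x1, ?_, x3⟩
          rw [← (above X x1 x3 x4).2]
          exact sup_le_sup_left inf_le_right _
    · rw [if_neg fun h => hperp h.2, if_pos hmeet,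
        -- Isotropy of X puts X ∩ W_n inside V_n^⊥, and W_n ∩ V_n^⊥ has the same dimension as V_n,
        -- so X is determined.
        slice {V.sp i ⊔ (W.sp i ⊓ (form d F).orthogonal (V.sp i))}]
      · simp
      · set P := W.sp i ⊓ (form d F).orthogonal (V.sp i) with hP
        have hPd : finrank F P = finrank F (V.sp i) := by
          have e1 := finrank_form_orthogonal P
          have e2 : (form d F).orthogonal P = (form d F).orthogonal (W.sp i) ⊔ V.sp i := by
            rw [hP, orthogonal_inf (form_nondegenerate d F) hS, orthogonal_orthogonal_form]
          have e3 := Submodule.finrank_sup_add_finrank_inf_eq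
            ((form d F).orthogonal (W.sp i)) (V.sp i)
          have e4 : finrank F I ≤
              finrank F ((form d F).orthogonal (W.sp i) ⊓ V.sp i : Submodule F (Space d F)) :=
            Submodule.finrank_mono
              (le_inf (inf_le_right.trans (W.sp_isotropic i)) inf_le_left)
          have e5 : finrank F ((form d F).orthogonal (W.sp i) ⊓ V.sp i :
              Submodule F (Space d F)) < finrank F (V.sp i) := by
            apply Submodule.finrank_lt_finrank_of_lt
            exact lt_of_le_of_ne inf_le_right fun h => hperp (inf_eq_right.mp h)
          have e6 := finrank_form_orthogonal (W.sp i)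
          rw [e2] at e1
          omega
        have hVP : V.sp i ⊓ P = I := by
          rw [hP, ← inf_assoc]
          exact inf_eq_left.mpr (inf_le_left.trans (V.sp_isotropic i))
        have hQd := Submodule.finrank_sup_add_finrank_inf_eq (V.sp i) P
        rw [hVP] at hQd
        have hPi : P ≤ (form d F).orthogonal P :=
          inf_le_left.trans ((W.sp_isotropic i).trans
            (LinearMap.BilinForm.orthogonal_le inf_le_left))
        intro X
        rw [Set.mem_singleton_iff]
        constructor
        · rintro rfl
          refine ⟨le_sup_left, sup_isotropic hS (V.sp_isotropic i) hPi
            ((le_orthogonal_comm hS).mp inf_le_right), by omega, ?_⟩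
          have e1 : finrank F P ≤
              finrank F ((V.sp i ⊔ P) ⊓ W.sp i : Submodule F (Space d F)) :=
            Submodule.finrank_mono (le_inf le_sup_right inf_le_left)
          have e2 : finrank F ((V.sp i ⊔ P) ⊓ W.sp i : Submodule F (Space d F)) <
              finrank F (W.sp i) := by
            apply Submodule.finrank_lt_finrank_of_lt
            refine lt_of_le_of_ne inf_le_right fun h => hle ?_
            have : W.sp i = V.sp i ⊔ P :=
              Submodule.eq_of_le_of_finrank_eq (inf_eq_right.mp h) (by omega)
            rw [this]
            exact le_sup_left
          omega
        · rintro ⟨x1, x2, x3, x4⟩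
          refine Submodule.eq_of_le_of_finrank_eq ?_ (by omega)
          rw [← (above X x1 x3 x4).2]
          refine sup_le_sup_left (le_inf inf_le_right ?_) _
          exact inf_le_left.trans (x2.trans (LinearMap.BilinForm.orthogonal_le x1))
  · rw [if_neg fun h => hmeet h.1, if_neg hmeet, slice ∅]
    · simp
    · intro X
      simp only [Set.mem_empty_iff_false, false_iff]
      rintro ⟨x1, _, x3, x4⟩
      exact hmeet (above X x1 x3 x4).1

/-- The correction has two sources: the recursion from isotropic lines over V_n to those over W_n
gives the power of q with exponent 2d - 2 dim W_n, and the hyperplane counts below W_n and V_n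
differ by the other term. -/
theorem triple_transpose_of_below (h2 : (2 : F) ≠ 0) {i : Fin n} (hi : (i : ℕ) + 1 = n)
    {V W : IsotropicFlag n d F} (hVW : BelowBy 1 V W i) :
    (Nat.card F : ℝ) * (incid n d F 2 i * (incid n d F 1 i).transpose) V W
      + ((incid n d F 1 i).transpose * incid n d F 2 i) V W =
    (incid n d F 1 i * ((incid n d F 1 i).transpose * incid n d F 1 i)) V W
      - ((Nat.card F : ℝ) ^ (2 * d - 2 * finrank F (W.sp i))
        + (Nat.card F : ℝ) ^ (finrank F (W.sp i) - finrank F (W.prev i)) / Nat.card F) := by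
  classical
  obtain ⟨h1, hd, hag⟩ := id hVW
  have N1 : (incid n d F 2 i * (incid n d F 1 i).transpose) V W =
      ((isotropicLines (form d F) (W.sp i)).ncard : ℝ) := by
    rw [incid_mul_transpose_apply, ← ncard_up_last W hi]
    congr 2
    ext X
    exact ⟨fun h => h.2, fun h => ⟨⟨h1.trans h.1, by have := h.2.1; omega, hag.trans h.2.2⟩, h⟩⟩
  have N2 : ((incid n d F 1 i).transpose * incid n d F 2 i) V W =
      ({X | BelowBy 1 X V i}.ncard : ℝ) := by
    rw [transpose_mul_incid_apply]
    congr 2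
    ext X
    exact ⟨fun h => h.1, fun h => ⟨h, h.1.trans h1, by have := h.2.1; omega, h.2.2.trans hag⟩⟩
  -- Every X above V other than W is a neighbour of W, since both contain V_n as a hyperplane, and
  -- contributes 1. The flag X = W contributes the diagonal entry.
  have N3 : (incid n d F 1 i * ((incid n d F 1 i).transpose * incid n d F 1 i)) V W =
      ({X | BelowBy 1 V X i}.ncard : ℝ) + ({X | BelowBy 1 X W i}.ncard - 1) := by
    have e1 : ({X | BelowBy 1 V X i}.ncard : ℝ) =
        ∑ X : IsotropicFlag n d F, if BelowBy 1 V X i then (1 : ℝ) else 0 := by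
      rw [Set.ncard_eq_toFinset_card', Set.toFinset_ofPred, ← Finset.sum_boole]
    have e2 : ({X | BelowBy 1 X W i}.ncard - 1 : ℝ) =
        ∑ X : IsotropicFlag n d F,
          if X = W then ({X | BelowBy 1 X W i}.ncard - 1 : ℝ) else 0 := by
      simp
    rw [e1, e2, ← Finset.sum_add_distrib, Matrix.mul_apply]
    refine Finset.sum_congr rfl fun X _ => ?_
    rw [incid_apply]
    by_cases hXW : X = W
    · subst hXW
      rw [if_pos hVW, if_pos rfl, transpose_mul_incid_apply]
      simp
    · rw [if_neg hXW, add_zero, transpose_mul_self_of_ne i hXW]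
      split_ifs with a b b
      · simp
      · exact absurd (a.neighbours hVW hXW) b
      · simp
      · simp
  rw [N1, N2, N3, ncard_up_last V hi,
    ncard_isotropicLines h2 (form_nondegenerate d F) (form_isSymm d F) h1 hd (W.sp_isotropic i)]
  have hq : (2 : ℝ) ≤ Nat.card F := by exact_mod_cast two_le_natCard (F := F)
  have c1 := V.ncard_down i
  have c2 := W.ncard_down i
  have hprev : V.prev i = W.prev i := hag.prev_eq
  have hle := Submodule.finrank_mono (V.prev_le i)
  rw [hprev] at hle c1
  rw [show finrank F (W.sp i) - finrank F (W.prev i) =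
    finrank F (V.sp i) - finrank F (W.prev i) + 1 by omega, pow_succ] at c2 ⊢
  rw [finrank_space, show 2 * d - 2 * finrank F (W.sp i) =
    2 * d - 2 * finrank F (V.sp i) - 2 by omega]
  rw [mul_div_assoc, div_self (by linarith), mul_one]
  apply mul_right_cancel₀ (b := (Nat.card F - 1 : ℝ)) (by linarith)
  linear_combination c1 - c2

/-- This is the relation for E_n² F_n + F_n E_n² without torus factors. Entries can be nonzero only
where the other steps agree and dim W_n = dim V_n + 1. -/
theorem incid_triple_last (h2 : (2 : F) ≠ 0) {i : Fin n} (hi : (i : ℕ) + 1 = n) :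
    (Nat.card F : ℝ) • (incid n d F 2 i * (incid n d F 1 i).transpose)
      + (incid n d F 1 i).transpose * incid n d F 2 i =
    incid n d F 1 i * ((incid n d F 1 i).transpose * incid n d F 1 i)
      - incid n d F 1 i * Matrix.diagonal fun W : IsotropicFlag n d F =>
        (Nat.card F : ℝ) ^ (2 * d - 2 * finrank F (W.sp i))
          + (Nat.card F : ℝ) ^ (finrank F (W.sp i) - finrank F (W.prev i)) / Nat.card F := by
  classical
  ext V W
  rw [Matrix.add_apply, Matrix.smul_apply, Matrix.sub_apply, Matrix.mul_diagonal, smul_eq_mul,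
    incid_apply]
  by_cases hVW : BelowBy 1 V W i
  · rw [if_pos hVW, one_mul, triple_transpose_of_below h2 hi hVW]
  · rw [if_neg hVW, zero_mul, sub_zero]
    by_cases h : V.AgreeOff W i ∧ finrank F (W.sp i) = finrank F (V.sp i) + 1
    · exact triple_transpose_of_not_le hi h.1 h.2 fun hle => hVW ⟨hle, h.2, h.1⟩
    · have z1 : (incid n d F 2 i * (incid n d F 1 i).transpose) V W = 0 := by
        rw [incid_mul_transpose_apply, Nat.cast_eq_zero, Set.ncard_eq_zero,
          Set.eq_empty_iff_forall_notMem]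
        rintro X ⟨⟨a1, a2, a3⟩, ⟨b1, b2, b3⟩⟩
        exact h ⟨a3.trans b3.symm, by omega⟩
      have z2 : ((incid n d F 1 i).transpose * incid n d F 2 i) V W = 0 := by
        rw [transpose_mul_incid_apply, Nat.cast_eq_zero, Set.ncard_eq_zero,
          Set.eq_empty_iff_forall_notMem]
        rintro X ⟨⟨a1, a2, a3⟩, ⟨b1, b2, b3⟩⟩
        exact h ⟨a3.symm.trans b3, by omega⟩
      have z3 : (incid n d F 1 i * ((incid n d F 1 i).transpose * incid n d F 1 i)) V W = 0 := by
        rw [Matrix.mul_apply]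
        refine Finset.sum_eq_zero fun X _ => ?_
        rw [incid_apply]
        split_ifs with hX
        · have hXW : X ≠ W := by
            rintro rfl
            exact hVW hX
          rw [transpose_mul_self_of_ne i hXW, if_neg, mul_zero]
          rintro ⟨b1, b2, b3⟩
          obtain ⟨a1, a2, a3⟩ := hX
          exact h ⟨a3.trans b1, by omega⟩
        · rw [zero_mul]
      rw [z1, z2, z3]
      simp

section Component

variable {M : Submodule F (Space d F)}

omit [Finite F] in
theorem component_eq_zero_iff (V : IsotropicFlag n d F) {i : Fin n} (hi : (i : ℕ) + 1 = n) :
    component M V = Sgn.zero ↔ finrank F (V.sp i) ≠ d := by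
  unfold component
  rw [V.middle_eq_sp hi]
  split_ifs <;> simp_all

omit [Finite F] in
/-- Neighbouring maximal isotropic subspaces have opposite types. -/
theorem Neighbours.component_iff (h2 : (2 : F) ≠ 0) (hM : IsMaximalIsotropic M)
    {V W : IsotropicFlag n d F} {i : Fin n} (hi : (i : ℕ) + 1 = n) (h : Neighbours V W i)
    {α β : Sgn} (hαβ : (α = .plus ∧ β = .minus) ∨ (α = .minus ∧ β = .plus)) :
    component M V = α ↔ component M W = β := by
  obtain ⟨h1, h3, h4⟩ := h
  by_cases hd : finrank F (V.sp i) = d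
  · have hflip := finrank_inf_lagrangian h2 (form_nondegenerate d F) (form_isSymm d F)
      (orthogonal_eq_self_of_finrank_eq (V.sp_isotropic i) hd)
      (orthogonal_eq_self_of_finrank_eq (W.sp_isotropic i) (h3.trans hd))
      (orthogonal_eq_self_of_finrank_eq hM.1 hM.2) h4
    unfold component
    rw [V.middle_eq_sp hi, W.middle_eq_sp hi, if_pos hd, if_pos (h3.trans hd)]
    have hmod : finrank F (V.sp i ⊓ M : Submodule F (Space d F)) ≡ d [MOD 2] ↔
        ¬ finrank F (W.sp i ⊓ M : Submodule F (Space d F)) ≡ d [MOD 2] := by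
      simp only [Nat.ModEq]
      omega
    rcases hαβ with ⟨rfl, rfl⟩ | ⟨rfl, rfl⟩ <;> split_ifs <;> simp_all
  · have z1 := (component_eq_zero_iff (M := M) V hi).mpr hd
    have z2 := (component_eq_zero_iff (M := M) W hi).mpr (h3 ▸ hd)
    rw [z1, z2]
    rcases hαβ with ⟨rfl, rfl⟩ | ⟨rfl, rfl⟩ <;> simp

/-- The diagonal matrix of the indicator function of a component. -/
noncomputable def componentMatrix (n : ℕ) (M : Submodule F (Space d F)) (α : Sgn) :
    Matrix (IsotropicFlag n d F) (IsotropicFlag n d F) ℝ :=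
  Matrix.diagonal fun V => if component M V = α then 1 else 0

/-- Off the diagonal the product of the transpose with b_n lives on neighbours, whose types are
opposite, so selecting α on the left equals selecting β on the right. On the diagonal only the
hyperplane count remains. -/
theorem componentMatrix_commutator (h2 : (2 : F) ≠ 0) (hM : IsMaximalIsotropic M)
    {i : Fin n} (hi : (i : ℕ) + 1 = n) {α β : Sgn}
    (hαβ : (α = .plus ∧ β = .minus) ∨ (α = .minus ∧ β = .plus)) :
    ((Nat.card F : ℝ) - 1) • (componentMatrix n M α *
        ((incid n d F 1 i).transpose * incid n d F 1 i)
      - (incid n d F 1 i).transpose * incid n d F 1 i * componentMatrix n M β) =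
    (Matrix.diagonal fun V : IsotropicFlag n d F =>
        (Nat.card F : ℝ) ^ (finrank F (V.sp i) - finrank F (V.prev i)) - 1) *
      (componentMatrix n M α - componentMatrix n M β) := by
  classical
  ext V W
  rw [Matrix.smul_apply, Matrix.sub_apply, componentMatrix, componentMatrix,
    Matrix.diagonal_mul, Matrix.mul_diagonal, Matrix.diagonal_sub, Matrix.diagonal_mul_diagonal]
  by_cases hVW : V = W
  · subst hVW
    rw [transpose_mul_incid_apply, Matrix.diagonal_apply_eq]
    simp only [and_self]
    have h := V.ncard_down i
    rw [smul_eq_mul, ← h]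
    ring
  · rw [Matrix.diagonal_apply_ne _ hVW, transpose_mul_self_of_ne i hVW]
    by_cases hN : Neighbours V W i
    · simp [hN.component_iff h2 hM hi hαβ, hN]
    · simp [hN]

end Component

end IsotropicFlag
end TypeD

namespace TypeD

/-! ### Torus factors, and the relations for the specialized generators. -/

namespace IsotropicFlag

variable {n d : ℕ} {F : Type} [Field F]

theorem AgreeOff.stepAt_eq_of_ne {V W : IsotropicFlag n d F} {i : Fin n} (h : V.AgreeOff W i)
    {k : Fin (n + 2)} (hk : (k : ℕ) ≠ i + 1) (hk' : (i : ℕ) + 1 = n → (k : ℕ) ≠ n + 1) :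
    V.stepAt k = W.stepAt k := by
  by_cases hkn : (k : ℕ) = n + 1
  · have hi : (i : ℕ) + 1 ≠ n := fun hi => hk' hi hkn
    have hi' := i.2
    have e : k = (⟨n - 1, by omega⟩ : Fin n).succ.succ := Fin.ext (by simp; omega)
    have e1 := V.next_eq_orthogonal (i := ⟨n - 1, by omega⟩) (by simp; omega)
    have e2 := W.next_eq_orthogonal (i := ⟨n - 1, by omega⟩) (by simp; omega)
    have e3 : V.sp ⟨n - 1, by omega⟩ = W.sp ⟨n - 1, by omega⟩ :=
      h _ fun hj => by have := congrArg Fin.val hj; simp at this; omega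
    rw [e]
    exact e1.trans (e3 ▸ e2.symm)
  · exact h.stepAt_eq (k := ⟨k, by omega⟩) hk

/-- The change of `gap a` along `E_{i+1}`. -/
def gapShift (a : Fin (n + 1)) (i : Fin n) : ℤ :=
  -(if a = i.castSucc then 1 else 0) + (if a = i.succ then 1 else 0)
    + (if a = Fin.last n ∧ (i : ℕ) + 1 = n then 1 else 0)

theorem gap_castSucc (V : IsotropicFlag n d F) (i : Fin n) :
    V.gap i.castSucc = finrank F (V.sp i) - finrank F (V.prev i) := rfl

theorem gap_succ (V : IsotropicFlag n d F) (i : Fin n) :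
    V.gap i.succ = finrank F (V.next i) - finrank F (V.sp i) := rfl

theorem gap_last (V : IsotropicFlag n d F) {i : Fin n} (hi : (i : ℕ) + 1 = n) :
    V.gap i.succ = 2 * d - 2 * finrank F (V.sp i) := by
  have h := finrank_form_orthogonal (V.sp i)
  rw [gap_succ, V.next_eq_orthogonal hi]
  omega

theorem BelowBy.gap_eq {V W : IsotropicFlag n d F} {i : Fin n} (h : BelowBy 1 V W i)
    (a : Fin (n + 1)) : V.gap a = W.gap a + gapShift a i := by
  obtain ⟨h1, h2, h3⟩ := h
  by_cases ha : a = i.castSucc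
  · subst ha
    have e : gapShift i.castSucc i = -1 := by
      simp only [gapShift, Fin.ext_iff, Fin.val_succ, Fin.val_castSucc, Fin.val_last]
      split_ifs <;> omega
    rw [gap_castSucc, gap_castSucc, h3.prev_eq, e, h2]
    push_cast
    ring
  · by_cases ha' : a = i.succ
    · subst ha'
      by_cases hi : (i : ℕ) + 1 = n
      -- The last gap is V_n^⊥ / V_n: when V_n grows by one, its complement also shrinks by one.
      · have e : gapShift i.succ i = 2 := by
          simp only [gapShift, Fin.ext_iff, Fin.val_succ, Fin.val_castSucc, Fin.val_last]
          split_ifs <;> omega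
        rw [gap_last _ hi, gap_last _ hi, e, h2]
        push_cast
        ring
      · have e : gapShift i.succ i = 1 := by
          simp only [gapShift, Fin.ext_iff, Fin.val_succ, Fin.val_castSucc, Fin.val_last]
          split_ifs <;> omega
        rw [gap_succ, gap_succ, h3.next_eq hi, e, h2]
        push_cast
        ring
    · have e : gapShift a i = 0 := by
        simp only [Fin.ext_iff, Fin.val_succ, Fin.val_castSucc] at ha ha'
        simp only [gapShift, Fin.ext_iff, Fin.val_succ, Fin.val_castSucc, Fin.val_last]
        split_ifs <;> omega
      have ha2 := a.2
      simp only [Fin.ext_iff, Fin.val_succ, Fin.val_castSucc] at ha ha'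
      have e1 : V.stepAt a.succ = W.stepAt a.succ :=
        h3.stepAt_eq_of_ne (by simp; omega) fun hi => by simp; omega
      have e2 : V.stepAt a.castSucc = W.stepAt a.castSucc :=
        h3.stepAt_eq_of_ne (by simp; omega) fun hi => by simp; omega
      rw [gap, gap, e1, e2, e, add_zero]

section Torus

variable {I : Type*} [Fintype I]

/-- `f` increases by `c` from columns to rows along the nonzero entries of `A`. -/
def ShiftsBy (A : Matrix I I ℝ) (f : I → ℤ) (c : ℤ) : Prop :=
  ∀ x y, A x y ≠ 0 → f x = f y + c

omit [Fintype I] in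
theorem ShiftsBy.transpose {A : Matrix I I ℝ} {f : I → ℤ} {c : ℤ} (h : ShiftsBy A f c) :
    ShiftsBy A.transpose f (-c) := by
  intro x y hxy
  have := h y x hxy
  omega

omit [Fintype I] in
theorem ShiftsBy.neg {A : Matrix I I ℝ} {f : I → ℤ} {c : ℤ} (h : ShiftsBy A f c) :
    ShiftsBy A (-f) (-c) := by
  intro x y hxy
  have := h x y hxy
  simp only [Pi.neg_apply]
  omega

omit [Fintype I] in
theorem ShiftsBy.add {A : Matrix I I ℝ} {f g : I → ℤ} {c e : ℤ} (h : ShiftsBy A f c)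
    (h' : ShiftsBy A g e) : ShiftsBy A (f + g) (c + e) := by
  intro x y hxy
  have h1 := h x y hxy
  have h2 := h' x y hxy
  simp only [Pi.add_apply]
  omega

variable [DecidableEq I]

/-- The diagonal matrix with entries `v ^ f x`. -/
noncomputable def torus (v : ℝ) (f : I → ℤ) : Matrix I I ℝ := Matrix.diagonal fun x => v ^ f x

variable {v : ℝ}

theorem torus_mul_torus (hv : v ≠ 0) (f g : I → ℤ) : torus v f * torus v g = torus v (f + g) := by
  rw [torus, torus, torus, Matrix.diagonal_mul_diagonal]
  congr 1
  funext x
  rw [Pi.add_apply, zpow_add₀ hv]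

theorem ShiftsBy.torus_mul (hv : v ≠ 0) {A : Matrix I I ℝ} {f : I → ℤ} {c : ℤ}
    (h : ShiftsBy A f c) : torus v f * A = v ^ c • (A * torus v f) := by
  ext x y
  rw [torus, Matrix.diagonal_mul, Matrix.smul_apply, Matrix.mul_diagonal, smul_eq_mul]
  by_cases hxy : A x y = 0
  · rw [hxy]
    ring
  · rw [h x y hxy, zpow_add₀ hv]
    ring

/-- Collecting torus factors on the right turns a product of generators into a power of v times a
product of incidence matrices. -/
theorem mul_torus_mul (hv : v ≠ 0) {A B : Matrix I I ℝ} {f g : I → ℤ} {c : ℤ}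
    (h : ShiftsBy B f c) :
    A * torus v f * (B * torus v g) = v ^ c • (A * B * torus v (f + g)) := by
  rw [Matrix.mul_assoc, ← Matrix.mul_assoc (torus v f), h.torus_mul hv, Matrix.smul_mul,
    Matrix.mul_smul, Matrix.mul_assoc B, torus_mul_torus hv, Matrix.mul_assoc A]

theorem mul_torus_mul_mul (hv : v ≠ 0) {A B C : Matrix I I ℝ} {f g k : I → ℤ} {c₁ c₂ c₃ : ℤ}
    (h1 : ShiftsBy B f c₁) (h2 : ShiftsBy C f c₂) (h3 : ShiftsBy C g c₃) :
    A * torus v f * (B * torus v g) * (C * torus v k) =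
      v ^ (c₁ + (c₂ + c₃)) • (A * B * C * torus v (f + g + k)) := by
  rw [mul_torus_mul hv h1, Matrix.smul_mul, mul_torus_mul hv (h2.add h3), smul_smul,
    ← zpow_add₀ hv]

/-- Reduction of a Serre relation to a relation between matrices without torus part. -/
theorem serre_of_matrix (hv : v ≠ 0) {A B C : Matrix I I ℝ} {f g : I → ℤ}
    {a b α β : ℝ} {s₁ s₂ s₃ : ℤ} (hAA : A * A = a • C)
    (h : α • (C * B) - A * B * A + β • (B * C) = 0) {p₁ p₂ p₃ : ℤ}
    (h1 : ShiftsBy A f p₁) (h2 : ShiftsBy B f p₂) (h3 : ShiftsBy A g p₃)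
    (hs₁ : s₁ = p₁ + (p₂ + p₂)) (hs₂ : s₂ = p₂ + (p₁ + p₃)) (hs₃ : s₃ = p₃ + (p₃ + p₁))
    (e1 : a * v ^ s₁ = b * v ^ s₂ * α) (e3 : a * v ^ s₃ = b * v ^ s₂ * β) :
    (A * torus v f) ^ 2 * (B * torus v g)
      - b • (A * torus v f * (B * torus v g) * (A * torus v f))
      + B * torus v g * (A * torus v f) ^ 2 = 0 := by
  have t1 : (A * torus v f) ^ 2 * (B * torus v g) =
      (b * v ^ s₂ * α) • (C * B * torus v (f + f + g)) := by
    rw [pow_two, mul_torus_mul_mul hv h1 h2 h2, hAA, ← hs₁, ← e1, Matrix.smul_mul,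
      Matrix.smul_mul, smul_smul, mul_comm a]
  have t2 : A * torus v f * (B * torus v g) * (A * torus v f) =
      v ^ s₂ • (A * B * A * torus v (f + f + g)) := by
    rw [mul_torus_mul_mul hv h2 h1 h3, ← hs₂, add_right_comm f g f]
  have t3 : B * torus v g * (A * torus v f) ^ 2 =
      (b * v ^ s₂ * β) • (B * C * torus v (f + f + g)) := by
    rw [pow_two, ← Matrix.mul_assoc, mul_torus_mul_mul hv h3 h3 h1, Matrix.mul_assoc B, hAA,
      ← hs₃, ← e3, Matrix.mul_smul, Matrix.smul_mul, smul_smul, mul_comm a,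
      show g + f + f = f + f + g by abel]
  rw [t1, t2, t3]
  have : (b * v ^ s₂) • ((α • (C * B) - A * B * A + β • (B * C)) * torus v (f + f + g)) = 0 := by
    rw [h, Matrix.zero_mul, smul_zero]
  rw [Matrix.add_mul, Matrix.sub_mul, Matrix.smul_mul, Matrix.smul_mul] at this
  rw [← this]
  module

end Torus

section Generators

variable [Finite F]

omit [Finite F] in
theorem incid_shiftsBy (i : Fin n) (a : Fin (n + 1)) :
    ShiftsBy (incid n d F 1 i) (fun V => V.gap a) (gapShift a i) := by
  intro V W h
  rw [incid_apply] at h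
  exact BelowBy.gap_eq (by by_contra hcon; exact h (if_neg hcon)) a

omit [Finite F] in
theorem incid_shiftsBy_neg (i : Fin n) (a : Fin (n + 1)) :
    ShiftsBy (incid n d F 1 i) (-fun V => V.gap a) (-gapShift a i) := (incid_shiftsBy i a).neg

omit [Finite F] in
theorem transpose_shiftsBy_neg (i : Fin n) (a : Fin (n + 1)) :
    ShiftsBy (incid n d F 1 i).transpose (-fun V => V.gap a) (gapShift a i) := by
  simpa using (incid_shiftsBy_neg (d := d) (F := F) i a).transpose

/-- The matrix of a generator at `v`. -/
noncomputable def genMatrix (v : ℝ) (M : Submodule F (Space d F)) :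
    Gen n → Matrix (IsotropicFlag n d F) (IsotropicFlag n d F) ℝ
  | .E i => incid n d F 1 i * torus v (-fun V => V.gap i.succ)
  | .F i => (incid n d F 1 i).transpose * torus v (-fun V => V.gap i.castSucc)
  | .H a => torus v (-fun V => V.gap a)
  | .Hinv a => torus v (fun V => V.gap a)
  | .J α => componentMatrix n M α

variable {v : ℝ} {M : Submodule F (Space d F)}

local notation "𝐄" i => genMatrix v M (Gen.E i)
local notation "𝐅" i => genMatrix v M (Gen.F i)
local notation "𝐇" a => genMatrix v M (Gen.H a)
local notation "𝐇'" a => genMatrix v M (Gen.Hinv a)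
local notation "𝐉" α => genMatrix v M (Gen.J α)

theorem gen_H_H (hv : v ≠ 0) (a b : Fin (n + 1)) : (𝐇 a) * (𝐇 b) = (𝐇 b) * (𝐇 a) := by
  simp only [genMatrix]
  rw [torus_mul_torus hv, torus_mul_torus hv, add_comm]

theorem gen_H_Hinv (hv : v ≠ 0) (a : Fin (n + 1)) : (𝐇 a) * (𝐇' a) = 1 := by
  simp only [genMatrix]
  rw [torus_mul_torus hv, neg_add_cancel]
  simp [torus]

theorem gen_Hinv_H (hv : v ≠ 0) (a : Fin (n + 1)) : (𝐇' a) * (𝐇 a) = 1 := by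
  simp only [genMatrix]
  rw [torus_mul_torus hv, add_neg_cancel]
  simp [torus]

theorem gen_H_E (hv : v ≠ 0) (a : Fin (n + 1)) (i : Fin n) :
    (𝐇 a) * (𝐄 i) = v ^ (-gapShift a i) • ((𝐄 i) * (𝐇 a)) := by
  simp only [genMatrix]
  rw [← Matrix.mul_assoc, (incid_shiftsBy_neg i a).torus_mul hv, Matrix.smul_mul,
    Matrix.mul_assoc, Matrix.mul_assoc, torus_mul_torus hv, torus_mul_torus hv, add_comm]

theorem gen_H_F (hv : v ≠ 0) (a : Fin (n + 1)) (i : Fin n) :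
    (𝐇 a) * (𝐅 i) = v ^ (gapShift a i) • ((𝐅 i) * (𝐇 a)) := by
  simp only [genMatrix]
  rw [← Matrix.mul_assoc, (transpose_shiftsBy_neg i a).torus_mul hv, Matrix.smul_mul,
    Matrix.mul_assoc, Matrix.mul_assoc, torus_mul_torus hv, torus_mul_torus hv, add_comm]

theorem gen_E_F_of_ne (hv : v ≠ 0) {i j : Fin n} (hij : i ≠ j) :
    (𝐄 i) * (𝐅 j) - (𝐅 j) * (𝐄 i) = 0 := by
  -- Both shifts come only from the adjacency j = i + 1, so the two products carry the same power of
  -- v.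
  have e : gapShift i.succ j = -gapShift j.castSucc i := by
    have := Fin.val_ne_of_ne hij
    simp only [gapShift, Fin.ext_iff, Fin.val_succ, Fin.val_castSucc, Fin.val_last]
    split_ifs <;> omega
  simp only [genMatrix]
  rw [mul_torus_mul hv (transpose_shiftsBy_neg j i.succ),
    mul_torus_mul hv (incid_shiftsBy_neg i j.castSucc), incid_transpose_comm hij, e, add_comm,
    sub_self]

theorem gen_E_E (hv : v ≠ 0) {i j : Fin n} (h : 1 < |(i : ℤ) - (j : ℤ)|) :
    (𝐄 i) * (𝐄 j) = (𝐄 j) * (𝐄 i) := by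
  rw [lt_abs] at h
  have e1 : gapShift i.succ j = 0 := by
    simp only [gapShift, Fin.ext_iff, Fin.val_succ, Fin.val_castSucc, Fin.val_last]
    split_ifs <;> omega
  have e2 : gapShift j.succ i = 0 := by
    simp only [gapShift, Fin.ext_iff, Fin.val_succ, Fin.val_castSucc, Fin.val_last]
    split_ifs <;> omega
  simp only [genMatrix]
  rw [mul_torus_mul hv (incid_shiftsBy_neg j i.succ),
    mul_torus_mul hv (incid_shiftsBy_neg i j.succ),
    incid_comm (by rintro rfl; omega) (by omega) (by omega), e1, e2, add_comm]

theorem gen_F_F (hv : v ≠ 0) {i j : Fin n} (h : 1 < |(i : ℤ) - (j : ℤ)|) :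
    (𝐅 i) * (𝐅 j) = (𝐅 j) * (𝐅 i) := by
  rw [lt_abs] at h
  have e1 : gapShift i.castSucc j = 0 := by
    simp only [gapShift, Fin.ext_iff, Fin.val_succ, Fin.val_castSucc, Fin.val_last]
    split_ifs <;> omega
  have e2 : gapShift j.castSucc i = 0 := by
    simp only [gapShift, Fin.ext_iff, Fin.val_succ, Fin.val_castSucc, Fin.val_last]
    split_ifs <;> omega
  simp only [genMatrix]
  rw [mul_torus_mul hv (transpose_shiftsBy_neg j i.castSucc),
    mul_torus_mul hv (transpose_shiftsBy_neg i j.castSucc), ← Matrix.transpose_mul,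
    ← Matrix.transpose_mul, incid_comm (by rintro rfl; omega) (by omega) (by omega), e1, e2,
    add_comm]

/-- With q = v², the factor q + 1 equals v (v + v⁻¹); this matches the count of lines in a plane
with the quantum integer of the Serre relation. -/
theorem q_shift_up (hv : v ≠ 0) (s : ℤ) :
    (v ^ 2 + 1) * v ^ (s + 1) = (v + v⁻¹) * v ^ s * v ^ 2 := by
  rw [zpow_add_one₀ hv]
  field_simp

theorem q_shift_down (hv : v ≠ 0) (s : ℤ) :
    (v ^ 2 + 1) * v ^ (s - 1) = (v + v⁻¹) * v ^ s * 1 := by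
  rw [zpow_sub_one₀ hv]
  field_simp

theorem gen_serre_E (hv : v ≠ 0) (hq : (Nat.card F : ℝ) = v ^ 2) {i j : Fin n}
    (h : |(i : ℤ) - (j : ℤ)| = 1) :
    (𝐄 i) ^ 2 * (𝐄 j) - (v + v⁻¹) • ((𝐄 i) * (𝐄 j) * (𝐄 i)) + (𝐄 j) * (𝐄 i) ^ 2 = 0 := by
  rw [abs_eq zero_le_one] at h
  have hAA := incid_mul_self (d := d) (F := F) i
  rw [hq] at hAA
  by_cases hij : (i : ℕ) + 1 = j
  · have hs := incid_serre_succ (d := d) (F := F) hij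
    rw [hq] at hs
    refine serre_of_matrix (s₂ := -gapShift i.succ i + 1) (α := v ^ 2) (β := 1) hv hAA
      (by rw [one_smul]; exact hs) (incid_shiftsBy_neg i i.succ)
      (incid_shiftsBy_neg j i.succ) (incid_shiftsBy_neg i j.succ) rfl ?_ rfl ?_ ?_
    · simp only [gapShift, Fin.ext_iff, Fin.val_succ, Fin.val_castSucc, Fin.val_last]
      split_ifs <;> omega
    · rw [← q_shift_up hv]
      congr 2
      simp only [gapShift, Fin.ext_iff, Fin.val_succ, Fin.val_castSucc, Fin.val_last]
      split_ifs <;> omega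
    · rw [← q_shift_down hv]
      congr 2
      simp only [gapShift, Fin.ext_iff, Fin.val_succ, Fin.val_castSucc, Fin.val_last]
      split_ifs <;> omega
  · have hij' : (j : ℕ) + 1 = i := by omega
    have hs := incid_serre_pred (d := d) (F := F) hij'
    rw [hq] at hs
    -- Here i may be the last index, where the shift is 2 instead of 1, so the common exponent is
    -- left symbolic.
    refine serre_of_matrix (s₂ := -gapShift i.succ i + 1) (α := 1) (β := v ^ 2) hv hAA
      (by rw [one_smul]; exact hs) (incid_shiftsBy_neg i i.succ)
      (incid_shiftsBy_neg j i.succ) (incid_shiftsBy_neg i j.succ) rfl ?_ rfl ?_ ?_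
    · simp only [gapShift, Fin.ext_iff, Fin.val_succ, Fin.val_castSucc, Fin.val_last]
      split_ifs <;> omega
    · rw [← q_shift_down hv]
      congr 2
      simp only [gapShift, Fin.ext_iff, Fin.val_succ, Fin.val_castSucc, Fin.val_last]
      split_ifs <;> omega
    · rw [← q_shift_up hv]
      congr 2
      simp only [gapShift, Fin.ext_iff, Fin.val_succ, Fin.val_castSucc, Fin.val_last]
      split_ifs <;> omega

theorem gen_serre_F (hv : v ≠ 0) (hq : (Nat.card F : ℝ) = v ^ 2) {i j : Fin n}
    (h : |(i : ℤ) - (j : ℤ)| = 1) :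
    (𝐅 i) ^ 2 * (𝐅 j) - (v + v⁻¹) • ((𝐅 i) * (𝐅 j) * (𝐅 i)) + (𝐅 j) * (𝐅 i) ^ 2 = 0 := by
  rw [abs_eq zero_le_one] at h
  have hAA := congrArg Matrix.transpose (incid_mul_self (d := d) (F := F) i)
  rw [Matrix.transpose_mul, Matrix.transpose_smul, hq] at hAA
  by_cases hij : (i : ℕ) + 1 = j
  · have hs := congrArg Matrix.transpose (incid_serre_succ (d := d) (F := F) hij)
    simp only [Matrix.transpose_add, Matrix.transpose_sub, Matrix.transpose_smul,
      Matrix.transpose_mul, Matrix.transpose_zero, hq] at hs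
    refine serre_of_matrix (s₂ := 0) (α := 1) (β := v ^ 2) hv hAA
      (by rw [one_smul, ← hs, Matrix.mul_assoc]; abel) (transpose_shiftsBy_neg i i.castSucc)
      (transpose_shiftsBy_neg j i.castSucc) (transpose_shiftsBy_neg i j.castSucc) rfl ?_ rfl ?_ ?_
    · simp only [gapShift, Fin.ext_iff, Fin.val_succ, Fin.val_castSucc, Fin.val_last]
      split_ifs <;> omega
    · rw [← q_shift_down hv]
      congr 2
      simp only [gapShift, Fin.ext_iff, Fin.val_succ, Fin.val_castSucc, Fin.val_last]
      split_ifs <;> omega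
    · rw [← q_shift_up hv]
      congr 2
      simp only [gapShift, Fin.ext_iff, Fin.val_succ, Fin.val_castSucc, Fin.val_last]
      split_ifs <;> omega
  · have hij' : (j : ℕ) + 1 = i := by omega
    have hs := congrArg Matrix.transpose (incid_serre_pred (d := d) (F := F) hij')
    simp only [Matrix.transpose_add, Matrix.transpose_sub, Matrix.transpose_smul,
      Matrix.transpose_mul, Matrix.transpose_zero, hq] at hs
    refine serre_of_matrix (s₂ := 0) (α := v ^ 2) (β := 1) hv hAA
      (by rw [one_smul, ← hs, Matrix.mul_assoc]; abel) (transpose_shiftsBy_neg i i.castSucc)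
      (transpose_shiftsBy_neg j i.castSucc) (transpose_shiftsBy_neg i j.castSucc) rfl ?_ rfl ?_ ?_
    · simp only [gapShift, Fin.ext_iff, Fin.val_succ, Fin.val_castSucc, Fin.val_last]
      split_ifs <;> omega
    · rw [← q_shift_up hv]
      congr 2
      simp only [gapShift, Fin.ext_iff, Fin.val_succ, Fin.val_castSucc, Fin.val_last]
      split_ifs <;> omega
    · rw [← q_shift_down hv]
      congr 2
      simp only [gapShift, Fin.ext_iff, Fin.val_succ, Fin.val_castSucc, Fin.val_last]
      split_ifs <;> omega

omit [Finite F] in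
theorem natCast_pow_gap_castSucc (hq : (Nat.card F : ℝ) = v ^ 2) (V : IsotropicFlag n d F)
    (i : Fin n) :
    (Nat.card F : ℝ) ^ (finrank F (V.sp i) - finrank F (V.prev i)) =
      v ^ (2 * V.gap i.castSucc) := by
  have h := Submodule.finrank_mono (V.prev_le i)
  rw [gap_castSucc, hq, ← pow_mul, ← zpow_natCast]
  congr 1
  push_cast [Nat.cast_sub h]
  ring

omit [Finite F] in
theorem natCast_pow_gap_succ (hq : (Nat.card F : ℝ) = v ^ 2) (V : IsotropicFlag n d F)
    (i : Fin n) :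
    (Nat.card F : ℝ) ^ (finrank F (V.next i) - finrank F (V.sp i)) =
      v ^ (2 * V.gap i.succ) := by
  have h := Submodule.finrank_mono (V.le_next i)
  rw [gap_succ, hq, ← pow_mul, ← zpow_natCast]
  congr 1
  push_cast [Nat.cast_sub h]
  ring

omit [Finite F] in
theorem natCast_pow_gap_last (hq : (Nat.card F : ℝ) = v ^ 2) (V : IsotropicFlag n d F)
    {i : Fin n} (hi : (i : ℕ) + 1 = n) :
    (Nat.card F : ℝ) ^ (2 * d - 2 * finrank F (V.sp i)) = v ^ (2 * V.gap i.succ) := by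
  have h := V.finrank_sp_le i
  rw [gap_last _ hi, hq, ← pow_mul, ← zpow_natCast]
  congr 1
  have h' : 2 * finrank F (V.sp i) ≤ 2 * d := by omega
  push_cast [Nat.cast_sub h']
  ring

/-- Both products acquire the factor v, and v (v - v⁻¹) = q - 1 is the denominator in the line
counts. -/
theorem gen_E_F_self (hv : v ≠ 0) (hq : (Nat.card F : ℝ) = v ^ 2) {i : Fin n}
    (hi : (i : ℕ) + 1 ≠ n) :
    (v - v⁻¹) • ((𝐄 i) * (𝐅 i) - (𝐅 i) * (𝐄 i)) =
      (𝐇 i.castSucc) * (𝐇' i.succ) - (𝐇' i.castSucc) * (𝐇 i.succ) := by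
  have e1 : gapShift i.succ i = 1 := by
    simp only [gapShift, Fin.ext_iff, Fin.val_succ, Fin.val_castSucc, Fin.val_last]
    split_ifs <;> omega
  have e2 : gapShift i.castSucc i = -1 := by
    simp only [gapShift, Fin.ext_iff, Fin.val_succ, Fin.val_castSucc, Fin.val_last]
    split_ifs <;> omega
  simp only [genMatrix]
  rw [mul_torus_mul hv (transpose_shiftsBy_neg i i.succ),
    mul_torus_mul hv (incid_shiftsBy_neg i i.castSucc), e1, e2, neg_neg,
    add_comm (-fun V : IsotropicFlag n d F => V.gap i.succ), ← smul_sub, ← Matrix.sub_mul,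
    smul_smul, show (v - v⁻¹) * v ^ (1 : ℤ) = (Nat.card F : ℝ) - 1 by
      rw [hq, zpow_one, sub_mul, inv_mul_cancel₀ hv]; ring,
    ← Matrix.smul_mul, incid_commutator hi, torus_mul_torus hv, torus_mul_torus hv, torus, torus,
    torus, Matrix.diagonal_mul_diagonal, Matrix.diagonal_sub]
  congr 1
  funext V
  rw [natCast_pow_gap_castSucc hq, natCast_pow_gap_succ hq, sub_mul, ← zpow_add₀ hv,
    ← zpow_add₀ hv]
  simp only [Pi.add_apply, Pi.neg_apply]
  congr 2 <;> ring

omit [Finite F] in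
theorem gap_last_eq_zero {V : IsotropicFlag n d F} {i : Fin n} (hi : (i : ℕ) + 1 = n) {α : Sgn}
    (hα : α ≠ .zero) (h : component M V = α) : V.gap i.succ = 0 := by
  have : finrank F (V.sp i) = d := by
    by_contra hne
    rw [(component_eq_zero_iff (M := M) V hi).mpr hne] at h
    exact hα h.symm
  rw [gap_last _ hi, this, sub_self]

theorem torus_component_comm (f : IsotropicFlag n d F → ℤ) (α : Sgn) :
    torus v f * componentMatrix n M α = componentMatrix n M α * torus v f := by
  rw [torus, componentMatrix, Matrix.diagonal_mul_diagonal, Matrix.diagonal_mul_diagonal]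
  congr 1
  funext V
  rw [mul_comm]

theorem gen_J_F_E (h2 : (2 : F) ≠ 0) (hM : IsMaximalIsotropic M) (hv : v ≠ 0)
    (hq : (Nat.card F : ℝ) = v ^ 2) {i : Fin n} (hi : (i : ℕ) + 1 = n) {α β : Sgn}
    (hαβ : (α = .plus ∧ β = .minus) ∨ (α = .minus ∧ β = .plus)) :
    (v - v⁻¹) • ((𝐉 α) * (𝐅 i) * (𝐄 i) - (𝐅 i) * (𝐄 i) * (𝐉 β)) =
      ((𝐇' i.castSucc) * (𝐇 i.succ) - (𝐇 i.castSucc) * (𝐇' i.succ)) * ((𝐉 α) - (𝐉 β)) := by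
  have e2 : gapShift i.castSucc i = -1 := by
    simp only [gapShift, Fin.ext_iff, Fin.val_succ, Fin.val_castSucc, Fin.val_last]
    split_ifs <;> omega
  have hα : α ≠ .zero := by rcases hαβ with ⟨rfl, rfl⟩ | ⟨rfl, rfl⟩ <;> simp
  have hβ : β ≠ .zero := by rcases hαβ with ⟨rfl, rfl⟩ | ⟨rfl, rfl⟩ <;> simp
  simp only [genMatrix]
  rw [Matrix.mul_assoc (componentMatrix n M α), mul_torus_mul hv (incid_shiftsBy_neg i i.castSucc),
    e2, neg_neg, Matrix.mul_smul, Matrix.smul_mul, ← smul_sub, smul_smul,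
    show (v - v⁻¹) * v ^ (1 : ℤ) = (Nat.card F : ℝ) - 1 by
      rw [hq, zpow_one, sub_mul, inv_mul_cancel₀ hv]; ring,
    Matrix.mul_assoc _ (torus v _) (componentMatrix n M β), torus_component_comm,
    ← Matrix.mul_assoc (componentMatrix n M α), ← Matrix.mul_assoc _ (componentMatrix n M β),
    ← Matrix.sub_mul, ← Matrix.smul_mul, componentMatrix_commutator h2 hM hi hαβ]
  rw [torus_mul_torus hv, torus_mul_torus hv, torus, torus, torus, componentMatrix, componentMatrix,
    Matrix.diagonal_sub, Matrix.diagonal_sub, Matrix.diagonal_mul_diagonal,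
    Matrix.diagonal_mul_diagonal, Matrix.diagonal_mul_diagonal]
  congr 1
  funext V
  rw [natCast_pow_gap_castSucc hq]
  -- The components + and - are supported where dim V_n = d. There the last gap vanishes and H_{n+1}
  -- acts as 1, which makes the two sides agree; elsewhere both are zero.
  by_cases h0 : V.gap i.succ = 0
  · simp only [Pi.add_apply, Pi.neg_apply, h0]
    rw [mul_right_comm, sub_mul, ← zpow_add₀ hv, one_mul]
    congr 3
    · ring
  · rw [if_neg fun h => h0 (gap_last_eq_zero hi hα h), if_neg fun h => h0 (gap_last_eq_zero hi hβ h)]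
    simp

theorem gen_E_E_F (h2 : (2 : F) ≠ 0) (hv : v ≠ 0)
    (hq : (Nat.card F : ℝ) = v ^ 2) {i : Fin n} (hi : (i : ℕ) + 1 = n) :
    (𝐄 i) ^ 2 * (𝐅 i) + (𝐅 i) * (𝐄 i) ^ 2 = (v + v⁻¹) • ((𝐄 i) * (𝐅 i) * (𝐄 i)
      - (𝐄 i) * (v • ((𝐇 i.castSucc) * (𝐇' i.succ)) + v⁻¹ • ((𝐇' i.castSucc) * (𝐇 i.succ)))) := by
  have e1 : gapShift i.succ i = 2 := by
    simp only [gapShift, Fin.ext_iff, Fin.val_succ, Fin.val_castSucc, Fin.val_last]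
    split_ifs <;> omega
  have e2 : gapShift i.castSucc i = -1 := by
    simp only [gapShift, Fin.ext_iff, Fin.val_succ, Fin.val_castSucc, Fin.val_last]
    split_ifs <;> omega
  have s1 := incid_shiftsBy_neg (d := d) (F := F) i i.succ
  have s2 := incid_shiftsBy_neg (d := d) (F := F) i i.castSucc
  have s3 := transpose_shiftsBy_neg (d := d) (F := F) i i.succ
  rw [e1] at s1 s3
  rw [e2] at s2
  have hlast := incid_triple_last (n := n) (d := d) h2 hi
  have hAA := incid_mul_self (d := d) (F := F) i
  simp only [genMatrix]
  set b := incid n d F 1 i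
  set f : IsotropicFlag n d F → ℤ := fun V => V.gap i.succ with hf
  set g : IsotropicFlag n d F → ℤ := fun V => V.gap i.castSucc with hg
  have t1 : (b * torus v (-f)) ^ 2 * (b.transpose * torus v (-g)) =
      (v ^ 2 * (v ^ 2 + 1)) •
        (incid n d F 2 i * b.transpose * torus v (-f + -f + -g)) := by
    rw [pow_two (b * torus v (-f)), mul_torus_mul_mul hv s1 s3 s3, hAA, Matrix.smul_mul,
      Matrix.smul_mul, smul_smul, hq]
    norm_num
  have t2 : b.transpose * torus v (-g) * (b * torus v (-f)) ^ 2 =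
      (v ^ 2 + 1) • (b.transpose * incid n d F 2 i * torus v (-f + -f + -g)) := by
    rw [pow_two (b * torus v (-f)), ← Matrix.mul_assoc, mul_torus_mul_mul hv s2 s2 s1,
      Matrix.mul_assoc b.transpose, hAA, Matrix.mul_smul, Matrix.smul_mul, smul_smul, hq,
      show -g + -f + -f = -f + -f + -g by abel]
    norm_num
  have t3 : b * torus v (-f) * (b.transpose * torus v (-g)) * (b * torus v (-f)) =
      v • (b * (b.transpose * b) * torus v (-f + -f + -g)) := by
    rw [mul_torus_mul_mul hv s3 s1 s2, show -f + -g + -f = -f + -f + -g by abel,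
      Matrix.mul_assoc b]
    norm_num
  -- The bracket of H's is exactly the diagonal correction in `incid_triple_last`, rescaled by v and
  -- by the torus factor common to all terms.
  have t4 : b * torus v (-f) * (v • (torus v (-g) * torus v f) + v⁻¹ • (torus v g * torus v (-f))) =
      v • (b * (Matrix.diagonal fun W : IsotropicFlag n d F =>
        (Nat.card F : ℝ) ^ (2 * d - 2 * finrank F (W.sp i))
          + (Nat.card F : ℝ) ^ (finrank F (W.sp i) - finrank F (W.prev i)) / Nat.card F) *
        torus v (-f + -f + -g)) := by
    rw [Matrix.mul_assoc, Matrix.mul_assoc, ← Matrix.mul_smul b]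
    congr 1
    simp only [torus, Matrix.diagonal_mul_diagonal, ← Matrix.diagonal_smul, Matrix.diagonal_add]
    congr 1
    funext V
    simp only [Pi.smul_apply, smul_eq_mul]
    rw [natCast_pow_gap_castSucc hq, natCast_pow_gap_last hq V hi, hq]
    simp only [Pi.add_apply, Pi.neg_apply, hf, hg, zpow_add₀ hv, two_mul, zpow_neg]
    have h1 : v ^ V.gap i.succ ≠ 0 := zpow_ne_zero _ hv
    have h3 : v ^ V.gap i.castSucc ≠ 0 := zpow_ne_zero _ hv
    field_simp
  rw [t1, t2, t3, t4, ← smul_sub, ← Matrix.sub_mul, ← hlast, hq, Matrix.add_mul, Matrix.smul_mul]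
  have : (v + v⁻¹) * v = v ^ 2 + 1 := by field_simp
  rw [smul_smul, this, smul_add, smul_smul, mul_comm (v ^ 2)]

theorem gen_F_F_E (h2 : (2 : F) ≠ 0) (hv : v ≠ 0)
    (hq : (Nat.card F : ℝ) = v ^ 2) {i : Fin n} (hi : (i : ℕ) + 1 = n) :
    (𝐅 i) ^ 2 * (𝐄 i) + (𝐄 i) * (𝐅 i) ^ 2 = (v + v⁻¹) • ((𝐅 i) * (𝐄 i) * (𝐅 i)
      - (v • ((𝐇 i.castSucc) * (𝐇' i.succ)) + v⁻¹ • ((𝐇' i.castSucc) * (𝐇 i.succ))) * (𝐅 i)) := by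
  have e1 : gapShift i.succ i = 2 := by
    simp only [gapShift, Fin.ext_iff, Fin.val_succ, Fin.val_castSucc, Fin.val_last]
    split_ifs <;> omega
  have e2 : gapShift i.castSucc i = -1 := by
    simp only [gapShift, Fin.ext_iff, Fin.val_succ, Fin.val_castSucc, Fin.val_last]
    split_ifs <;> omega
  have s2 := incid_shiftsBy_neg (d := d) (F := F) i i.castSucc
  have s3 := transpose_shiftsBy_neg (d := d) (F := F) i i.succ
  have s4 := transpose_shiftsBy_neg (d := d) (F := F) i i.castSucc
  rw [e1] at s3
  rw [e2] at s2 s4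
  have hlast := congrArg Matrix.transpose (incid_triple_last (n := n) (d := d) h2 hi)
  have hAA := congrArg Matrix.transpose (incid_mul_self (d := d) (F := F) i)
  simp only [Matrix.transpose_add, Matrix.transpose_sub, Matrix.transpose_smul,
    Matrix.transpose_mul, Matrix.transpose_transpose, Matrix.diagonal_transpose] at hlast hAA
  simp only [genMatrix]
  set b := incid n d F 1 i
  set f : IsotropicFlag n d F → ℤ := fun V => V.gap i.succ with hf
  set g : IsotropicFlag n d F → ℤ := fun V => V.gap i.castSucc with hg
  set C := (incid n d F 2 i).transpose
  have t1 : (b.transpose * torus v (-g)) ^ 2 * (b * torus v (-f)) =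
      (v * (v ^ 2 + 1)) • (C * b * torus v (-g + -g + -f)) := by
    rw [pow_two (b.transpose * torus v (-g)), mul_torus_mul_mul hv s4 s2 s2, hAA, Matrix.smul_mul,
      Matrix.smul_mul, smul_smul, hq]
    norm_num
  have t2 : b * torus v (-f) * (b.transpose * torus v (-g)) ^ 2 =
      (v * (v ^ 2 + 1)) • (v ^ 2 • (b * C * torus v (-g + -g + -f))) := by
    rw [pow_two (b.transpose * torus v (-g)), ← Matrix.mul_assoc, mul_torus_mul_mul hv s3 s3 s4,
      Matrix.mul_assoc b, hAA, Matrix.mul_smul, Matrix.smul_mul, smul_smul, hq, smul_smul,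
      show -f + -g + -g = -g + -g + -f by abel]
    congr 1
    rw [show (2 + (2 + -1) : ℤ) = ((3 : ℕ) : ℤ) by norm_num, zpow_natCast]
    ring
  have t3 : b.transpose * torus v (-g) * (b * torus v (-f)) * (b.transpose * torus v (-g)) =
      v ^ 2 • (b.transpose * b * b.transpose * torus v (-g + -g + -f)) := by
    rw [mul_torus_mul_mul hv s2 s4 s3, show -g + -f + -g = -g + -g + -f by abel]
    norm_num
  have t4 : (v • (torus v (-g) * torus v f) + v⁻¹ • (torus v g * torus v (-f))) *
      (b.transpose * torus v (-g)) =
      v ^ 2 • ((Matrix.diagonal fun W : IsotropicFlag n d F =>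
        (Nat.card F : ℝ) ^ (2 * d - 2 * finrank F (W.sp i))
          + (Nat.card F : ℝ) ^ (finrank F (W.sp i) - finrank F (W.prev i)) / Nat.card F) *
        b.transpose * torus v (-g + -g + -f)) := by
    -- The H's now stand to the left of F_n. The torus factor is moved across the transpose at the
    -- cost of one power of v, as its shifts -1 and 2 add up to 1.
    have s5 := (s4.add s3).torus_mul hv
    have : b.transpose * torus v (-g + -g + -f) =
        v⁻¹ • (torus v (-g + -f) * (b.transpose * torus v (-g))) := by
      rw [← Matrix.mul_assoc, s5, Matrix.smul_mul, smul_smul, Matrix.mul_assoc,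
        torus_mul_torus hv, show -g + -f + -g = -g + -g + -f by abel]
      norm_num [hv]
    rw [Matrix.mul_assoc (Matrix.diagonal _), this, Matrix.mul_smul, smul_smul,
      ← Matrix.mul_assoc (Matrix.diagonal _) (torus v _), ← Matrix.smul_mul (v ^ 2 * v⁻¹)]
    congr 1
    simp only [torus, Matrix.diagonal_mul_diagonal, ← Matrix.diagonal_smul, Matrix.diagonal_add]
    congr 1
    funext V
    simp only [Pi.smul_apply, smul_eq_mul]
    rw [natCast_pow_gap_castSucc hq, natCast_pow_gap_last hq V hi, hq]
    simp only [Pi.add_apply, Pi.neg_apply, hf, hg, zpow_add₀ hv, two_mul, zpow_neg]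
    have h1 : v ^ V.gap i.succ ≠ 0 := zpow_ne_zero _ hv
    have h3 : v ^ V.gap i.castSucc ≠ 0 := zpow_ne_zero _ hv
    field_simp
  rw [t1, t2, t3, t4, ← smul_sub, ← Matrix.sub_mul, Matrix.mul_assoc b.transpose b,
    ← Matrix.mul_assoc b.transpose b, ← hlast, hq, Matrix.add_mul, Matrix.smul_mul,
    smul_smul (v + v⁻¹)]
  have : (v + v⁻¹) * v ^ 2 = v * (v ^ 2 + 1) := by field_simp
  rw [this]
  module

end Generators

end IsotropicFlag
end TypeD

namespace TypeD

open IsotropicFlag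

/-! ### Relations of the J's and identities between diagonal matrices. -/

section ComponentRelations

variable {n d : ℕ} {F : Type} [Field F] {M : Submodule F (Space d F)}

theorem component_eq_of_middle_eq {V W : IsotropicFlag n d F} (h : V.middle = W.middle) :
    component M V = component M W := by
  unfold component
  rw [h]

variable [Finite F]

open Classical in
-- A flag whose step V_n can still grow has dim V_n < d and lies in component 0. Changing an earlier
-- step leaves V_n, hence the component, unchanged.
theorem componentMatrix_mul_incid {α : Sgn} (hα : α ≠ .zero) (i : Fin n) :
    componentMatrix n M α * incid n d F 1 i =
      if (i : ℕ) + 1 = n then 0 else incid n d F 1 i * componentMatrix n M α := by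
  have hi' := i.2
  ext V W
  rw [componentMatrix, Matrix.diagonal_mul]
  by_cases hi : (i : ℕ) + 1 = n
  · rw [if_pos hi, Matrix.zero_apply, incid_apply]
    by_cases h : BelowBy 1 V W i
    · obtain ⟨h1, h2, h3⟩ := h
      have h4 := W.finrank_sp_le i
      have h5 : component M V = Sgn.zero := (component_eq_zero_iff V hi).mpr (by omega)
      rw [if_neg fun h6 => hα (h6.symm.trans h5), zero_mul]
    · rw [if_neg h, mul_zero]
  · rw [if_neg hi, Matrix.mul_diagonal, incid_apply]
    by_cases h : BelowBy 1 V W i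
    · have e : component M V = component M W := by
        apply component_eq_of_middle_eq
        rw [V.middle_eq_sp (i := ⟨n - 1, by omega⟩) (by simp; omega),
          W.middle_eq_sp (i := ⟨n - 1, by omega⟩) (by simp; omega)]
        exact h.2.2 _ fun hj => by have := congrArg Fin.val hj; simp at this; omega
      rw [e, mul_comm]
    · rw [if_neg h, mul_zero, zero_mul]

omit [Finite F] in
theorem componentMatrix_transpose (α : Sgn) :
    (componentMatrix n M α).transpose = componentMatrix n M α := Matrix.diagonal_transpose _

variable {v : ℝ}

theorem gen_J_E {α : Sgn} (hα : α ≠ .zero) (i : Fin n) :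
    genMatrix v M (.J α) * genMatrix v M (.E i) =
      if (i : ℕ) + 1 = n then 0 else genMatrix v M (.E i) * genMatrix v M (.J α) := by
  simp only [genMatrix]
  rw [← Matrix.mul_assoc, componentMatrix_mul_incid hα]
  split_ifs
  · rw [Matrix.zero_mul]
  · rw [Matrix.mul_assoc, Matrix.mul_assoc, torus_component_comm]

theorem gen_F_J {α : Sgn} (hα : α ≠ .zero) (i : Fin n) :
    genMatrix v M (.F i) * genMatrix v M (.J α) =
      if (i : ℕ) + 1 = n then 0 else genMatrix v M (.J α) * genMatrix v M (.F i) := by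
  have h := congrArg Matrix.transpose (componentMatrix_mul_incid (M := M) hα i)
  rw [Matrix.transpose_mul, componentMatrix_transpose] at h
  simp only [genMatrix]
  rw [Matrix.mul_assoc, torus_component_comm, ← Matrix.mul_assoc, h]
  split_ifs
  · rw [Matrix.transpose_zero, Matrix.zero_mul]
  · rw [Matrix.transpose_mul, componentMatrix_transpose, Matrix.mul_assoc]

theorem gen_J_sum :
    genMatrix v M (.J .plus) + genMatrix v M (.J .zero) + genMatrix v M (.J .minus) =
      (1 : Matrix (IsotropicFlag n d F) (IsotropicFlag n d F) ℝ) := by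
  simp only [genMatrix, componentMatrix]
  rw [Matrix.diagonal_add, Matrix.diagonal_add, ← Matrix.diagonal_one]
  congr 1
  funext V
  cases component M V <;> simp

theorem gen_J_mul (α β : Sgn) :
    genMatrix v M (.J α) * genMatrix v M (.J β) =
      if α = β then (genMatrix v M (.J α) :
        Matrix (IsotropicFlag n d F) (IsotropicFlag n d F) ℝ) else 0 := by
  simp only [genMatrix, componentMatrix]
  rw [Matrix.diagonal_mul_diagonal]
  split_ifs with h
  · subst h
    simp
  · rw [← Matrix.diagonal_zero]
    congr 1
    funext V
    split_ifs with h1 h2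
    · exact absurd (h1.symm.trans h2) h
    all_goals simp

theorem gen_J_H (α : Sgn) (a : Fin (n + 1)) :
    genMatrix v M (.J α) * genMatrix v M (.H a) = genMatrix v M (.H a) * genMatrix v M (.J α) :=
  (torus_component_comm _ _).symm

theorem torus_pow (hv : v ≠ 0) (f : IsotropicFlag n d F → ℤ) (k : ℕ) :
    torus v f ^ k = torus v (k • f) := by
  induction k with
  | zero => simp [torus]
  | succ k ih => rw [pow_succ, ih, torus_mul_torus hv, succ_nsmul]

theorem torus_list_prod (hv : v ≠ 0) (l : List (IsotropicFlag n d F → ℤ)) :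
    (l.map (torus v)).prod = torus v l.sum := by
  induction l with
  | nil => simp [torus]
  | cons f l ih => rw [List.map_cons, List.prod_cons, ih, torus_mul_torus hv, List.sum_cons]

omit [Finite F] in
theorem sum_gap_eq_finrank_middle (V : IsotropicFlag n d F) :
    ∑ i : Fin n, V.gap i.castSucc = finrank F V.middle := by
  -- Steps are reindexed by naturals so that the sum telescopes; the indices stay below 2n + 2, so
  -- `Fin.ofNat` does not wrap around.
  have h := Fin.sum_univ_eq_sum_range
    (fun k => (finrank F (V.step (Fin.ofNat (2 * n + 2) (k + 1))) : ℤ) -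
      finrank F (V.step (Fin.ofNat (2 * n + 2) k))) n
  have hv : ∀ k, k < 2 * n + 2 → ((Fin.ofNat (2 * n + 2) k : Fin (2 * n + 2)) : ℕ) = k :=
    fun k hk => Nat.mod_eq_of_lt hk
  rw [Finset.sum_range_sub (fun k => (finrank F (V.step (Fin.ofNat (2 * n + 2) k)) : ℤ))] at h
  have e0 : Fin.ofNat (2 * n + 2) 0 = 0 := rfl
  have en : Fin.ofNat (2 * n + 2) n = ⟨n, by omega⟩ := Fin.ext (hv n (by omega))
  rw [e0, V.step_zero, finrank_bot, en] at h
  rw [show V.middle = V.step ⟨n, by omega⟩ from rfl]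
  rw [Nat.cast_zero, sub_zero] at h
  rw [← h]
  refine Finset.sum_congr rfl fun i _ => ?_
  have e1 : V.sp i = V.step (Fin.ofNat (2 * n + 2) (i + 1)) :=
    congrArg V.step (Fin.ext (hv _ (by omega)).symm)
  have e2 : V.prev i = V.step (Fin.ofNat (2 * n + 2) i) :=
    congrArg V.step (Fin.ext (hv _ (by omega)).symm)
  rw [gap_castSucc, e1, e2]

/-- The last gap is 2d - 2 dim V_n, and twice the sum of the other gaps is 2 dim V_n. -/
theorem gen_H_prod (hv : v ≠ 0) (hn : 0 < n) :
    genMatrix v M (.H (Fin.last n)) *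
      (List.ofFn fun i : Fin n => genMatrix v M (.H i.castSucc) ^ 2).prod =
    algebraMap ℝ (Matrix (IsotropicFlag n d F) (IsotropicFlag n d F) ℝ) (v ^ (-(2 * d : ℤ))) := by
  simp only [genMatrix, torus_pow hv]
  have : (List.ofFn fun i : Fin n =>
      torus v (2 • (-fun V : IsotropicFlag n d F => V.gap i.castSucc))) =
      (List.ofFn fun i : Fin n => 2 • (-fun V : IsotropicFlag n d F => V.gap i.castSucc)).map
        (torus v) := by
    rw [List.map_ofFn]
    rfl
  rw [this, torus_list_prod hv, torus_mul_torus hv, List.sum_ofFn, torus,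
    Matrix.algebraMap_eq_diagonal]
  congr 1
  funext V
  have h1 := sum_gap_eq_finrank_middle V
  have hi : ((⟨n - 1, by omega⟩ : Fin n) : ℕ) + 1 = n := by simp; omega
  have h2 := gap_last V hi
  have e : (⟨n - 1, by omega⟩ : Fin n).succ = Fin.last n := Fin.ext hi
  rw [e, ← V.middle_eq_sp hi, ← h1] at h2
  simp only [Pi.add_apply, Pi.neg_apply, Finset.sum_apply, Pi.smul_apply,
    Pi.algebraMap_apply, Algebra.algebraMap_self, RingHom.id_apply]
  rw [h2]
  congr 1
  rw [← Finset.smul_sum, Finset.sum_neg_distrib, nsmul_eq_mul]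
  push_cast
  ring

/-- Isotropy bounds every gap of index at most n by d, so at each flag one of the d + 1 factors of
the diagonal entry vanishes. -/
theorem gen_H_minpoly (j : Fin n) :
    ((List.range (d + 1)).map fun l : ℕ => genMatrix v M (.H j.castSucc) -
      algebraMap ℝ (Matrix (IsotropicFlag n d F) (IsotropicFlag n d F) ℝ) (v ^ (-(l : ℤ)))).prod =
    0 := by
  have key : ∀ L : List ℕ, (L.map fun l : ℕ => genMatrix v M (.H j.castSucc) -
      algebraMap ℝ (Matrix (IsotropicFlag n d F) (IsotropicFlag n d F) ℝ) (v ^ (-(l : ℤ)))).prod =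
      Matrix.diagonal fun V =>
        (L.map fun l : ℕ => v ^ (-V.gap j.castSucc) - v ^ (-(l : ℤ))).prod := by
    intro L
    induction L with
    | nil => simp
    | cons l L ih =>
      rw [List.map_cons, List.prod_cons, ih]
      simp only [genMatrix, torus]
      rw [Matrix.algebraMap_eq_diagonal, Matrix.diagonal_sub, Matrix.diagonal_mul_diagonal]
      rfl
  rw [key, ← Matrix.diagonal_zero]
  congr 1
  funext V
  rw [List.prod_eq_zero_iff, List.mem_map]
  have h1 := V.finrank_sp_le j
  have h2 := Submodule.finrank_mono (V.prev_le j)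
  refine ⟨finrank F (V.sp j) - finrank F (V.prev j), List.mem_range.mpr (by omega), ?_⟩
  rw [gap_castSucc, Nat.cast_sub h2, sub_self]

end ComponentRelations

/-! ### Labels determine the generators and are preserved by the special orthogonal group. -/

section Invariance

theorem OddPrimePower.natCard_field (q : OddPrimePower) : Nat.card q.field = q.p ^ q.k :=
  GaloisField.card q.p q.k q.k_ne_zero

theorem OddPrimePower.two_ne_zero (q : OddPrimePower) : (2 : q.field) ≠ 0 := by
  apply Ring.two_ne_zero
  rw [ringChar.eq q.field q.p]
  exact q.ne_two

variable {n d : ℕ} {M : SubspaceFamily d}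

theorem IsotropicFlag.step_last {F : Type} [Field F] (V : IsotropicFlag n d F) :
    V.step (Fin.last _) = ⊤ := by
  rw [V.perp (Fin.last _) 0 (by simp), V.step_zero]
  simp

namespace SamePosition

variable {q q' : OddPrimePower} {V V' : Flags n d q} {W W' : Flags n d q'}

theorem finrank_inf (h : SamePosition M V V' W W') (k l : Fin (n + 2)) :
    finrank q.field (V.stepAt k ⊓ V'.stepAt l : Submodule q.field (Space d q.field)) =
      finrank q'.field (W.stepAt k ⊓ W'.stepAt l : Submodule q'.field (Space d q'.field)) :=
  h.1 _ _

/-- Intersecting with the last step, the whole space, reads off the dimensions of the steps from the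
label. -/
theorem finrank_left (h : SamePosition M V V' W W') (k : Fin (n + 2)) :
    finrank q.field (V.stepAt k) = finrank q'.field (W.stepAt k) := by
  have := h.1 ⟨k, by omega⟩ (Fin.last _)
  rwa [V'.step_last, W'.step_last, inf_top_eq, inf_top_eq] at this

theorem finrank_right (h : SamePosition M V V' W W') (k : Fin (n + 2)) :
    finrank q.field (V'.stepAt k) = finrank q'.field (W'.stepAt k) := by
  have := h.1 (Fin.last _) ⟨k, by omega⟩
  rwa [V.step_last, W.step_last, top_inf_eq, top_inf_eq] at this

theorem gap_right (h : SamePosition M V V' W W') (a : Fin (n + 1)) : V'.gap a = W'.gap a := by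
  rw [gap, gap, h.finrank_right, h.finrank_right]

theorem symm (h : SamePosition M V V' W W') : SamePosition M W W' V V' :=
  ⟨fun i j => (h.1 i j).symm, h.2.1.symm, h.2.2.symm⟩

theorem swap (h : SamePosition M V V' W W') : SamePosition M V' V W' W := by
  refine ⟨fun i j => ?_, h.2.2, h.2.1⟩
  rw [inf_comm, inf_comm (W'.step i)]
  exact h.1 j i

/-- Inclusion means that the intersection has full dimension, which the label records. -/
theorem le (h : SamePosition M V V' W W') {k l : Fin (n + 2)} (hle : V.stepAt k ≤ V'.stepAt l) :
    W.stepAt k ≤ W'.stepAt l := by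
  have h1 := h.finrank_inf k l
  rw [inf_eq_left.mpr hle, h.finrank_left] at h1
  exact inf_eq_left.mp (Submodule.eq_of_le_of_finrank_eq inf_le_left h1.symm)

theorem stepAt_eq (h : SamePosition M V V' W W') {k : Fin (n + 2)}
    (hk : V.stepAt k = V'.stepAt k) : W.stepAt k = W'.stepAt k :=
  le_antisymm (h.le hk.le) (h.swap.le hk.ge)

theorem eq_of_eq (h : SamePosition M V V' W W') (hV : V = V') : W = W' :=
  ext_sp fun i => h.stepAt_eq (by rw [hV])

theorem eq_iff (h : SamePosition M V V' W W') : V = V' ↔ W = W' := ⟨h.eq_of_eq, h.symm.eq_of_eq⟩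

theorem below (h : SamePosition M V V' W W') {i : Fin n} (hb : V.Below V' i) : W.Below W' i := by
  obtain ⟨h1, h2, h3⟩ := hb
  refine ⟨h.le h1, ?_, fun j hj => h.stepAt_eq (h3 j hj)⟩
  rw [← h.finrank_left, ← h.finrank_right, h2]

theorem below_iff (h : SamePosition M V V' W W') {i : Fin n} : V.Below V' i ↔ W.Below W' i :=
  ⟨h.below, h.symm.below⟩

end SamePosition

theorem funJ_eq {F : Type} [Field F] (hd : 0 < d) (M : Submodule F (Space d F)) (α : Sgn)
    (V V' : IsotropicFlag n d F) :
    funJ M α V V' = if V = V' ∧ component M V = α then 1 else 0 := by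
  -- Natural subtraction makes d > 0 essential: only then does d - 1 have the parity opposite to d.
  have hmod : ∀ m : ℕ, m ≡ d - 1 [MOD 2] ↔ ¬ m ≡ d [MOD 2] := by
    intro m
    simp only [Nat.ModEq]
    omega
  cases α <;> simp only [funJ, component, hmod] <;> by_cases h1 : V = V' <;>
    by_cases h2 : finrank F V.middle = d <;>
    by_cases h3 : finrank F (V.middle ⊓ M : Submodule F (Space d F)) ≡ d [MOD 2] <;>
    simp [h1, h2, h3]

/-- Linear automorphisms preserve dimensions of intersections; for the component, determinant one is
what keeps the parity of the intersection with M. -/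
theorem samePosition_map (hM : ∀ q, IsMaximalIsotropic (M q)) {q : OddPrimePower}
    {g : Space d q.field ≃ₗ[q.field] Space d q.field} (hg : g ∈ specialOrthogonal d q.field)
    {V V' W W' : Flags n d q}
    (hW : ∀ i, W.step i = (V.step i).map (g : Space d q.field →ₗ[q.field] Space d q.field))
    (hW' : ∀ i, W'.step i = (V'.step i).map (g : Space d q.field →ₗ[q.field] Space d q.field)) :
    SamePosition M V V' W W' := by
  have hcomp : ∀ V W : Flags n d q,
      (∀ i, W.step i = (V.step i).map (g : Space d q.field →ₗ[q.field] Space d q.field)) →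
      component (M q) V = component (M q) W := by
    intro V W hW
    have hm : W.middle = V.middle.map (g : Space d q.field →ₗ[q.field] Space d q.field) := hW _
    have hmi : V.middle ≤ (form d q.field).orthogonal V.middle := by
      have h := V.perp ⟨n + 1, by omega⟩ ⟨n, by omega⟩ (by simp; omega)
      rw [show V.middle = V.step ⟨n, by omega⟩ from rfl, ← h]
      exact V.mono (by simp)
    unfold component
    rw [hm, finrank_map_isometry g]
    by_cases hd : finrank q.field V.middle = d
    · rw [if_pos hd, if_pos hd]
      have hpar := finrank_map_inf_modEq q.two_ne_zero (form_nondegenerate d q.field)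
        (form_isSymm d q.field) (orthogonal_eq_self_of_finrank_eq hmi hd)
        (orthogonal_eq_self_of_finrank_eq (hM q).1 (hM q).2) g hg.1 hg.2
      exact if_congr ⟨fun h => hpar.trans h, fun h => hpar.symm.trans h⟩ rfl rfl
    · rw [if_neg hd, if_neg hd]
  refine ⟨fun i j => ?_, hcomp V W hW, hcomp V' W' hW'⟩
  rw [hW, hW', ← Submodule.map_inf _ g.injective, finrank_map_isometry g]

/-- Since the group preserves labels, dependence on the label alone already gives invariance. -/
theorem mem_invariantFunctions (hM : ∀ q, IsMaximalIsotropic (M q)) {f : FunctionFamily n d}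
    (hf : ∀ (q q' : OddPrimePower) (V V' : Flags n d q) (W W' : Flags n d q'),
      SamePosition M V V' W W' → f q V V' = f q' W W') : f ∈ invariantFunctions n M :=
  ⟨fun q _ hg _ _ _ _ hW hW' => (hf q q _ _ _ _ (samePosition_map hM hg hW hW')).symm, hf⟩

theorem generatorFunction_mem (hd : 0 < d) (hM : ∀ q, IsMaximalIsotropic (M q)) (s : Gen n) :
    generatorFunction n M s ∈ invariantFunctions n M := by
  classical
  apply mem_invariantFunctions hM
  intro q q' V V' W W' h
  cases s with
  | E i =>
    simp only [generatorFunction, funE]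
    exact if_congr h.below_iff (by rw [h.gap_right]) rfl
  | F i =>
    simp only [generatorFunction, funF]
    exact if_congr h.swap.below_iff (by rw [h.gap_right]) rfl
  | H a =>
    simp only [generatorFunction, funH]
    exact if_congr h.eq_iff (by rw [h.gap_right]) rfl
  | Hinv a =>
    simp only [generatorFunction, funHinv]
    exact if_congr h.eq_iff (by rw [h.gap_right]) rfl
  | J α =>
    simp only [generatorFunction, funJ_eq hd]
    exact if_congr (and_congr h.eq_iff (by rw [h.2.1])) rfl rfl

end Invariance

end TypeD

namespace TypeD

open IsotropicFlag

/-! ### Passage between the generic algebra and its specializations. -/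

section Transfer

variable {n d : ℕ} {M : SubspaceFamily d}

/-- The component at `q` of an element of the convolution algebra. -/
noncomputable def evalAt (M : SubspaceFamily d) (q : OddPrimePower) :
    convolutionAlgebra n M →+* Matrix (Flags n d q) (Flags n d q) ℝ :=
  (Pi.evalRingHom (fun q : OddPrimePower => Matrix (Flags n d q) (Flags n d q) ℝ) q :
    ConvolutionProduct n d →+* Matrix (Flags n d q) (Flags n d q) ℝ).comp
    (convolutionAlgebra n M).val.toRingHom

theorem evalAt_ext {a b : convolutionAlgebra n M} (h : ∀ q, evalAt M q a = evalAt M q b) :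
    a = b := Subtype.ext (funext h)

theorem evalAt_algebraMap (q : OddPrimePower) (c : LaurentA) :
    evalAt M q (algebraMap LaurentA (convolutionAlgebra n M) c) =
      algebraMap ℝ (Matrix (Flags n d q) (Flags n d q) ℝ) (specialize q c) := rfl

theorem evalAt_smul (q : OddPrimePower) (c : LaurentA) (a : convolutionAlgebra n M) :
    evalAt M q (c • a) = specialize q c • evalAt M q a := by
  rw [Algebra.smul_def, map_mul, evalAt_algebraMap, Algebra.smul_def]

/-- The real number `√q`. -/
noncomputable def OddPrimePower.sqrt (q : OddPrimePower) : ℝ := q.sqrtUnit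

theorem OddPrimePower.sqrt_ne_zero (q : OddPrimePower) : q.sqrt ≠ 0 := q.sqrtUnit.ne_zero

theorem OddPrimePower.natCard_eq_sqrt_sq (q : OddPrimePower) :
    (Nat.card q.field : ℝ) = q.sqrt ^ 2 := by
  rw [q.natCard_field]
  push_cast
  exact (Real.sq_sqrt (by positivity)).symm

theorem specialize_T (q : OddPrimePower) (k : ℤ) :
    specialize q (LaurentPolynomial.T k) = q.sqrt ^ k := by
  rw [specialize, LaurentPolynomial.eval₂_T, Units.val_zpow_eq_zpow_val]
  rfl

theorem evalAt_generator (hd : 0 < d) (hM : ∀ q, IsMaximalIsotropic (M q)) (q : OddPrimePower)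
    (s : Gen n) :
    evalAt M q (toAlgebra ⟨generatorFunction n M s, generatorFunction_mem hd hM s⟩) =
      genMatrix q.sqrt (M q) s := by
  classical
  ext V W
  change specialize q (generatorFunction n M s q V W) = _
  cases s with
  | E i =>
    simp only [genMatrix, torus]
    rw [Matrix.mul_diagonal, incid_apply, ite_mul, one_mul, zero_mul]
    simp only [generatorFunction, funE]
    rw [apply_ite (specialize q), map_zero, specialize_T]
    exact if_congr Iff.rfl rfl rfl
  | F i =>
    simp only [genMatrix, torus]
    rw [Matrix.mul_diagonal, Matrix.transpose_apply, incid_apply, ite_mul, one_mul, zero_mul]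
    simp only [generatorFunction, funF]
    rw [apply_ite (specialize q), map_zero, specialize_T]
    exact if_congr Iff.rfl rfl rfl
  | H a =>
    simp only [genMatrix, torus, generatorFunction, funH]
    rw [apply_ite (specialize q), map_zero, specialize_T, Matrix.diagonal_apply]
    split_ifs with h
    · rw [h]
      rfl
    · rfl
  | Hinv a =>
    simp only [genMatrix, torus, generatorFunction, funHinv]
    rw [apply_ite (specialize q), map_zero, specialize_T, Matrix.diagonal_apply]
    split_ifs with h
    · rw [h]
    · rfl
  | J α =>
    simp only [genMatrix, componentMatrix, generatorFunction, funJ_eq hd]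
    rw [apply_ite (specialize q), map_zero, map_one, Matrix.diagonal_apply]
    split_ifs <;> simp_all

theorem algebraMap_T (k : ℤ) :
    algebraMap LaurentA FieldQv (LaurentPolynomial.T k) = vv ^ k := by
  let u : LaurentAˣ := ⟨LaurentPolynomial.T 1, LaurentPolynomial.T (-1),
    by rw [← LaurentPolynomial.T_add]; rfl, by rw [← LaurentPolynomial.T_add]; rfl⟩
  have hu : ∀ m : ℕ, ((u ^ m : LaurentAˣ) : LaurentA) = LaurentPolynomial.T m := by
    intro m
    rw [Units.val_pow_eq_pow_val]
    change LaurentPolynomial.T 1 ^ m = _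
    rw [LaurentPolynomial.T_pow, mul_one]
  have hv : algebraMap LaurentA FieldQv (u : LaurentA) = vv := rfl
  have hnat : ∀ m : ℕ, algebraMap LaurentA FieldQv (LaurentPolynomial.T m) = vv ^ m := by
    intro m
    rw [← hu, Units.val_pow_eq_pow_val, map_pow, hv]
  obtain ⟨m, rfl | rfl⟩ := k.eq_nat_or_neg
  · rw [hnat, zpow_natCast]
  · rw [zpow_neg, zpow_natCast, ← hnat]
    refine eq_inv_of_mul_eq_one_left ?_
    rw [← map_mul, ← LaurentPolynomial.T_add, neg_add_cancel]
    exact map_one _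

/-- This allows the denominator to be cleared, so that a relation can be pulled back from ℚ(v) to
ℤ[v, v⁻¹]. -/
theorem vv_sub_inv_ne_zero : vv - vv⁻¹ ≠ 0 := by
  have h : vv - vv⁻¹ =
      algebraMap LaurentA FieldQv (LaurentPolynomial.T 1 - LaurentPolynomial.T (-1)) := by
    rw [map_sub, algebraMap_T, algebraMap_T, zpow_one, zpow_neg_one]
  rw [h, Ne, FaithfulSMul.algebraMap_eq_zero_iff, sub_eq_zero]
  intro h'
  have := congrArg (fun f : LaurentA => f.coeff 1) h'
  simp at this

/-- A relation with coefficients in ℤ[v, v⁻¹] is thereby the image of one in the convolution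
algebra, where it can be tested at every q. -/
theorem tmul_smul_eq (c : LaurentA) (a : convolutionAlgebra n M) :
    (Algebra.TensorProduct.includeRight (c • a) : FieldQv ⊗[LaurentA] convolutionAlgebra n M) =
      algebraMap LaurentA FieldQv c • Algebra.TensorProduct.includeRight a := by
  rw [map_smul, algebraMap_smul]

end Transfer

end TypeD

namespace TypeD

open IsotropicFlag

/-! ### The relations over ℚ(v) from those at every q. -/

section Relations

variable {n d : ℕ} {M : SubspaceFamily d}

theorem vv_add_inv : vv + vv⁻¹ =
    algebraMap LaurentA FieldQv (LaurentPolynomial.T 1 + LaurentPolynomial.T (-1)) := by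
  rw [map_add, algebraMap_T, algebraMap_T, zpow_one, zpow_neg_one]

theorem vv_sub_inv : vv - vv⁻¹ =
    algebraMap LaurentA FieldQv (LaurentPolynomial.T 1 - LaurentPolynomial.T (-1)) := by
  rw [map_sub, algebraMap_T, algebraMap_T, zpow_one, zpow_neg_one]

theorem specialize_T_sub (q : OddPrimePower) :
    specialize q (LaurentPolynomial.T 1 - LaurentPolynomial.T (-1)) = q.sqrt - q.sqrt⁻¹ := by
  rw [map_sub, specialize_T, specialize_T, zpow_one, zpow_neg_one]

/-- Relations between the specializations at all `q` give the relations of `U`. -/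
theorem satisfiesRelations_of_evalAt (hM : ∀ q, IsMaximalIsotropic (M q))
    {x : Gen n → convolutionAlgebra n M}
    (hx : ∀ q s, evalAt M q (x s) = genMatrix q.sqrt (M q) s) :
    SatisfiesRelations (fun s =>
      ((1 : FieldQv) ⊗ₜ[LaurentA] x s : FieldQv ⊗[LaurentA] convolutionAlgebra n M)) := by
  set ι : convolutionAlgebra n M →ₐ[LaurentA] FieldQv ⊗[LaurentA] convolutionAlgebra n M :=
    Algebra.TensorProduct.includeRight
  have hι : ∀ (c : LaurentA) (a : convolutionAlgebra n M),
      algebraMap LaurentA FieldQv c • ι a = ι (c • a) := fun c a => (tmul_smul_eq c a).symm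
  change SatisfiesRelations fun s => ι (x s)
  refine
  { J_sum := ?_, J_mul := fun α β => ?_, J_H := fun α a => ?_, J_E := fun α hα i => ?_,
    F_J := fun α hα i => ?_, J_F_E := fun α β hαβ i hi => ?_, H_H := fun a b => ?_,
    H_Hinv := fun a => ?_, Hinv_H := fun a => ?_, H_E := fun a i => ?_, H_F := fun a i => ?_,
    E_F := fun i j hij => ?_, E_E := fun i j hij => ?_, F_F := fun i j hij => ?_,
    serre_E := fun i j hij => ?_, serre_F := fun i j hij => ?_, E_E_F := fun i hi => ?_,
    F_F_E := fun i hi => ?_ }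
  · simp only [← map_add]
    rw [← map_one ι]
    refine congrArg ι (evalAt_ext fun q => ?_)
    simp only [map_add, map_one, hx]
    exact gen_J_sum
  · rw [← map_mul, ← map_zero ι, ← apply_ite ι]
    refine congrArg ι (evalAt_ext fun q => ?_)
    rw [apply_ite (evalAt M q)]
    simp only [map_mul, map_zero, hx]
    exact gen_J_mul α β
  · simp only [← map_mul]
    refine congrArg ι (evalAt_ext fun q => ?_)
    simp only [map_mul, hx]
    exact gen_J_H α a
  · simp only [← map_mul]
    rw [← map_zero ι, ← apply_ite ι]
    refine congrArg ι (evalAt_ext fun q => ?_)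
    rw [apply_ite (evalAt M q)]
    simp only [map_mul, map_zero, hx]
    exact gen_J_E hα i
  · simp only [← map_mul]
    rw [← map_zero ι, ← apply_ite ι]
    refine congrArg ι (evalAt_ext fun q => ?_)
    rw [apply_ite (evalAt M q)]
    simp only [map_mul, map_zero, hx]
    exact gen_F_J hα i
  · have e : Fin.last n = i.succ := Fin.ext hi.symm
    -- Multiplying by v - v⁻¹ makes all coefficients integral, so both sides come from the
    -- convolution algebra.
    rw [e, smul_mul_assoc, eq_inv_smul_iff₀ vv_sub_inv_ne_zero, vv_sub_inv]
    simp only [← map_mul, ← map_sub ι, hι]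
    refine congrArg ι (evalAt_ext fun q => ?_)
    rw [evalAt_smul, specialize_T_sub]
    simp only [map_mul, map_sub, hx]
    exact gen_J_F_E q.two_ne_zero (hM q) q.sqrt_ne_zero q.natCard_eq_sqrt_sq hi hαβ
  · simp only [← map_mul]
    refine congrArg ι (evalAt_ext fun q => ?_)
    simp only [map_mul, hx]
    exact gen_H_H q.sqrt_ne_zero a b
  · rw [← map_mul, ← map_one ι]
    refine congrArg ι (evalAt_ext fun q => ?_)
    simp only [map_mul, map_one, hx]
    exact gen_H_Hinv q.sqrt_ne_zero a
  · rw [← map_mul, ← map_one ι]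
    refine congrArg ι (evalAt_ext fun q => ?_)
    simp only [map_mul, map_one, hx]
    exact gen_Hinv_H q.sqrt_ne_zero a
  · rw [show ((if a = i.castSucc then 1 else 0) - (if a = i.succ then 1 else 0)
      - (if a = Fin.last n ∧ (i : ℕ) + 1 = n then 1 else 0) : ℤ) = -gapShift a i by
        rw [gapShift]; ring, ← algebraMap_T]
    simp only [← map_mul ι, hι]
    refine congrArg ι (evalAt_ext fun q => ?_)
    rw [evalAt_smul, specialize_T]
    simp only [map_mul, hx]
    exact gen_H_E q.sqrt_ne_zero a i
  · change _ = vv ^ gapShift a i • _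
    rw [← algebraMap_T]
    simp only [← map_mul ι, hι]
    refine congrArg ι (evalAt_ext fun q => ?_)
    rw [evalAt_smul, specialize_T]
    simp only [map_mul, hx]
    exact gen_H_F q.sqrt_ne_zero a i
  · by_cases h : i = j
    · subst h
      have hi : (i : ℕ) + 1 ≠ n := fun h => hij ⟨h, h⟩
      rw [if_pos rfl, eq_inv_smul_iff₀ vv_sub_inv_ne_zero, vv_sub_inv]
      simp only [← map_mul, ← map_sub ι, hι]
      refine congrArg ι (evalAt_ext fun q => ?_)
      rw [evalAt_smul, specialize_T_sub]
      simp only [map_mul, map_sub, hx]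
      exact gen_E_F_self q.sqrt_ne_zero q.natCard_eq_sqrt_sq hi
    · rw [if_neg h]
      simp only [← map_mul, ← map_sub ι]
      rw [← map_zero ι]
      refine congrArg ι (evalAt_ext fun q => ?_)
      simp only [map_mul, map_sub, map_zero, hx]
      exact gen_E_F_of_ne q.sqrt_ne_zero h
  · simp only [← map_mul]
    refine congrArg ι (evalAt_ext fun q => ?_)
    simp only [map_mul, hx]
    exact gen_E_E q.sqrt_ne_zero hij
  · simp only [← map_mul]
    refine congrArg ι (evalAt_ext fun q => ?_)
    simp only [map_mul, hx]
    exact gen_F_F q.sqrt_ne_zero hij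
  · rw [vv_add_inv]
    simp only [← map_mul ι, ← map_pow ι, hι, ← map_sub ι, ← map_add ι]
    rw [← map_zero ι]
    refine congrArg ι (evalAt_ext fun q => ?_)
    simp only [map_add, map_sub, map_zero, evalAt_smul, specialize_T, zpow_one, zpow_neg_one,
      map_mul, map_pow, hx]
    exact gen_serre_E q.sqrt_ne_zero q.natCard_eq_sqrt_sq hij
  · rw [vv_add_inv]
    simp only [← map_mul ι, ← map_pow ι, hι, ← map_sub ι, ← map_add ι]
    rw [← map_zero ι]
    refine congrArg ι (evalAt_ext fun q => ?_)
    simp only [map_add, map_sub, map_zero, evalAt_smul, specialize_T, zpow_one, zpow_neg_one,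
      map_mul, map_pow, hx]
    exact gen_serre_F q.sqrt_ne_zero q.natCard_eq_sqrt_sq hij
  · have e : Fin.last n = i.succ := Fin.ext hi.symm
    have h1 : vv = algebraMap LaurentA FieldQv (LaurentPolynomial.T 1) := rfl
    have h2 : vv⁻¹ = algebraMap LaurentA FieldQv (LaurentPolynomial.T (-1)) := by
      rw [algebraMap_T, zpow_neg_one]
    rw [e, vv_add_inv, h2, h1]
    simp only [← map_mul ι, ← map_pow ι, hι, ← map_sub ι, ← map_add ι]
    refine congrArg ι (evalAt_ext fun q => ?_)
    simp only [map_add, map_sub, evalAt_smul, specialize_T, zpow_one, zpow_neg_one,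
      map_mul, map_pow, hx]
    exact gen_E_E_F q.two_ne_zero q.sqrt_ne_zero q.natCard_eq_sqrt_sq hi
  · have e : Fin.last n = i.succ := Fin.ext hi.symm
    have h1 : vv = algebraMap LaurentA FieldQv (LaurentPolynomial.T 1) := rfl
    have h2 : vv⁻¹ = algebraMap LaurentA FieldQv (LaurentPolynomial.T (-1)) := by
      rw [algebraMap_T, zpow_neg_one]
    rw [e, vv_add_inv, h2, h1]
    simp only [← map_mul ι, ← map_pow ι, hι, ← map_sub ι, ← map_add ι]
    refine congrArg ι (evalAt_ext fun q => ?_)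
    simp only [map_add, map_sub, evalAt_smul, specialize_T, zpow_one, zpow_neg_one,
      map_mul, map_pow, hx]
    exact gen_F_F_E q.two_ne_zero q.sqrt_ne_zero q.natCard_eq_sqrt_sq hi

end Relations

end TypeD

theorem mainTheorem8 (n d : ℕ) (hn : 0 < n) (hd : 0 < d) (M : TypeD.SubspaceFamily d)
    (hM : ∀ q, TypeD.IsMaximalIsotropic (M q)) :
    ∃ hmem : ∀ s : TypeD.Gen n, TypeD.generatorFunction n M s ∈ TypeD.invariantFunctions n M,
      let x : TypeD.Gen n → TypeD.convolutionAlgebra n M :=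
        fun s => TypeD.toAlgebra ⟨TypeD.generatorFunction n M s, hmem s⟩
      TypeD.SatisfiesRelations (fun s =>
        ((1 : TypeD.FieldQv) ⊗ₜ[TypeD.LaurentA] x s :
          TypeD.FieldQv ⊗[TypeD.LaurentA] TypeD.convolutionAlgebra n M)) ∧
      x (.H (Fin.last n)) * (List.ofFn fun i : Fin n => x (.H i.castSucc) ^ 2).prod =
        algebraMap TypeD.LaurentA (TypeD.convolutionAlgebra n M)
          (LaurentPolynomial.T (-(2 * d : ℤ))) ∧
      ∀ j : Fin n, ((List.range (d + 1)).map fun l : ℕ =>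
        x (.H j.castSucc) - algebraMap TypeD.LaurentA (TypeD.convolutionAlgebra n M)
          (LaurentPolynomial.T (-(l : ℤ)))).prod = 0 := by
  refine ⟨TypeD.generatorFunction_mem hd hM, ?_⟩
  intro x
  have hx : ∀ q s, TypeD.evalAt M q (x s) = TypeD.IsotropicFlag.genMatrix q.sqrt (M q) s :=
    TypeD.evalAt_generator hd hM
  refine ⟨TypeD.satisfiesRelations_of_evalAt hM hx, TypeD.evalAt_ext fun q => ?_,
    fun j => TypeD.evalAt_ext fun q => ?_⟩
  · rw [map_mul, map_list_prod, List.map_ofFn, hx, TypeD.evalAt_algebraMap, TypeD.specialize_T,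
      ← TypeD.gen_H_prod (M := M q) q.sqrt_ne_zero hn]
    congr 3
    funext i
    rw [Function.comp_apply, map_pow, hx]
  · rw [map_list_prod, List.map_map, map_zero, ← TypeD.gen_H_minpoly (M := M q) (v := q.sqrt) j]
    congr 2
    funext l
    rw [Function.comp_apply, map_sub, hx, TypeD.evalAt_algebraMap, TypeD.specialize_T]
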